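/- **Theorem (P-completeness of the Object Usage Decision Problem).** The Object Usage Decision Problem (OUDP) is $\mathbf{P}$-complete under logarithmic-space many-one reductions: OUDP belongs to $\mathbf{P}$ (it is decided by a deterministic Turing machine in time polynomial in the input length), and for every language $L \in \mathbf{P}$ over a finite alphabet there is a function $f$, computable by a deterministic Turing machine in logarithmic space, such that $w \in L \iff f(w) \in \mathrm{OUDP}$ for all words $w$. This holds for every gas schedule, i.e. every assignment of a positive integer price to each operation code of the following virtual machine. *Virtual machine.* A blockchain state $s$ assigns to each object name (a bit string) a value (a bit string; empty for an object that does not exist). A transaction $tx = (t, g, \mathrm{ins}, R, W)$ consists of a declared compute bound $t$ and a price $g$ (metadata without effect on the execution), a finite sequence $\mathrm{ins}$ of instructions, and finite declared read and write sets $R$, $W$ of objects. Instructions are executed in order, starting from the first. They are: $\mathtt{label}\ \ell$ (marks a jump destination); $\mathtt{jump}\ \ell$ (continue at the first $\mathtt{label}\ \ell$; the execution ends if there is none); $\mathtt{read}\ o\ \ell_0\ \ell_1$ (read the first bit of the value of $o$ and jump to $\ell_0$ if it is $0$, to $\ell_1$ if it is $1$; continue with the next instruction if the value is empty); $\mathtt{push}\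 o\ b$ (prepend the bit $b$ to the value of $o$); $\mathtt{pop}\ o$ (delete the first bit of the value of $o$, if any); $\mathtt{halt}$. Every executed instruction consumes the price of its operation code. The execution ends at $\mathtt{halt}$, at the end of the sequence, when the remaining gas does not pay for the current instruction, or when the current instruction would read an object outside $R$ or write ($\mathtt{push}$ or $\mathtt{pop}$) an object outside $W$; such an unpaid or undeclared instruction is not carried out. *Object Usage Machine and OUDP.* On $(o, tx, s, G)$, the Object Usage Machine executes $tx$ on $s$ with gas limit $G$; it outputs $\mathsf{ACCEPT}$ if $o$ is accessed (read or written) by an executed instruction, i.e. within total gas $G$ including the price of the access, and $\mathsf{REJECT}$ otherwise. OUDP asks, given $(o, tx, s, G)$ with $G$ written in unary, $t$ and $g$ in binary, and $s$ given as a finite list of objects with their values (the first entry for an object counts, unlisted objects do not exist), whether the Object Usage Machine outputs $\mathsf{ACCEPT}$. Words that encode no instance are not in OUDP. -/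

import Mathlib

namespace ObjectUsage

/-! ## The class P, logarithmic-space reductions, P-completeness -/

/-- `L` is in P: a deterministic Turing machine decides membership in `L` for every input word,
in time polynomial in the length of the word. -/
def InP {α : Type} (L : Language α) : Prop :=
  Nonempty (Turing.TM2ComputableInPolyTime (fun w : List α => w) Computability.encodeBool
    (fun w : List α => @decide (w ∈ L) (Classical.propDecidable _)))

/-- Moves of a tape head. -/
inductive Move where
  | left
  | stay
  | right

/-- What the input head can see: a letter of the input, or one of the two end markers. -/
inductive InCell (α : Type) where
  | leftEnd
  | letter (a : α)
  | rightEnd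

/-- What a transducer does in one step: the new control state, the move of the input head, the
symbols written on the work tapes and the moves of their heads, and the output symbols emitted. -/
structure Action (Q Γ β : Type) (k : ℕ) where
  next : Q
  inMove : Move
  write : Fin k → Γ
  workMove : Fin k → Move
  emit : List β

/-- A deterministic Turing machine with a two-way read-only input tape over `α`, finitely many
one-way infinite work tapes, and a write-only output tape over `β`. It halts where the transition
function is `none`. -/
structure Transducer (α β : Type) where
  Q : Type
  finQ : Finite Q
  Γ : Type
  finΓ : Finite Γ
  k : ℕ
  blank : Γ
  start : Q
  δ : Q → InCell α → (Fin k → Γ) → Option (Action Q Γ β k)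

namespace Transducer

variable {α β : Type}

/-- Configurations of a transducer. Input position `0` carries the left end marker, position
`i + 1` carries the `i`-th letter, and position `length + 1` carries the right end marker. -/
structure Cfg (T : Transducer α β) where
  state : T.Q
  inPos : ℕ
  work : Fin T.k → ℕ → T.Γ
  workPos : Fin T.k → ℕ
  out : List β

/-- The content of an input cell. -/
def readInput (w : List α) : ℕ → InCell α
  | 0 => .leftEnd
  | i + 1 =>
    match w[i]? with
    | some a => .letter a
    | none => .rightEnd

/-- Moving the input head over a word of length `n`; it never leaves the end markers. -/
def moveIn (n : ℕ) : Move → ℕ → ℕ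
  | .left, p => p - 1
  | .stay, p => p
  | .right, p => min (p + 1) (n + 1)

/-- Moving a work head; a left move in the leftmost cell has no effect. -/
def moveWork : Move → ℕ → ℕ
  | .left, p => p - 1
  | .stay, p => p
  | .right, p => p + 1

/-- The initial configuration: blank work tapes, all heads in their leftmost cell, no output. -/
def init (T : Transducer α β) : T.Cfg where
  state := T.start
  inPos := 0
  work := fun _ _ => T.blank
  workPos := fun _ => 0
  out := []

/-- One step of the transducer on the input `w`. -/
def step (T : Transducer α β) (w : List α) (c : T.Cfg) : Option T.Cfg :=
  (T.δ c.state (readInput w c.inPos) (fun i => c.work i (c.workPos i))).map fun a =>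
    { state := a.next
      inPos := moveIn w.length a.inMove c.inPos
      work := fun i => Function.update (c.work i) (c.workPos i) (a.write i)
      workPos := fun i => moveWork (a.workMove i) (c.workPos i)
      out := c.out ++ a.emit }

/-- `T` halts on every input `w` with output `f w`. -/
def Computes (T : Transducer α β) (f : List α → List β) : Prop :=
  ∀ w, ∃ c, StateTransition.Reaches (T.step w) T.init c ∧ T.step w c = none ∧ c.out = f w

/-- On inputs of length `n`, only the first `O(log n)` cells of the work tapes are visited (the
additive constant takes care of `n ≤ 1`). Input and output tapes do not count. -/
def UsesLogSpace (T : Transducer α β) : Prop :=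
  ∃ C : ℕ, ∀ w c, StateTransition.Reaches (T.step w) T.init c →
    ∀ i, c.workPos i ≤ C * Nat.log 2 w.length + C

end Transducer

/-- `f` is computable in logarithmic space. -/
def LogSpaceComputable {α β : Type} (f : List α → List β) : Prop :=
  ∃ T : Transducer α β, T.Computes f ∧ T.UsesLogSpace

/-- Many-one reducibility in logarithmic space. -/
def LogSpaceReducible {α β : Type} (L : Language α) (L' : Language β) : Prop :=
  ∃ f : List α → List β, LogSpaceComputable f ∧ ∀ w, w ∈ L ↔ f w ∈ L'

/-- Every language in P, over any finite alphabet, reduces to `L` in logarithmic space. -/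
def PHard {β : Type} (L : Language β) : Prop :=
  ∀ (α : Type) [Finite α] (L' : Language α), InP L' → LogSpaceReducible L' L

/-- P-completeness. -/
def PComplete {β : Type} (L : Language β) : Prop :=
  InP L ∧ PHard L

/-! ## Transactions and their execution -/

/-- Names of objects are bit strings. -/
abbrev ObjId := List Bool

/-- Values of objects are bit strings of arbitrary length. -/
abbrev Value := List Bool

/-- Names of jump destinations are bit strings. -/
abbrev Label := List Bool

/-- A blockchain state assigns a value to every object. Objects that do not exist on the
blockchain have the empty value; writing to such an object creates it. -/
abbrev State := ObjId → Value

/-- Instructions of the virtual machine.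
* `label ℓ` marks a jump destination;
* `jump ℓ` continues at the first instruction `label ℓ` (and ends the execution if there is none);
* `read o ℓ₀ ℓ₁` reads the first bit of the value of `o` and jumps to `ℓ₀` if it is `0`, to `ℓ₁` if
  it is `1`, and continues with the next instruction if the value is empty;
* `push o b` puts the bit `b` in front of the value of `o`;
* `pop o` deletes the first bit of the value of `o` (if there is one);
* `halt` ends the execution. -/
inductive Instr where
  | label (ℓ : Label)
  | jump (ℓ : Label)
  | read (o : ObjId) (ℓ₀ ℓ₁ : Label)
  | push (o : ObjId) (b : Bool)
  | pop (o : ObjId)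
  | halt
  deriving DecidableEq

/-- Operation codes. -/
inductive Op where
  | label
  | jump
  | read
  | push
  | pop
  | halt

/-- The operation code of an instruction. -/
def Instr.op : Instr → Op
  | .label _ => .label
  | .jump _ => .jump
  | .read _ _ _ => .read
  | .push _ _ => .push
  | .pop _ => .pop
  | .halt => .halt

/-- A gas schedule: every operation has a fixed positive price. -/
structure GasSchedule where
  cost : Op → ℕ
  cost_pos : ∀ p, 0 < cost p

/-- A transaction: the declared bound `t` on its compute units, the price `g` offered per unit, its
instruction sequence, and its declared read and write sets. The values `t` and `g` are metadata and
do not influence the execution. -/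
structure Transaction where
  t : ℕ
  g : ℕ
  ins : List Instr
  readSet : List ObjId
  writeSet : List ObjId

/-- A configuration of the virtual machine: the instructions from the current one on, the current
blockchain state, the gas left, and the objects read and written so far. -/
structure Cfg where
  rest : List Instr
  state : State
  gas : ℕ
  usedRead : Finset ObjId
  usedWrite : Finset ObjId

/-- The part of the instruction sequence from the first instruction `label ℓ` on. -/
def Transaction.seek (tx : Transaction) (ℓ : Label) : List Instr :=
  tx.ins.dropWhile fun i => decide (i ≠ Instr.label ℓ)

/-- One step of the virtual machine. The execution ends (value `none`) at the end of the instruction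
sequence, at `halt`, when the gas left does not pay for the current instruction, and when the
current instruction reads an object outside the declared read set or writes to an object outside
the declared write set. In these cases the current instruction is not carried out. -/
def step (gs : GasSchedule) (tx : Transaction) (c : Cfg) : Option Cfg :=
  match c.rest with
  | [] => none
  | i :: is =>
    if c.gas < gs.cost i.op then none
    else
      let gas := c.gas - gs.cost i.op
      match i with
      | .label _ => some { c with rest := is, gas := gas }
      | .jump ℓ => some { c with rest := tx.seek ℓ, gas := gas }
      | .read o ℓ₀ ℓ₁ =>
        if o ∈ tx.readSet then
          some { c with
            rest := match c.state o with
              | [] => is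
              | false :: _ => tx.seek ℓ₀
              | true :: _ => tx.seek ℓ₁
            gas := gas
            usedRead := insert o c.usedRead }
        else none
      | .push o b =>
        if o ∈ tx.writeSet then
          some { c with
            rest := is
            state := Function.update c.state o (b :: c.state o)
            gas := gas
            usedWrite := insert o c.usedWrite }
        else none
      | .pop o =>
        if o ∈ tx.writeSet then
          some { c with
            rest := is
            state := Function.update c.state o (c.state o).tail
            gas := gas
            usedWrite := insert o c.usedWrite }
        else none
      | .halt => none

/-- The start of the execution of `tx` on the state `s` with gas limit `G`. -/
def start (tx : Transaction) (s : State) (G : ℕ) : Cfg where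
  rest := tx.ins
  state := s
  gas := G
  usedRead := ∅
  usedWrite := ∅

/-- `o` is accessed (read or written) within gas `G` when `tx` is executed on `s`: at some point of
the execution with gas limit `G`, the object `o` is among the used objects. -/
def Accesses (gs : GasSchedule) (tx : Transaction) (s : State) (o : ObjId) (G : ℕ) : Prop :=
  ∃ c, StateTransition.Reaches (step gs tx) (start tx s G) c ∧ (o ∈ c.usedRead ∨ o ∈ c.usedWrite)

/-- Outputs of the Object Usage Machine. -/
inductive Verdict where
  | accept
  | reject

open Classical in
/-- The output of the Object Usage Machine. -/
noncomputable def oum (gs : GasSchedule) (tx : Transaction) (s : State) (o : ObjId) (G : ℕ) :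
    Verdict :=
  if Accesses gs tx s o G then .accept else .reject

/-! ## The Object Usage Decision Problem -/

/-- An instance: an object, a transaction, a state given by a finite list of objects with their
values (the first entry of an object counts, objects that are not listed do not exist), and a gas
limit. -/
structure Instance where
  obj : ObjId
  tx : Transaction
  state : List (ObjId × Value)
  gas : ℕ

/-- The state that a list of objects and values describes. -/
def stateOf (l : List (ObjId × Value)) : State := fun o => (l.lookup o).getD []

/-- The finite alphabet in which instances are written: bits, operation codes, a terminator of bit
strings, a terminator of lists, and the unary digit. -/
inductive Tok where
  | bit (b : Bool)
  | op (p : Op)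
  | term
  | close
  | one

/-- A bit string with its terminator. -/
def encBits (u : List Bool) : List Tok := u.map Tok.bit ++ [Tok.term]

/-- A natural number in binary. -/
def encNat (n : ℕ) : List Tok := encBits (Computability.encodeNat n)

/-- A list of items with its terminator. -/
def encList {X : Type} (enc : X → List Tok) (l : List X) : List Tok := l.flatMap enc ++ [Tok.close]

/-- An instruction: its operation code and its arguments. -/
def encInstr : Instr → List Tok
  | .label ℓ => .op .label :: encBits ℓ
  | .jump ℓ => .op .jump :: encBits ℓ
  | .read o ℓ₀ ℓ₁ => .op .read :: (encBits o ++ encBits ℓ₀ ++ encBits ℓ₁)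
  | .push o b => .op .push :: .bit b :: encBits o
  | .pop o => .op .pop :: encBits o
  | .halt => [.op .halt]

/-- An object with its value. -/
def encEntry (p : ObjId × Value) : List Tok := encBits p.1 ++ encBits p.2

/-- A transaction. -/
def encTx (tx : Transaction) : List Tok :=
  encNat tx.t ++ encNat tx.g ++ encList encInstr tx.ins ++ encList encBits tx.readSet ++
    encList encBits tx.writeSet

/-- An instance; the gas limit is written in unary. -/
def Instance.encode (x : Instance) : List Tok :=
  encBits x.obj ++ encTx x.tx ++ encList encEntry x.state ++ List.replicate x.gas Tok.one

theorem encBits_append_inj {u v : List Bool} {x y : List Tok}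
    (h : encBits u ++ x = encBits v ++ y) : u = v ∧ x = y := by
  induction u generalizing v with
  | nil => cases v <;> simp_all [encBits]
  | cons a u ih =>
    cases v with
    | nil => simp [encBits] at h
    | cons b v =>
      simp only [encBits, List.map_cons, List.cons_append, List.cons.injEq, Tok.bit.injEq] at h
      obtain ⟨h1, h2⟩ := ih (v := v) (by simpa [encBits] using h.2)
      exact ⟨by rw [h.1, h1], h2⟩

theorem encNat_append_inj {m n : ℕ} {x y : List Tok}
    (h : encNat m ++ x = encNat n ++ y) : m = n ∧ x = y := by
  obtain ⟨h1, h2⟩ := encBits_append_inj h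
  refine ⟨?_, h2⟩
  rw [← Computability.decode_encodeNat m, h1, Computability.decode_encodeNat]

theorem encList_append_inj {X : Type} {enc : X → List Tok}
    (hne : ∀ a x y, enc a ++ x ≠ Tok.close :: y)
    (hinj : ∀ a b x y, enc a ++ x = enc b ++ y → a = b ∧ x = y)
    {l m : List X} {x y : List Tok} (h : encList enc l ++ x = encList enc m ++ y) :
    l = m ∧ x = y := by
  induction l generalizing m with
  | nil =>
    cases m with
    | nil => simpa [encList] using h
    | cons b m => exact absurd (by simpa [encList] using h.symm) (hne b _ x)
  | cons a l ih =>
    cases m with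
    | nil => exact absurd (by simpa [encList] using h) (hne a _ y)
    | cons b m =>
      obtain ⟨h1, h2⟩ := hinj a b (encList enc l ++ x) (encList enc m ++ y)
        (by simpa [encList] using h)
      obtain ⟨h3, h4⟩ := ih h2
      exact ⟨by rw [h1, h3], h4⟩

theorem encBits_append_ne_close (a : List Bool) (x y : List Tok) :
    encBits a ++ x ≠ Tok.close :: y := by
  cases a <;> simp [encBits]

theorem encInstr_append_inj (a b : Instr) (x y : List Tok)
    (h : encInstr a ++ x = encInstr b ++ y) : a = b ∧ x = y := by
  cases a <;> cases b <;> simp [encInstr] at h ⊢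
  case label.label => exact encBits_append_inj h
  case jump.jump => exact encBits_append_inj h
  case read.read =>
    obtain ⟨h1, h⟩ := encBits_append_inj h
    obtain ⟨h2, h⟩ := encBits_append_inj h
    obtain ⟨h3, h⟩ := encBits_append_inj h
    exact ⟨⟨h1, h2, h3⟩, h⟩
  case push.push =>
    obtain ⟨h1, h2⟩ := encBits_append_inj h.2
    exact ⟨⟨h1, h.1⟩, h2⟩
  case pop.pop => exact encBits_append_inj h
  case halt.halt => exact h

/-- Different instances have different encodings. -/
theorem Instance.encode_injective : Function.Injective Instance.encode := by
  rintro ⟨o, ⟨t, g, i, r, w⟩, s, G⟩ ⟨o', ⟨t', g', i', r', w'⟩, s', G'⟩ h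
  simp only [Instance.encode, encTx, List.append_assoc] at h
  obtain ⟨rfl, h1⟩ := encBits_append_inj h
  obtain ⟨rfl, h2⟩ := encNat_append_inj h1
  obtain ⟨rfl, h3⟩ := encNat_append_inj h2
  obtain ⟨rfl, h4⟩ := encList_append_inj
    (by intro a x y; cases a <;> simp [encInstr]) encInstr_append_inj h3
  obtain ⟨rfl, h5⟩ := encList_append_inj encBits_append_ne_close
    (fun _ _ _ _ h => encBits_append_inj h) h4
  obtain ⟨rfl, h6⟩ := encList_append_inj encBits_append_ne_close
    (fun _ _ _ _ h => encBits_append_inj h) h5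
  obtain ⟨rfl, h7⟩ := encList_append_inj
    (by intro a x y; simp only [encEntry, List.append_assoc]; exact encBits_append_ne_close _ _ _)
    (by
      rintro ⟨a, a'⟩ ⟨b, b'⟩ x y h
      simp only [encEntry, List.append_assoc] at h
      obtain ⟨h1, h⟩ := encBits_append_inj h
      obtain ⟨h2, h⟩ := encBits_append_inj h
      exact ⟨by rw [h1, h2], h⟩) h6
  have : G = G' := by simpa using congrArg List.length h7
  rw [this]

/-- The Object Usage Decision Problem, as the language of the encodings of the instances
`(o, tx, s, G)` for which the Object Usage Machine outputs `accept`. -/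
def OUDP (gs : GasSchedule) : Language Tok :=
  {w | ∃ x : Instance, x.encode = w ∧ oum gs x.tx (stateOf x.state) x.obj x.gas = .accept}

end ObjectUsage

/-!
The problem is in P because the virtual machine can be simulated on stacks. The deciding machine
`deciderTM` checks the syntax of its input with a finite automaton (`PState.run_encode` and
`PState.exists_encode`: it accepts precisely the encodings) and keeps a copy of the input in which
every item that has to be found again carries a mark. Everything else is searching: a declaration,
a jump target, the value of an object, and the comparison of an object with the one in question are
all found by looking for a mark that is followed by a given bit string. A new value is put in front
of the memory as a new entry, which hides the old one since the first entry counts. As the gas is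
given in unary and every instruction costs at least one unit, there are at most as many
instructions to execute as the input has letters; each of them takes time polynomial in the size of
the memory, and the memory grows by at most a polynomial amount at each (`decides_main`,
`inP_OUDP`).

For hardness, a language in P is decided by a machine with finitely many stacks in polynomial time,
and objects are as good as stacks: `Compiler.tx` is a transaction that simulates such a machine,
where one object holds the content of one stack, the `j`-th symbol being written as `j` ones and a
zero. The transaction only depends on the machine, not on the input; its instructions sit in blocks,
one for each triple of a statement, a value of the local variable and a phase. When the machine has
halted, the transaction looks at the output and pushes a bit on a separate object, the one in
question, if and only if the output is `true`. One step of the machine costs a bounded amount of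
gas, whatever the prices (`Compiler.exists_acc_iff`). The reduction therefore writes down a fixed
word, the codes of the input letters, another fixed word, and a unary number that exceeds a given
polynomial in the length of the input. Logarithmic space suffices for this
(`exists_logSpaceComputable_pad`): count the letters in base `2` while reading them, go on counting
in a large fixed base on the same cells until all digits overflow, and emit a bounded number of
units at every increment. With `ℓ` binary digits and base `b` this emits about `b ^ ℓ` units, a
power of the input length whose exponent is `log₂ b`.
-/

namespace ObjectUsage

open Turing StateTransition

/-! ### A stack machine that decides the problem -/

instance : DecidableEq Op := fun a b => by
  cases a <;> cases b <;> first | exact isTrue rfl | exact isFalse (by simp)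

instance : Fintype Op :=
  .ofList [.label, .jump, .read, .push, .pop, .halt] (by rintro ⟨⟩ <;> simp)

instance : DecidableEq Tok
  | .bit a, .bit b => decidable_of_iff (a = b) (by simp)
  | .op a, .op b => decidable_of_iff (a = b) (by simp)
  | .term, .term => isTrue rfl
  | .close, .close => isTrue rfl
  | .one, .one => isTrue rfl
  | .bit _, .op _ | .bit _, .term | .bit _, .close | .bit _, .one => isFalse (by simp)
  | .op _, .bit _ | .op _, .term | .op _, .close | .op _, .one => isFalse (by simp)
  | .term, .bit _ | .term, .op _ | .term, .close | .term, .one => isFalse (by simp)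
  | .close, .bit _ | .close, .op _ | .close, .term | .close, .one => isFalse (by simp)
  | .one, .bit _ | .one, .op _ | .one, .term | .one, .close => isFalse (by simp)

instance : Fintype Tok :=
  .ofList [.term, .close, .one, .bit false, .bit true, .op .label, .op .jump, .op .read,
    .op .push, .op .pop, .op .halt] (by
      intro t
      rcases t with b | p | _ | _ | _
      · cases b <;> simp
      · cases p <;> simp
      all_goals simp)

/-- Marks that the decider inserts into its copy of the input, in front of the items that it has to
find again: the entries of the state, the members of the declared read and write sets, the object
of the instance, and the instruction sequence. -/
inductive Mark where
  | entry
  | decl (write : Bool)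
  | obj
  | prog
  deriving DecidableEq, Fintype

/-- The symbols on the work stacks of the decider. -/
inductive Sym where
  | tok (t : Tok)
  | mark (m : Mark)
  deriving DecidableEq, Fintype

/-- The work stacks of the decider: the memory `M` (a marked copy of the input, without the gas), a
copy `X` of the memory which is consumed by a search, scratch space `T`, the bit string `N` that is
searched for, the rest `P` of the instruction sequence, and the gas `G`. -/
inductive Reg where
  | M
  | X
  | T
  | N
  | P
  | G
  deriving DecidableEq

instance : Fintype Reg := .ofList [.M, .X, .T, .N, .P, .G] (by rintro ⟨⟩ <;> simp)

/-- All stacks of the decider. -/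
inductive Stk where
  | inp
  | out
  | reg (r : Reg)
  deriving DecidableEq, Fintype

/-- The stack alphabets of the decider. -/
abbrev StkSym : Stk → Type
  | .inp => Tok
  | .out => Bool
  | .reg _ => Sym

/-- The states of the finite automaton that checks the syntax of the input. -/
inductive PState where
  | obj
  | num (second canonical : Bool)
  | ins
  | args (n : Fin 3)
  | pushBit
  | set (write : Bool)
  | setItem (write : Bool)
  | entries
  | key
  | val
  | gas
  deriving DecidableEq, Fintype

/-- The transition function of the automaton, together with the symbols that go into the memory.
A binary numeral is canonical if it is empty or its last bit is `1`. -/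
def PState.next : PState → Tok → Option (PState × List Sym)
  | .obj, .bit b => some (.obj, [.tok (.bit b)])
  | .obj, .term => some (.num false true, [.tok .term])
  | .num s _, .bit b => some (.num s b, [])
  | .num false true, .term => some (.num true true, [])
  | .num true true, .term => some (.ins, [.mark .prog])
  | .ins, .op .label => some (.args 0, [.tok (.op .label)])
  | .ins, .op .jump => some (.args 0, [.tok (.op .jump)])
  | .ins, .op .read => some (.args 2, [.tok (.op .read)])
  | .ins, .op .push => some (.pushBit, [.tok (.op .push)])
  | .ins, .op .pop => some (.args 0, [.tok (.op .pop)])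
  | .ins, .op .halt => some (.ins, [.tok (.op .halt)])
  | .ins, .close => some (.set false, [.tok .close])
  | .pushBit, .bit b => some (.args 0, [.tok (.bit b)])
  | .args n, .bit b => some (.args n, [.tok (.bit b)])
  | .args 0, .term => some (.ins, [.tok .term])
  | .args 1, .term => some (.args 0, [.tok .term])
  | .args 2, .term => some (.args 1, [.tok .term])
  | .set w, .bit b => some (.setItem w, [.mark (.decl w), .tok (.bit b)])
  | .set w, .term => some (.set w, [.mark (.decl w), .tok .term])
  | .set w, .close => some (cond w .entries (.set true), [.tok .close])
  | .setItem w, .bit b => some (.setItem w, [.tok (.bit b)])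
  | .setItem w, .term => some (.set w, [.tok .term])
  | .entries, .bit b => some (.key, [.mark .entry, .tok (.bit b)])
  | .entries, .term => some (.val, [.mark .entry, .tok .term])
  | .entries, .close => some (.gas, [.tok .close])
  | .key, .bit b => some (.key, [.tok (.bit b)])
  | .key, .term => some (.val, [.tok .term])
  | .val, .bit b => some (.val, [.tok (.bit b)])
  | .val, .term => some (.entries, [.tok .term])
  | .gas, .one => some (.gas, [.tok .one])
  | _, _ => none

/-- The three kinds of accesses to an object. -/
inductive Act where
  | read
  | push (b : Bool)
  | pop
  deriving Fintype

/-- Whether an access is a write. -/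
def Act.isWrite : Act → Bool
  | .read => false
  | _ => true

/-- The purposes of a search in the memory: the start of the program, the target of a jump, the
declaration of an object that is to be accessed, the comparison of this object with the object of
the instance, and the value of the object. -/
inductive Ret where
  | init
  | jump
  | decl (a : Act)
  | obj (a : Act)
  | val (a : Act)
  deriving Fintype

/-- The symbol in front of the items among which a search looks for its key. -/
def Ret.sym : Ret → Sym
  | .init => .mark .prog
  | .jump => .tok (.op .label)
  | .decl a => .mark (.decl a.isWrite)
  | .obj _ => .mark .obj
  | .val _ => .mark .entry

/-- What happens after an argument of the current instruction has been skipped. -/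
inductive Skip where
  | toMain
  | toSkip
  | toJump
  deriving DecidableEq

instance : Fintype Skip := .ofList [.toMain, .toSkip, .toJump] (by rintro ⟨⟩ <;> simp)

/-- The labels of the decider. -/
inductive Lab where
  | start
  | load (q : PState)
  | store (q : PState) (t : Tok)
  | rewind
  | copy (r : Ret)
  | uncopy (r : Ret)
  | scan (r : Ret)
  | cmp (r : Ret)
  | cmp' (r : Ret) (a : Sym)
  | keyFound (r : Ret)
  | keyMissed (r : Ret)
  | found (r : Ret)
  | goto (charge : Bool)
  | goto₁ (charge : Bool)
  | goto₂ (charge : Bool)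
  | goto₃ (charge : Bool)
  | main
  | charge (p : Op)
  | chargeLabel
  | skip (k : Skip)
  | pushBit
  | arg (r : Ret)
  | arg' (r : Ret)
  | use (a : Act)
  | branch (o : Option Bool)
  | branch' (o : Option Bool)
  | val (o : Option Bool)
  | put (o : Option Bool)
  | put₁ (o : Option Bool)
  | put₂ (o : Option Bool)
  | put₃ (o : Option Bool)
  | put₄
  | put₅
  | put₆
  | fin (b : Bool)
  | clear (r : Reg) (b : Bool)
  deriving Fintype

/-- Statements of the decider. Its only local variable holds the last symbol popped. -/
abbrev DStmt := TM2.Stmt StkSym Lab (Option Sym)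

/-- Pop from a work stack. -/
def popR (r : Reg) (q : DStmt) : DStmt := .pop (.reg r) (fun _ a => a) q

/-- Push a fixed symbol on a work stack. -/
def pushR (r : Reg) (a : Sym) (q : DStmt) : DStmt := .push (.reg r) (fun _ => a) q

/-- Push the last symbol popped on a work stack. -/
def pushV (r : Reg) (q : DStmt) : DStmt := .push (.reg r) (fun v => v.getD (.tok .term)) q

/-- Jump to a fixed label. -/
def go (l : Lab) : DStmt := .goto fun _ => l

/-- Move the content of a work stack to another one. -/
def moveStmt (a b : Reg) (l l' : Lab) : DStmt :=
  popR a (.branch Option.isSome (pushV b (go l)) (go l'))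

/-- Clear a work stack. -/
def clearStmt (a : Reg) (l l' : Lab) : DStmt :=
  popR a (.branch Option.isSome (go l) (go l'))

/-- Push a list on a work stack. -/
def pushList (r : Reg) : List Sym → DStmt → DStmt
  | [], q => q
  | a :: as, q => pushR r a (pushList r as q)

/-- Take `n` units of gas; reject if there are less. -/
def payStmt : ℕ → DStmt → DStmt
  | 0, q => q
  | n + 1, q => popR .G (.branch Option.isSome (payStmt n q) (go (.fin false)))

/-- Where the decider continues after an unsuccessful search. -/
def Ret.missing : Ret → Lab
  | .obj a => .copy (.val a)
  | .val a => .use a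
  | _ => .fin false

/-- Where the decider goes after skipping an argument. -/
def Skip.dest : Skip → Lab
  | .toMain => .main
  | .toSkip => .skip .toMain
  | .toJump => .arg .jump

/-- The code that carries out an instruction which has been paid for. -/
def Op.code : Op → Lab
  | .label => .skip .toMain
  | .jump => .arg .jump
  | .read => .arg (.decl .read)
  | .push => .pushBit
  | .pop => .arg (.decl .pop)
  | .halt => .fin false

/-- The program of the decider. -/
def decider (gs : GasSchedule) : Lab → DStmt
  | .start => pushR .T (.mark .obj) (go (.load .obj))
  | .load q => .pop .inp (fun _ t => t.map Sym.tok) (.goto fun v =>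
      match v with
      | some (.tok t) => .store q t
      | _ => if q = .gas then .rewind else .fin false)
  | .store q t =>
      match q.next t with
      | some (q', l) => pushList .T l (go (.load q'))
      | none => go (.fin false)
  | .rewind => popR .T (.branch Option.isSome
      (.branch (fun v => v = some (.tok .one)) (pushV .G (go .rewind)) (pushV .M (go .rewind)))
      (go (.copy .init)))
  | .copy r => moveStmt .M .T (.copy r) (.uncopy r)
  | .uncopy r => popR .T (.branch Option.isSome (pushV .M (pushV .X (go (.uncopy r))))
      (go (.scan r)))
  | .scan r => popR .X (.goto fun v =>
      if v = none then r.missing else if v = some r.sym then .cmp r else .scan r)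
  | .cmp r => popR .N (.goto fun v =>
      match v with
      | none => .keyFound r
      | some a => .cmp' r a)
  | .cmp' r a => popR .X (.branch (fun v => v = some a) (pushR .T a (go (.cmp r)))
      (.branch Option.isSome (pushV .X (pushR .N a (go (.keyMissed r))))
        (pushR .N a (go (.keyMissed r)))))
  | .keyFound r => moveStmt .T .N (.keyFound r) (.found r)
  | .keyMissed r => moveStmt .T .N (.keyMissed r) (.scan r)
  | .found .init => go (.goto false)
  | .found .jump => go (.goto true)
  | .found (.decl a) => clearStmt .X (.found (.decl a)) (.copy (.obj a))
  | .found (.obj _) => go (.fin true)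
  | .found (.val a) => go (.use a)
  | .goto c => clearStmt .N (.goto c) (.goto₁ c)
  | .goto₁ c => clearStmt .P (.goto₁ c) (.goto₂ c)
  | .goto₂ c => moveStmt .X .T (.goto₂ c) (.goto₃ c)
  | .goto₃ c => moveStmt .T .P (.goto₃ c) (cond c .chargeLabel .main)
  | .main => popR .P (.goto fun v =>
      match v with
      | some (.tok (.op p)) => .charge p
      | _ => .fin false)
  | .charge p => payStmt (gs.cost p) (go p.code)
  | .chargeLabel => payStmt (gs.cost .label) (go .main)
  | .skip k => popR .P (.goto fun v =>
      if v = none then .fin false else if v = some (.tok .term) then k.dest else .skip k)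
  | .pushBit => popR .P (.goto fun v =>
      match v with
      | some (.tok (.bit b)) => .arg (.decl (.push b))
      | _ => .fin false)
  | .arg r => popR .P (.branch Option.isSome
      (pushV .T (.goto fun v => if v = some (.tok .term) then .arg' r else .arg r))
      (go (.fin false)))
  | .arg' r => moveStmt .T .N (.arg' r) (.copy r)
  | .use .read => popR .X (.goto fun v =>
      match v with
      | some (.tok (.bit b)) => .branch (some b)
      | _ => .branch none)
  | .branch o => clearStmt .X (.branch o) (.branch' o)
  | .branch' o => clearStmt .N (.branch' o)
      (match o with
      | none => .skip .toSkip
      | some false => .arg .jump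
      | some true => .skip .toJump)
  | .use (.push b) => go (.val (some b))
  | .use .pop => popR .X (.goto fun v =>
      match v with
      | some (.tok (.bit _)) => .val none
      | _ => .put none)
  | .val o => popR .X (.branch (fun v => v = some (.tok (.bit true)) ∨ v = some (.tok (.bit false)))
      (pushV .T (go (.val o))) (go (.put o)))
  | .put o => clearStmt .X (.put o) (.put₁ o)
  | .put₁ o => pushR .M (.tok .term) (go (.put₂ o))
  | .put₂ o => moveStmt .T .M (.put₂ o) (.put₃ o)
  | .put₃ (some b) => pushR .M (.tok (.bit b)) (go .put₄)
  | .put₃ none => go .put₄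
  | .put₄ => moveStmt .N .T .put₄ .put₅
  | .put₅ => moveStmt .T .M .put₅ .put₆
  | .put₆ => pushR .M (.mark .entry) (go .main)
  | .fin b => .pop .inp (fun _ t => t.map Sym.tok)
      (.branch Option.isSome (go (.fin b)) (go (.clear .M b)))
  | .clear .M b => clearStmt .M (.clear .M b) (.clear .X b)
  | .clear .X b => clearStmt .X (.clear .X b) (.clear .T b)
  | .clear .T b => clearStmt .T (.clear .T b) (.clear .N b)
  | .clear .N b => clearStmt .N (.clear .N b) (.clear .P b)
  | .clear .P b => clearStmt .P (.clear .P b) (.clear .G b)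
  | .clear .G b => popR .G (.branch Option.isSome (go (.clear .G b))
      (.push .out (fun _ => b) .halt))

/-- The decider as a bundled Turing machine. -/
def deciderTM (gs : GasSchedule) : FinTM2 where
  K := Stk
  k₀ := .inp
  k₁ := .out
  Γ := StkSym
  Λ := Lab
  main := .start
  σ := Option Sym
  initialState := none
  Γk₀Fin := inferInstanceAs (Fintype Tok)
  m := decider gs

/-- The contents of the work stacks. -/
def regs (m x t n p g : List Sym) : Reg → List Sym
  | .M => m
  | .X => x
  | .T => t
  | .N => n
  | .P => p
  | .G => g

/-- The contents of all stacks. -/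
def stks (i : List Tok) (S : Reg → List Sym) (o : List Bool) : ∀ k, List (StkSym k)
  | .inp => i
  | .out => o
  | .reg r => S r

section
variable (i : List Tok) (S : Reg → List Sym) (o : List Bool) (m x t n p g y : List Sym)

@[simp] theorem stks_inp : stks i S o .inp = i := rfl

@[simp] theorem stks_out : stks i S o .out = o := rfl

@[simp] theorem stks_reg (r : Reg) : stks i S o (.reg r) = S r := rfl

@[simp] theorem update_stks_inp (i' : List Tok) :
    Function.update (stks i S o) .inp i' = stks i' S o := by
  funext k; rcases k with _ | _ | r <;> simp [stks]

@[simp] theorem update_stks_out (o' : List Bool) :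
    Function.update (stks i S o) .out o' = stks i S o' := by
  funext k; rcases k with _ | _ | r <;> simp [stks]

@[simp] theorem update_stks_reg (r : Reg) :
    Function.update (stks i S o) (.reg r) y = stks i (Function.update S r y) o := by
  funext k
  rcases k with _ | _ | r'
  · simp [stks]
  · simp [stks]
  · by_cases h : r' = r
    · subst h; simp [stks]
    · simp [stks, h]

@[simp] theorem regs_M : regs m x t n p g .M = m := rfl
@[simp] theorem regs_X : regs m x t n p g .X = x := rfl
@[simp] theorem regs_T : regs m x t n p g .T = t := rfl
@[simp] theorem regs_N : regs m x t n p g .N = n := rfl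
@[simp] theorem regs_P : regs m x t n p g .P = p := rfl
@[simp] theorem regs_G : regs m x t n p g .G = g := rfl

@[simp] theorem update_regs_M : Function.update (regs m x t n p g) .M y = regs y x t n p g := by
  funext k; cases k <;> simp
@[simp] theorem update_regs_X : Function.update (regs m x t n p g) .X y = regs m y t n p g := by
  funext k; cases k <;> simp
@[simp] theorem update_regs_T : Function.update (regs m x t n p g) .T y = regs m x y n p g := by
  funext k; cases k <;> simp
@[simp] theorem update_regs_N : Function.update (regs m x t n p g) .N y = regs m x t y p g := by
  funext k; cases k <;> simp
@[simp] theorem update_regs_P : Function.update (regs m x t n p g) .P y = regs m x t n y g := by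
  funext k; cases k <;> simp
@[simp] theorem update_regs_G : Function.update (regs m x t n p g) .G y = regs m x t n p y := by
  funext k; cases k <;> simp

end

/-- `EvalIn f a b t`: the transition function `f` leads from `a` to `b` in at most `t` steps. -/
def EvalIn {σ : Type*} (f : σ → Option σ) (a b : σ) (t : ℕ) : Prop :=
  ∃ n ≤ t, (flip bind f)^[n] (some a) = some b

theorem EvalIn.trans {σ : Type*} {f : σ → Option σ} {a b c : σ} {t u : ℕ} (h : EvalIn f a b t)
    (h' : EvalIn f b c u) : EvalIn f a c (t + u) := by
  obtain ⟨n, hn, h⟩ := h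
  obtain ⟨k, hk, h'⟩ := h'
  exact ⟨k + n, by omega, by rw [Function.iterate_add_apply, h, h']⟩

theorem EvalIn.of_step {σ : Type*} {f : σ → Option σ} {a b : σ} (h : f a = some b) :
    EvalIn f a b 1 := ⟨1, le_rfl, by simpa [flip] using h⟩

/-- `Run gs l i S l' i' S' t`: from the label `l`, with input stack `i` and work stacks `S`, the
decider comes to the label `l'`, with input stack `i'` and work stacks `S'`, in at most `t`
steps, whatever its local variable is. -/
def Run (gs : GasSchedule) (l : Lab) (i : List Tok) (S : Reg → List Sym) (l' : Lab) (i' : List Tok)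
    (S' : Reg → List Sym) (t : ℕ) : Prop :=
  ∀ v, ∃ v', EvalIn (TM2.step (decider gs)) ⟨some l, v, stks i S []⟩ ⟨some l', v', stks i' S' []⟩ t

/-- `Final gs l i S b t`: from the label `l`, with input stack `i` and work stacks `S`, the decider
halts with output `b` and all other stacks empty in at most `t` steps. -/
def Final (gs : GasSchedule) (l : Lab) (i : List Tok) (S : Reg → List Sym) (b : Bool) (t : ℕ) :
    Prop :=
  ∀ v, EvalIn (TM2.step (decider gs)) ⟨some l, v, stks i S []⟩
    ⟨none, none, stks [] (regs [] [] [] [] [] []) [b]⟩ t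

section
variable {gs : GasSchedule} {l l' l'' : Lab} {i i' i'' : List Tok} {S S' S'' : Reg → List Sym}
  {t u : ℕ} {b : Bool}

theorem Run.refl : Run gs l i S l i S 0 := fun v => ⟨v, 0, le_rfl, rfl⟩

theorem Run.mono (h : Run gs l i S l' i' S' t) (htu : t ≤ u) : Run gs l i S l' i' S' u := fun v =>
  let ⟨v', n, hn, h⟩ := h v
  ⟨v', n, hn.trans htu, h⟩

theorem Final.mono (h : Final gs l i S b t) (htu : t ≤ u) : Final gs l i S b u := fun v =>
  let ⟨n, hn, h⟩ := h v
  ⟨n, hn.trans htu, h⟩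

theorem Run.trans (h : Run gs l i S l' i' S' t) (h' : Run gs l' i' S' l'' i'' S'' u) :
    Run gs l i S l'' i'' S'' (t + u) := fun v =>
  let ⟨v', h⟩ := h v
  let ⟨v'', h'⟩ := h' v'
  ⟨v'', h.trans h'⟩

theorem Run.final (h : Run gs l i S l' i' S' t) (h' : Final gs l' i' S' b u) :
    Final gs l i S b (t + u) := fun v =>
  let ⟨v', h⟩ := h v
  h.trans (h' v')

/-- One step of the decider. -/
theorem Run.step (h : ∀ v, ∃ v', TM2.stepAux (decider gs l) v (stks i S []) =
    ⟨some l', v', stks i' S' []⟩) : Run gs l i S l' i' S' 1 := fun v =>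
  let ⟨v', h⟩ := h v
  ⟨v', .of_step (by simp [h])⟩

end

/-- Moving a work stack to another one. -/
theorem run_move {gs : GasSchedule} {l l' : Lab} {a b : Reg} (hab : a ≠ b)
    (hl : decider gs l = moveStmt a b l l') (i : List Tok) (S : Reg → List Sym) :
    Run gs l i S l' i (Function.update (Function.update S a []) b ((S a).reverse ++ S b))
      ((S a).length + 1) := by
  generalize hx : S a = x
  induction x generalizing S with
  | nil =>
    have h1 : Function.update S a [] = S := by rw [← hx, Function.update_eq_self]
    refine .step fun v => ⟨none, ?_⟩
    simp [hl, moveStmt, popR, go, hx, h1]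
  | cons c x ih =>
    have h1 : Run gs l i S l i (Function.update (Function.update S a x) b (c :: S b)) 1 := by
      refine .step fun v => ⟨some c, ?_⟩
      simp [hl, moveStmt, popR, pushV, go, hx, hab.symm]
    have h2 := ih (Function.update (Function.update S a x) b (c :: S b)) (by simp [hab])
    refine (h1.trans h2).mono (u := (c :: x).length + 1) (by simp; omega) |> fun h => ?_
    convert h using 1
    funext r
    by_cases h3 : r = b
    · subst h3; simp
    · by_cases h4 : r = a
      · subst h4; simp [h3]
      · simp [h3, h4]

/-- Clearing a work stack. -/
theorem run_clear {gs : GasSchedule} {l l' : Lab} {a : Reg}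
    (hl : decider gs l = clearStmt a l l') (i : List Tok) (S : Reg → List Sym) :
    Run gs l i S l' i (Function.update S a []) ((S a).length + 1) := by
  generalize hx : S a = x
  induction x generalizing S with
  | nil =>
    refine .step fun v => ⟨none, ?_⟩
    simp [hl, clearStmt, popR, go, hx]
  | cons c x ih =>
    have h1 : Run gs l i S l i (Function.update S a x) 1 := by
      refine .step fun v => ⟨some c, ?_⟩
      simp [hl, clearStmt, popR, go, hx]
    have h2 := ih (Function.update S a x) (by simp)
    refine (h1.trans h2).mono (u := (c :: x).length + 1) (by simp; omega) |> fun h => ?_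
    simpa using h

theorem run_fin (gs : GasSchedule) (b : Bool) (i : List Tok) (S : Reg → List Sym) :
    Run gs (.fin b) i S (.clear .M b) [] S (i.length + 1) := by
  induction i with
  | nil => exact .step fun v => ⟨none, by simp [decider, go]⟩
  | cons c i ih =>
    have h1 : Run gs (.fin b) (c :: i) S (.fin b) i S 1 :=
      .step fun v => ⟨some (.tok c), by simp [decider, go]⟩
    exact (h1.trans ih).mono (by simp; omega)

/-- The decider cleans up and outputs its verdict. -/
theorem final_fin (gs : GasSchedule) (b : Bool) (i : List Tok) (m x t n p g : List Sym) :
    Final gs (.fin b) i (regs m x t n p g) b (i.length + m.length + x.length + t.length + n.length +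
      p.length + g.length + 7) := by
  have h0 := run_fin gs b i (regs m x t n p g)
  have h1 := run_clear (gs := gs) (l := .clear .M b) rfl [] (regs m x t n p g)
  simp only [update_regs_M] at h1
  have h2 := run_clear (gs := gs) (l := .clear .X b) rfl [] (regs [] x t n p g)
  simp only [update_regs_X] at h2
  have h3 := run_clear (gs := gs) (l := .clear .T b) rfl [] (regs [] [] t n p g)
  simp only [update_regs_T] at h3
  have h4 := run_clear (gs := gs) (l := .clear .N b) rfl [] (regs [] [] [] n p g)
  simp only [update_regs_N] at h4
  have h5 := run_clear (gs := gs) (l := .clear .P b) rfl [] (regs [] [] [] [] p g)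
  simp only [update_regs_P] at h5
  have h6 : Final gs (.clear .G b) [] (regs [] [] [] [] [] g) b (g.length + 1) := by
    clear h0 h1 h2 h3 h4 h5
    induction g with
    | nil => exact fun v => .of_step (by simp [decider, popR])
    | cons c g ih =>
      have h1 : Run gs (.clear .G b) [] (regs [] [] [] [] [] (c :: g)) (.clear .G b) []
          (regs [] [] [] [] [] g) 1 := .step fun v => ⟨some c, by simp [decider, popR, go]⟩
      exact (h1.final ih).mono (by simp; omega)
  exact (((((h0.trans h1).trans h2).trans h3).trans h4).trans h5 |>.final h6).mono
    (by simp; omega)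

/-! ### The syntax check and the memory of the decider -/

/-- The bit string `u` in the memory. -/
def symBits (u : List Bool) : List Sym := (encBits u).map .tok

/-- A sequence of instructions in the memory. -/
def symCode (l : List Instr) : List Sym := (l.flatMap encInstr).map .tok

/-- An entry of the state in the memory. -/
def symEntry (e : ObjId × Value) : List Sym := .mark .entry :: (symBits e.1 ++ symBits e.2)

/-- A declared object in the memory. -/
def symDecl (w : Bool) (o : ObjId) : List Sym := .mark (.decl w) :: symBits o

/-- The part of the memory behind the instructions. -/
def memTail (x : Instance) : List Sym :=
  .tok .close :: (x.tx.readSet.flatMap (symDecl false) ++ .tok .close ::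
    (x.tx.writeSet.flatMap (symDecl true) ++ .tok .close ::
      (x.state.flatMap symEntry ++ [.tok .close])))

/-- The memory of the decider for the instance `x`, in front of which the entries `l` have been
added to the state. -/
def mem (l : List (ObjId × Value)) (x : Instance) : List Sym :=
  l.flatMap symEntry ++ .mark .obj :: (symBits x.obj ++ .mark .prog ::
    (symCode x.tx.ins ++ memTail x))

/-- The output of the automaton on a word, starting from a given state; `none` if the automaton
does not accept. -/
def PState.run : PState → List Tok → Option (List Sym)
  | q, [] => if q = .gas then some [] else none
  | q, t :: w =>
    match q.next t with
    | none => none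
    | some (q', l) => (PState.run q' w).map (l ++ ·)

theorem PState.run_cons {q q' : PState} {t : Tok} {l : List Sym} (h : q.next t = some (q', l))
    (w : List Tok) : q.run (t :: w) = (q'.run w).map (l ++ ·) := by
  simp [PState.run, h]

theorem exists_encodeNat {u : List Bool} (h : u.getLastD true = true) :
    ∃ n, Computability.encodeNat n = u := by
  cases u with
  | nil => exact ⟨0, rfl⟩
  | cons b u =>
    suffices ∃ p, Computability.encodePosNum p = b :: u by
      obtain ⟨p, hp⟩ := this
      refine ⟨(p : ℕ), ?_⟩
      have h1 : ((p : ℕ) : Num) = Num.pos p := by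
        rw [← PosNum.cast_to_num, ← Num.of_to_nat (p : Num), PosNum.cast_to_num]; rfl
      rw [Computability.encodeNat, h1, Computability.encodeNum, hp]
    rw [List.getLastD_cons] at h
    induction u generalizing b with
    | nil => exact ⟨.one, by simp_all [Computability.encodePosNum]⟩
    | cons c u ih =>
      obtain ⟨p, hp⟩ := ih c (by rwa [List.getLastD_cons] at h)
      cases b with
      | false => exact ⟨.bit0 p, by rw [Computability.encodePosNum, hp]⟩
      | true => exact ⟨.bit1 p, by rw [Computability.encodePosNum, hp]⟩

theorem getLastD_encodeNat (n : ℕ) : (Computability.encodeNat n).getLastD true = true := by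
  have h (p : PosNum) : ∀ c, (Computability.encodePosNum p).getLastD c = true := by
    induction p with
    | one => intro c; rfl
    | bit0 p ih => intro c; rw [Computability.encodePosNum, List.getLastD_cons, ih]
    | bit1 p ih => intro c; rw [Computability.encodePosNum, List.getLastD_cons, ih]
  rw [Computability.encodeNat]
  cases (n : Num) with
  | zero => rfl
  | pos p => exact h p true

theorem PState.run_bits {q q' : PState} (hb : ∀ b, q.next (.bit b) = some (q, [.tok (.bit b)]))
    (ht : q.next .term = some (q', [.tok .term])) (u : List Bool) (w : List Tok) :
    q.run (encBits u ++ w) = (q'.run w).map (symBits u ++ ·) := by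
  induction u with
  | nil => simp [encBits, symBits, run_cons ht]
  | cons b u ih =>
    have : encBits (b :: u) ++ w = .bit b :: (encBits u ++ w) := rfl
    rw [this, run_cons (hb b), ih, Option.map_map]
    rfl

theorem PState.run_num (s c : Bool) (u : List Bool) (w : List Tok) :
    (PState.num s c).run (encBits u ++ w) =
      (PState.num s (u.getLastD c)).run (.term :: w) := by
  induction u generalizing c with
  | nil => rfl
  | cons b u ih =>
    have : encBits (b :: u) ++ w = .bit b :: (encBits u ++ w) := rfl
    rw [this, run_cons (q' := .num s b) (l := []) rfl, ih, List.getLastD_cons]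
    simp

theorem PState.run_ins (l : List Instr) (w : List Tok) :
    PState.ins.run (encList encInstr l ++ w) =
      ((PState.set false).run w).map (symCode l ++ .tok .close :: ·) := by
  have a0 := run_bits (q := .args 0) (q' := .ins) (fun b => rfl) rfl
  have a1 := run_bits (q := .args 1) (q' := .args 0) (fun b => rfl) rfl
  have a2 := run_bits (q := .args 2) (q' := .args 1) (fun b => rfl) rfl
  induction l with
  | nil =>
    rw [encList, List.flatMap_nil, List.nil_append, List.singleton_append, run_cons rfl]; rfl
  | cons i l ih =>
    have h : encList encInstr (i :: l) ++ w = encInstr i ++ (encList encInstr l ++ w) := by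
      simp [encList]
    rw [h]
    cases i <;>
      simp only [encInstr, List.cons_append, List.append_assoc, List.nil_append]
    case push =>
      rw [run_cons rfl, run_cons rfl, a0, ih]
      simp [Function.comp_def, symCode, symBits, encInstr]
    all_goals
      rw [run_cons rfl]
      simp only [a0, a1, a2, ih]
      simp [Function.comp_def, symCode, symBits, encInstr]

theorem PState.run_set (v : Bool) (l : List ObjId) (w : List Tok) :
    (PState.set v).run (encList encBits l ++ w) =
      ((cond v PState.entries (.set true)).run w).map (l.flatMap (symDecl v) ++ .tok .close :: ·) := by
  have a0 := run_bits (q := .setItem v) (q' := .set v) (fun b => rfl) rfl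
  induction l with
  | nil =>
    rw [encList, List.flatMap_nil, List.nil_append, List.singleton_append, run_cons rfl]; rfl
  | cons i l ih =>
    have h : encList encBits (i :: l) ++ w = encBits i ++ (encList encBits l ++ w) := by
      simp [encList]
    rw [h]
    cases i with
    | nil =>
      have : encBits [] ++ (encList encBits l ++ w) = .term :: (encList encBits l ++ w) := rfl
      rw [this, run_cons rfl, ih, Option.map_map]
      rfl
    | cons b i =>
      have : encBits (b :: i) ++ (encList encBits l ++ w) =
        .bit b :: (encBits i ++ (encList encBits l ++ w)) := rfl
      rw [this, run_cons rfl, a0, ih, Option.map_map, Option.map_map]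
      congr 1; funext z; simp [symDecl, symBits, encBits]

theorem PState.run_entries (l : List (ObjId × Value)) (w : List Tok) :
    PState.entries.run (encList encEntry l ++ w) =
      (PState.gas.run w).map (l.flatMap symEntry ++ .tok .close :: ·) := by
  have a0 := run_bits (q := .key) (q' := .val) (fun b => rfl) rfl
  have a1 := run_bits (q := .val) (q' := .entries) (fun b => rfl) rfl
  induction l with
  | nil =>
    rw [encList, List.flatMap_nil, List.nil_append, List.singleton_append, run_cons rfl]; rfl
  | cons i l ih =>
    obtain ⟨i, j⟩ := i
    have h : encList encEntry ((i, j) :: l) ++ w =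
        encBits i ++ (encBits j ++ (encList encEntry l ++ w)) := by
      simp [encList, encEntry]
    rw [h]
    cases i with
    | nil =>
      have : encBits [] ++ (encBits j ++ (encList encEntry l ++ w)) =
        .term :: (encBits j ++ (encList encEntry l ++ w)) := rfl
      rw [this, run_cons rfl, a1, ih, Option.map_map, Option.map_map]
      congr 1; funext z; simp [symEntry, symBits, encBits]
    | cons b i =>
      have : encBits (b :: i) ++ (encBits j ++ (encList encEntry l ++ w)) =
        .bit b :: (encBits i ++ (encBits j ++ (encList encEntry l ++ w))) := rfl
      rw [this, run_cons rfl, a0, a1, ih, Option.map_map, Option.map_map, Option.map_map]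
      congr 1; funext z; simp [symEntry, symBits, encBits]

theorem PState.run_gas (n : ℕ) :
    PState.gas.run (List.replicate n .one) = some (List.replicate n (.tok .one)) := by
  induction n with
  | zero => rfl
  | succ n ih => rw [List.replicate_succ, run_cons rfl, ih]; rfl

/-- The automaton accepts the encoding of an instance and produces the initial memory. -/
theorem PState.run_encode (x : Instance) :
    ∃ out, PState.obj.run x.encode = some out ∧
      .mark .obj :: out = mem [] x ++ List.replicate x.gas (.tok .one) := by
  have a0 := run_bits (q := .obj) (q' := .num false true) (fun b => rfl) rfl
  refine ⟨_, ?_, rfl⟩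
  rw [Instance.encode, encTx]
  simp only [List.append_assoc, encNat, a0, run_num, getLastD_encodeNat]
  rw [run_cons (q' := .num true true) rfl, run_num, getLastD_encodeNat, run_cons (q' := .ins) rfl,
    run_ins, run_set, cond_false, run_set, cond_true, run_entries, run_gas]
  simp [memTail]

theorem PState.isSome_run_cons {q : PState} {t : Tok} {w : List Tok}
    (h : (q.run (t :: w)).isSome) : ∃ q' l, q.next t = some (q', l) ∧ (q'.run w).isSome := by
  rw [PState.run] at h
  rcases hq : q.next t with _ | ⟨q', l⟩
  · simp [hq] at h
  · exact ⟨q', l, rfl, by simpa [hq] using h⟩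

theorem PState.isSome_run_bits {q q' : PState} {l : List Sym} (hg : q ≠ .gas)
    (hb : ∀ b, ∃ l, q.next (.bit b) = some (q, l)) (ht : q.next .term = some (q', l))
    (h : ∀ t, (q.next t).isSome → t = .term ∨ ∃ b, t = .bit b) (w : List Tok)
    (hw : (q.run w).isSome) : ∃ u w', w = encBits u ++ w' ∧ (q'.run w').isSome := by
  induction w with
  | nil => simp [PState.run, hg] at hw
  | cons t w ih =>
    obtain ⟨q1, l1, h1, h2⟩ := isSome_run_cons hw
    rcases h t (by simp [h1]) with rfl | ⟨b, rfl⟩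
    · rw [ht] at h1
      cases h1
      exact ⟨[], w, rfl, h2⟩
    · obtain ⟨l2, h3⟩ := hb b
      rw [h3] at h1
      cases h1
      obtain ⟨u, w', rfl, h4⟩ := ih h2
      exact ⟨b :: u, w', rfl, h4⟩

theorem PState.isSome_run_num {s c : Bool} {w : List Tok} (hw : ((PState.num s c).run w).isSome) :
    ∃ u w', w = encBits u ++ w' ∧ u.getLastD c = true ∧
      ((cond s PState.ins (.num true true)).run w').isSome := by
  induction w generalizing c with
  | nil => simp [PState.run] at hw
  | cons t w ih =>
    obtain ⟨q1, l1, h1, h2⟩ := isSome_run_cons hw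
    cases t with
    | bit b =>
      cases h1
      obtain ⟨u, w', rfl, h3, h4⟩ := ih h2
      exact ⟨b :: u, w', rfl, by rw [List.getLastD_cons, h3], h4⟩
    | term =>
      cases s <;> cases c <;> cases h1 <;> exact ⟨[], w, rfl, rfl, h2⟩
    | op _ | close | one => cases s <;> cases c <;> cases h1

theorem PState.isSome_run_ins {w : List Tok} (hw : (PState.ins.run w).isSome) :
    ∃ l w', w = encList encInstr l ++ w' ∧ ((PState.set false).run w').isSome := by
  have a0 := isSome_run_bits (q := .args 0) (q' := .ins) (by simp) (fun b => ⟨_, rfl⟩) rfl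
    (by intro t; cases t <;> simp [PState.next])
  have a1 := isSome_run_bits (q := .args 1) (q' := .args 0) (by simp) (fun b => ⟨_, rfl⟩) rfl
    (by intro t; cases t <;> simp [PState.next])
  have a2 := isSome_run_bits (q := .args 2) (q' := .args 1) (by simp) (fun b => ⟨_, rfl⟩) rfl
    (by intro t; cases t <;> simp [PState.next])
  induction hn : w.length using Nat.strong_induction_on generalizing w with
  | _ n ih =>
    subst hn
    have key (i : Instr) (w' : List Tok) (h : w = encInstr i ++ w')
        (hw' : (PState.ins.run w').isSome) :
        ∃ l w', w = encList encInstr l ++ w' ∧ ((PState.set false).run w').isSome := by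
      obtain ⟨l, w'', rfl, h'⟩ := ih w'.length
        (by rw [h]; cases i <;> simp [encInstr] <;> omega) hw' rfl
      exact ⟨i :: l, w'', by simp [h, encList], h'⟩
    cases w with
    | nil => simp [PState.run] at hw
    | cons t w =>
      obtain ⟨q1, l1, h1, h2⟩ := isSome_run_cons hw
      cases t with
      | bit b => cases h1
      | term => cases h1
      | one => cases h1
      | close => cases h1; exact ⟨[], w, rfl, h2⟩
      | op p =>
        cases p <;> cases h1
        · obtain ⟨u, w', rfl, h3⟩ := a0 _ h2
          exact key (.label u) w' rfl h3
        · obtain ⟨u, w', rfl, h3⟩ := a0 _ h2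
          exact key (.jump u) w' rfl h3
        · obtain ⟨u, w', rfl, h3⟩ := a2 _ h2
          obtain ⟨u', w', rfl, h4⟩ := a1 _ h3
          obtain ⟨u'', w', rfl, h5⟩ := a0 _ h4
          exact key (.read u u' u'') w' (by simp [encInstr]) h5
        · cases w with
          | nil => simp [PState.run] at h2
          | cons t w =>
            obtain ⟨q1, l1, h1, h2⟩ := isSome_run_cons h2
            cases t <;> cases h1
            obtain ⟨u, w', rfl, h3⟩ := a0 _ h2
            exact key (.push u _) w' rfl h3
        · obtain ⟨u, w', rfl, h3⟩ := a0 _ h2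
          exact key (.pop u) w' rfl h3
        · exact key .halt w rfl h2

theorem PState.isSome_run_set {v : Bool} {w : List Tok} (hw : ((PState.set v).run w).isSome) :
    ∃ l w', w = encList encBits l ++ w' ∧
      ((cond v PState.entries (.set true)).run w').isSome := by
  have a0 := isSome_run_bits (q := .setItem v) (q' := .set v) (by simp) (fun b => ⟨_, rfl⟩) rfl
    (by intro t; cases t <;> simp [PState.next])
  induction hn : w.length using Nat.strong_induction_on generalizing w with
  | _ n ih =>
    subst hn
    have key (i : ObjId) (w' : List Tok) (h : w = encBits i ++ w')
        (hw' : ((PState.set v).run w').isSome) : ∃ l w', w = encList encBits l ++ w' ∧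
          ((cond v PState.entries (.set true)).run w').isSome := by
      obtain ⟨l, w'', rfl, h'⟩ := ih w'.length (by rw [h]; simp [encBits]; omega) hw' rfl
      exact ⟨i :: l, w'', by simp [h, encList], h'⟩
    cases w with
    | nil => simp [PState.run] at hw
    | cons t w =>
      obtain ⟨q1, l1, h1, h2⟩ := isSome_run_cons hw
      cases t with
      | bit b =>
        cases h1
        obtain ⟨u, w', rfl, h3⟩ := a0 _ h2
        exact key (b :: u) w' rfl h3
      | term => cases h1; exact key [] w rfl h2
      | one => cases h1
      | close => cases h1; exact ⟨[], w, rfl, h2⟩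
      | op p => cases h1

theorem PState.isSome_run_entries {w : List Tok} (hw : (PState.entries.run w).isSome) :
    ∃ l w', w = encList encEntry l ++ w' ∧ (PState.gas.run w').isSome := by
  have a0 := isSome_run_bits (q := .key) (q' := .val) (by simp) (fun b => ⟨_, rfl⟩) rfl
    (by intro t; cases t <;> simp [PState.next])
  have a1 := isSome_run_bits (q := .val) (q' := .entries) (by simp) (fun b => ⟨_, rfl⟩) rfl
    (by intro t; cases t <;> simp [PState.next])
  induction hn : w.length using Nat.strong_induction_on generalizing w with
  | _ n ih =>
    subst hn
    have key (i : ObjId × Value) (w' : List Tok) (h : w = encEntry i ++ w')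
        (hw' : (PState.entries.run w').isSome) : ∃ l w', w = encList encEntry l ++ w' ∧
          (PState.gas.run w').isSome := by
      obtain ⟨l, w'', rfl, h'⟩ := ih w'.length (by rw [h]; simp [encEntry, encBits]; omega) hw' rfl
      exact ⟨i :: l, w'', by simp [h, encList], h'⟩
    cases w with
    | nil => simp [PState.run] at hw
    | cons t w =>
      obtain ⟨q1, l1, h1, h2⟩ := isSome_run_cons hw
      cases t with
      | bit b =>
        cases h1
        obtain ⟨u, w', rfl, h3⟩ := a0 _ h2
        obtain ⟨u', w', rfl, h4⟩ := a1 _ h3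
        exact key (b :: u, u') w' (by simp [encEntry, encBits]) h4
      | term =>
        cases h1
        obtain ⟨u', w', rfl, h3⟩ := a1 _ h2
        exact key ([], u') w' (by simp [encEntry, encBits]) h3
      | one => cases h1
      | close => cases h1; exact ⟨[], w, rfl, h2⟩
      | op p => cases h1

theorem PState.isSome_run_gas {w : List Tok} (hw : (PState.gas.run w).isSome) :
    w = List.replicate w.length .one := by
  induction w with
  | nil => rfl
  | cons t w ih =>
    obtain ⟨q1, l1, h1, h2⟩ := isSome_run_cons hw
    cases t <;> cases h1
    rw [List.length_cons, List.replicate_succ, ← ih h2]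

/-- The automaton accepts only encodings of instances. -/
theorem PState.exists_encode {w : List Tok} (hw : (PState.obj.run w).isSome) :
    ∃ x : Instance, x.encode = w := by
  obtain ⟨o, w, rfl, h⟩ := isSome_run_bits (q := .obj) (q' := .num false true) (by simp)
    (fun b => ⟨_, rfl⟩) rfl (by intro t; cases t <;> simp [PState.next]) _ hw
  obtain ⟨t, w, rfl, ht, h1⟩ := isSome_run_num h
  obtain ⟨g, w, rfl, hg, h2⟩ := isSome_run_num h1
  obtain ⟨i, w, rfl, h3⟩ := isSome_run_ins h2
  obtain ⟨r, w, rfl, h4⟩ := isSome_run_set h3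
  obtain ⟨v, w, rfl, h5⟩ := isSome_run_set h4
  obtain ⟨s, w, rfl, h6⟩ := isSome_run_entries h5
  obtain ⟨t, rfl⟩ := exists_encodeNat ht
  obtain ⟨g, rfl⟩ := exists_encodeNat hg
  refine ⟨⟨o, ⟨t, g, i, r, v⟩, s, w.length⟩, ?_⟩
  rw [Instance.encode, encTx, ← isSome_run_gas h6]
  simp [encNat]

/-! ### Searching in the memory -/

/-- The rest of the list after the first occurrence of the symbol `c` followed by `key`. -/
def search (c : Sym) (key : List Sym) : List Sym → Option (List Sym)
  | [] => none
  | a :: x => if a = c ∧ key <+: x then some (x.drop key.length) else search c key x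

theorem search_append {c : Sym} {u : List Sym} (h : c ∉ u) (key v : List Sym) :
    search c key (u ++ v) = search c key v := by
  induction u with
  | nil => rfl
  | cons a u ih =>
    simp only [List.mem_cons, not_or] at h
    rw [List.cons_append, search, if_neg (fun h' => h.1 h'.1.symm), ih h.2]

theorem search_eq_none {c : Sym} {u : List Sym} (h : c ∉ u) (key : List Sym) :
    search c key u = none := by
  simpa [search] using search_append h key []

theorem search_cons_of_ne {a c : Sym} (h : a ≠ c) (key v : List Sym) :
    search c key (a :: v) = search c key v := by
  rw [search, if_neg (fun h' => h h'.1)]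

theorem search_found (c : Sym) (key z : List Sym) : search c key (c :: (key ++ z)) = some z := by
  simp [search]

theorem length_search {c : Sym} {key u z : List Sym} (h : search c key u = some z) :
    z.length ≤ u.length := by
  induction u with
  | nil => simp [search] at h
  | cons a u ih =>
    rw [search] at h
    split_ifs at h
    · cases h; simp; omega
    · have := ih h; simp; omega

theorem symBits_append_inj {u v : List Bool} {x y : List Sym}
    (h : symBits u ++ x = symBits v ++ y) : u = v := by
  induction u generalizing v with
  | nil => cases v <;> simp_all [symBits, encBits]
  | cons a u ih =>
    cases v with
    | nil => simp [symBits, encBits] at h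
    | cons b v =>
      simp only [symBits, encBits, List.map_cons, List.cons_append, List.cons.injEq, Sym.tok.injEq,
        Tok.bit.injEq] at h
      rw [h.1, ih (v := v) (by simpa [symBits, encBits] using h.2)]

/-- The symbols in bit strings of the memory. -/
theorem mem_symBits {a : Sym} {u : List Bool} (h : a ∈ symBits u) :
    a = .tok .term ∨ ∃ b, a = .tok (.bit b) := by
  simp only [symBits, encBits, List.mem_map, List.mem_append, List.mem_singleton] at h
  obtain ⟨t, ⟨b, -, rfl⟩ | rfl, rfl⟩ := h
  · exact .inr ⟨b, rfl⟩
  · exact .inl rfl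

theorem mark_notMem_symBits (m : Mark) (u : List Bool) : Sym.mark m ∉ symBits u := fun h => by
  rcases mem_symBits h with h | ⟨b, h⟩ <;> cases h

theorem op_notMem_symBits (p : Op) (u : List Bool) : Sym.tok (.op p) ∉ symBits u := fun h => by
  rcases mem_symBits h with h | ⟨b, h⟩ <;> cases h

theorem Ret.sym_notMem (r : Ret) (u : List Bool) : r.sym ∉ symBits u := by
  cases r with
  | jump => exact op_notMem_symBits _ _
  | _ => exact mark_notMem_symBits _ _

theorem search_missed {c : Sym} {o r : List Bool} (hc : c ∉ symBits r) (h : o ≠ r) (z : List Sym) :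
    search c (symBits o) (c :: (symBits r ++ z)) = search c (symBits o) z := by
  rw [search, if_neg, search_append hc]
  rintro ⟨-, y, hy⟩
  exact h (symBits_append_inj hy)

theorem mark_notMem_symCode (m : Mark) (l : List Instr) : Sym.mark m ∉ symCode l := by
  simp [symCode]

theorem entries_notMem {c : Sym} (hc : ∀ u, c ∉ symBits u) (h : c ≠ .mark .entry)
    (l : List (ObjId × Value)) : c ∉ l.flatMap symEntry := by
  simp [symEntry, hc, h]

theorem decls_notMem {c : Sym} {w : Bool} (hc : ∀ u, c ∉ symBits u) (h : c ≠ .mark (.decl w))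
    (l : List ObjId) : c ∉ l.flatMap (symDecl w) := by
  simp [symDecl, hc, h]

theorem search_prog (l : List (ObjId × Value)) (x : Instance) :
    search Ret.init.sym [] (mem l x) = some (symCode x.tx.ins ++ memTail x) := by
  have hc := mark_notMem_symBits .prog
  rw [Ret.sym, mem, search_append (entries_notMem hc (by simp) l), search_cons_of_ne (by simp),
    search_append (hc _)]
  exact search_found _ [] _

theorem search_obj (l : List (ObjId × Value)) (x : Instance) (a : Act) (o : ObjId) :
    (search (Ret.obj a).sym (symBits o) (mem l x)).isSome ↔ x.obj = o := by
  have hc := mark_notMem_symBits .obj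
  rw [Ret.sym, mem, search_append (entries_notMem hc (by simp) l)]
  by_cases h : o = x.obj
  · subst h; simp [search_found]
  · rw [search_missed (hc _) h, search_cons_of_ne (by simp), search_append
      (mark_notMem_symCode _ _), memTail, search_cons_of_ne (by simp), search_append
      (decls_notMem hc (by simp) _), search_cons_of_ne (by simp), search_append
      (decls_notMem hc (by simp) _), search_cons_of_ne (by simp), search_append
      (entries_notMem hc (by simp) _), search_eq_none (by simp)]
    simpa using fun h' => h h'.symm

theorem search_decls {w : Bool} {z : List Sym}
    (hz : ∀ key, search (.mark (.decl w)) key z = none) (l : List ObjId) (o : ObjId) :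
    (search (.mark (.decl w)) (symBits o) (l.flatMap (symDecl w) ++ z)).isSome ↔ o ∈ l := by
  have hc := mark_notMem_symBits (.decl w)
  induction l with
  | nil => simp [hz]
  | cons r l ih =>
    rw [List.flatMap_cons, symDecl, List.cons_append, List.cons_append, List.append_assoc]
    by_cases h : o = r
    · subst h; simp [search_found]
    · rw [search_missed (hc _) h]; simp [h, ih]

theorem search_decl (l : List (ObjId × Value)) (x : Instance) (a : Act) (o : ObjId) :
    (search (Ret.decl a).sym (symBits o) (mem l x)).isSome ↔
      o ∈ cond a.isWrite x.tx.writeSet x.tx.readSet := by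
  rw [Ret.sym]
  generalize a.isWrite = w
  have hc := mark_notMem_symBits (.decl w)
  rw [mem, search_append (entries_notMem hc (by simp) l), search_cons_of_ne (by simp),
    search_append (hc _), search_cons_of_ne (by simp), search_append (mark_notMem_symCode _ _),
    memTail, search_cons_of_ne (by simp)]
  have he (key) : search (.mark (.decl w)) key (x.state.flatMap symEntry ++ [.tok .close]) = none := by
    rw [search_append (entries_notMem hc (by simp) _), search_eq_none (by simp)]
  cases w with
  | false =>
    refine search_decls (fun key => ?_) _ _
    rw [search_cons_of_ne (by simp), search_append (decls_notMem hc (by simp) _),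
      search_cons_of_ne (by simp), he]
  | true =>
    rw [search_append (decls_notMem hc (by simp) _), search_cons_of_ne (by simp)]
    refine search_decls (fun key => ?_) _ _
    rw [search_cons_of_ne (by simp), he]

theorem search_entries {z : List Sym} (l : List (ObjId × Value)) (o : ObjId) :
    (l.lookup o = none ∧ search (.mark .entry) (symBits o) (l.flatMap symEntry ++ z) =
      search (.mark .entry) (symBits o) z) ∨
    ∃ v y, l.lookup o = some v ∧
      search (.mark .entry) (symBits o) (l.flatMap symEntry ++ z) = some (symBits v ++ y) := by
  have hc := mark_notMem_symBits .entry
  induction l with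
  | nil => simp
  | cons r l ih =>
    obtain ⟨r, v⟩ := r
    simp only [List.flatMap_cons, symEntry, List.cons_append, List.append_assoc]
    by_cases h : o = r
    · subst h
      exact .inr ⟨v, _, by simp, search_found _ _ _⟩
    · have h1 : (o == r) = false := by simpa using h
      rw [search_missed (hc _) h, search_append (hc _), List.lookup_cons, h1]
      exact ih

/-- Searching for an object among the entries gives its value. -/
theorem search_val (l : List (ObjId × Value)) (x : Instance) (a : Act) (o : ObjId) :
    (stateOf (l ++ x.state) o = [] ∧ search (Ret.val a).sym (symBits o) (mem l x) = none) ∨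
    ∃ y, search (Ret.val a).sym (symBits o) (mem l x) =
      some (symBits (stateOf (l ++ x.state) o) ++ y) := by
  have hc := mark_notMem_symBits .entry
  simp only [Ret.sym, stateOf, List.lookup_append, mem]
  rcases search_entries (z := .mark .obj :: (symBits x.obj ++ .mark .prog ::
    (symCode x.tx.ins ++ memTail x))) l o with ⟨h1, h2⟩ | ⟨v, y, h1, h2⟩
  · rw [h2, search_cons_of_ne (by simp), search_append (hc _), search_cons_of_ne (by simp),
      search_append (mark_notMem_symCode _ _), memTail, search_cons_of_ne (by simp), search_append
      (decls_notMem hc (by simp) _), search_cons_of_ne (by simp), search_append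
      (decls_notMem hc (by simp) _), search_cons_of_ne (by simp)]
    rcases search_entries (z := [.tok .close]) x.state o with ⟨h3, h4⟩ | ⟨v, y, h3, h4⟩
    · left
      rw [h4, search_eq_none (by simp)]
      simp [h1, h3]
    · right
      exact ⟨y, by rw [h4]; simp [h1, h3]⟩
  · exact .inr ⟨y, by rw [h2]; simp [h1]⟩

theorem search_instrs {z : List Sym} (l : List Instr) (ℓ : Label) :
    search (.tok (.op .label)) (symBits ℓ) (symCode l ++ z) =
      match l.dropWhile fun i => decide (i ≠ Instr.label ℓ) with
      | [] => search (.tok (.op .label)) (symBits ℓ) z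
      | _ :: is => some (symCode is ++ z) := by
  have hc := op_notMem_symBits .label
  have ho (u : List Bool) : Sym.tok (.op .label) ∉ (encBits u).map Sym.tok := hc u
  induction l with
  | nil => simp [symCode]
  | cons i l ih =>
    have h : symCode (i :: l) ++ z = (encInstr i).map Sym.tok ++ (symCode l ++ z) := by
      simp [symCode]
    rw [h]
    by_cases hi : i = .label ℓ
    · subst hi
      rw [List.dropWhile_cons_of_neg (by simp)]
      exact search_found _ (symBits ℓ) _
    · rw [List.dropWhile_cons_of_pos (by simpa using hi), ← ih]
      cases i with
      | label ℓ' => exact search_missed (hc _) (by simpa [eq_comm] using hi) _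
      | _ => exact search_append (by simp [encInstr, ho]) _ _

/-- Searching for a label gives the instructions behind it. -/
theorem search_label (l : List (ObjId × Value)) (x : Instance) (ℓ : Label) :
    search Ret.jump.sym (symBits ℓ) (mem l x) =
      match x.tx.seek ℓ with
      | [] => none
      | _ :: is => some (symCode is ++ memTail x) := by
  have hc := op_notMem_symBits .label
  rw [Ret.sym, mem, search_append (entries_notMem hc (by simp) l), search_cons_of_ne (by simp),
    search_append (hc _), search_cons_of_ne (by simp), search_instrs, Transaction.seek]
  have : search (.tok (.op .label)) (symBits ℓ) (memTail x) = none := by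
    rw [memTail, search_cons_of_ne (by simp), search_append
      (decls_notMem hc (by simp) _), search_cons_of_ne (by simp), search_append
      (decls_notMem hc (by simp) _), search_cons_of_ne (by simp), search_append
      (entries_notMem hc (by simp) _), search_eq_none (by simp)]
  rw [this]

/-! ### The subroutines of the decider -/

section
variable {gs : GasSchedule}

theorem stepAux_pushList (r : Reg) (l : List Sym) (q : DStmt) (v : Option Sym) (i : List Tok)
    (S : Reg → List Sym) (o : List Bool) :
    TM2.stepAux (pushList r l q) v (stks i S o) =
      TM2.stepAux q v (stks i (Function.update S r (l.reverse ++ S r)) o) := by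
  induction l generalizing S with
  | nil => simp [pushList]
  | cons a l ih => simp [pushList, pushR, ih]

theorem PState.length_next {q q' : PState} {t : Tok} {l : List Sym}
    (h : q.next t = some (q', l)) : l.length ≤ 2 := by
  unfold PState.next at h
  split at h <;> simp_all <;> (try rw [← h.2]) <;> simp

theorem PState.length_run {q : PState} {u : List Tok} {out : List Sym} (h : q.run u = some out) :
    out.length ≤ 2 * u.length := by
  induction u generalizing q out with
  | nil =>
    rw [PState.run] at h
    split_ifs at h
    cases h
    simp
  | cons t u ih =>
    rw [PState.run] at h
    rcases hq : q.next t with _ | ⟨q', l⟩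
    · simp [hq] at h
    · simp only [hq, Option.map_eq_some_iff] at h
      obtain ⟨out', h1, rfl⟩ := h
      have := ih h1
      have := length_next hq
      simp
      omega

theorem run_load {q : PState} {u : List Tok} {out : List Sym} (h : q.run u = some out)
    (t : List Sym) :
    Run gs (.load q) u (regs [] [] t [] [] []) .rewind [] (regs [] [] (out.reverse ++ t) [] [] [])
      (2 * u.length + 1) := by
  induction u generalizing q t out with
  | nil =>
    rw [PState.run] at h
    split_ifs at h with hq
    cases h
    exact .step fun v => ⟨none, by simp [decider, hq]⟩
  | cons a u ih =>
    rw [PState.run] at h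
    rcases hq : q.next a with _ | ⟨q', l⟩
    · simp [hq] at h
    · simp only [hq, Option.map_eq_some_iff] at h
      obtain ⟨out', h1, rfl⟩ := h
      have h2 : Run gs (.load q) (a :: u) (regs [] [] t [] [] []) (.store q a) u
          (regs [] [] t [] [] []) 1 := .step fun v => ⟨some (.tok a), by simp [decider]⟩
      have h3 : Run gs (.store q a) u (regs [] [] t [] [] []) (.load q') u
          (regs [] [] (l.reverse ++ t) [] [] []) 1 :=
        .step fun v => ⟨v, by simp [decider, hq, stepAux_pushList, go]⟩
      have h4 := (h2.trans h3).trans (ih h1 (l.reverse ++ t))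
      refine Run.mono (t := 1 + 1 + (2 * u.length + 1)) ?_ (by simp; omega)
      simpa using h4

theorem final_load {q : PState} {u : List Tok} (h : q.run u = none) (t : List Sym) :
    Final gs (.load q) u (regs [] [] t [] [] []) false (4 * u.length + t.length + 10) := by
  induction u generalizing q t with
  | nil =>
    rw [PState.run] at h
    split_ifs at h with hq
    have h1 : Run gs (.load q) [] (regs [] [] t [] [] []) (.fin false) []
        (regs [] [] t [] [] []) 1 := .step fun v => ⟨none, by simp [decider, hq]⟩
    exact (h1.final (final_fin gs _ _ _ _ _ _ _ _)).mono (by simp; omega)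
  | cons a u ih =>
    rw [PState.run] at h
    have h2 : Run gs (.load q) (a :: u) (regs [] [] t [] [] []) (.store q a) u
        (regs [] [] t [] [] []) 1 := .step fun v => ⟨some (.tok a), by simp [decider]⟩
    rcases hq : q.next a with _ | ⟨q', l⟩
    · have h3 : Run gs (.store q a) u (regs [] [] t [] [] []) (.fin false) u
          (regs [] [] t [] [] []) 1 := .step fun v => ⟨v, by simp [decider, hq, go]⟩
      exact ((h2.trans h3).final (final_fin gs _ _ _ _ _ _ _ _)).mono (by simp; omega)
    · have h3 : Run gs (.store q a) u (regs [] [] t [] [] []) (.load q') u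
          (regs [] [] (l.reverse ++ t) [] [] []) 1 :=
        .step fun v => ⟨v, by simp [decider, hq, stepAux_pushList, go]⟩
      have h1 : q'.run u = none := by simpa [hq] using h
      have := PState.length_next hq
      exact ((h2.trans h3).final (ih h1 (l.reverse ++ t))).mono (by simp; omega)

theorem run_rewind_gas (k : ℕ) (t m g : List Sym) :
    Run gs .rewind [] (regs m [] (List.replicate k (.tok .one) ++ t) [] [] g) .rewind []
      (regs m [] t [] [] (List.replicate k (.tok .one) ++ g)) k := by
  induction k generalizing g with
  | zero => exact .refl
  | succ k ih =>
    have h : Run gs .rewind [] (regs m [] (List.replicate (k + 1) (.tok .one) ++ t) [] [] g) .rewind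
        [] (regs m [] (List.replicate k (.tok .one) ++ t) [] [] (.tok .one :: g)) 1 :=
      .step fun v => ⟨some (.tok .one), by simp [decider, popR, pushV, go, List.replicate_succ]⟩
    have h2 := (h.trans (ih (.tok .one :: g))).mono (u := k + 1) (by omega)
    rwa [show List.replicate k (Sym.tok .one) ++ .tok .one :: g =
      List.replicate (k + 1) (.tok .one) ++ g by simp [List.replicate_succ']] at h2

theorem run_rewind {t : List Sym} (ht : .tok .one ∉ t) (m g : List Sym) :
    Run gs .rewind [] (regs m [] t [] [] g) (.copy .init) [] (regs (t.reverse ++ m) [] [] [] [] g)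
      (t.length + 1) := by
  induction t generalizing m with
  | nil => exact .step fun v => ⟨none, by simp [decider, popR, go]⟩
  | cons a t ih =>
    simp only [List.mem_cons, not_or] at ht
    have h : Run gs .rewind [] (regs m [] (a :: t) [] [] g) .rewind [] (regs (a :: m) [] t [] [] g)
        1 := .step fun v => ⟨some a, by simp [decider, popR, pushV, go, Ne.symm ht.1]⟩
    have h2 := (h.trans (ih ht.2 (a :: m))).mono (u := t.length + 1 + 1) (by omega)
    simpa using h2

variable (m x t n p g : List Sym)

theorem run_uncopy (r : Ret) :
    Run gs (.uncopy r) [] (regs m x t n p g) (.scan r) []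
      (regs (t.reverse ++ m) (t.reverse ++ x) [] n p g) (t.length + 1) := by
  induction t generalizing m x with
  | nil => exact .step fun v => ⟨none, by simp [decider, popR, go]⟩
  | cons a t ih =>
    have h : Run gs (.uncopy r) [] (regs m x (a :: t) n p g) (.uncopy r) []
        (regs (a :: m) (a :: x) t n p g) 1 :=
      .step fun v => ⟨some a, by simp [decider, popR, pushV, go]⟩
    have h2 := (h.trans (ih (a :: m) (a :: x))).mono (u := t.length + 1 + 1) (by omega)
    simpa using h2

/-- Comparing the key with the front of `X`, if it is a prefix. -/
theorem run_cmp_found (r : Ret) {x n : List Sym} (h : n <+: x) :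
    Run gs (.cmp r) [] (regs m x t n p g) (.keyFound r) []
      (regs m (x.drop n.length) (n.reverse ++ t) [] p g) (2 * n.length + 1) := by
  induction n generalizing x t with
  | nil => exact .step fun v => ⟨none, by simp [decider, popR]⟩
  | cons a n ih =>
    obtain ⟨y, rfl⟩ := h
    have h1 : Run gs (.cmp r) [] (regs m (a :: n ++ y) t (a :: n) p g) (.cmp' r a) []
        (regs m (a :: n ++ y) t n p g) 1 := .step fun v => ⟨some a, by simp [decider, popR]⟩
    have h2 : Run gs (.cmp' r a) [] (regs m (a :: n ++ y) t n p g) (.cmp r) []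
        (regs m (n ++ y) (a :: t) n p g) 1 :=
      .step fun v => ⟨some a, by simp [decider, popR, pushR, go]⟩
    have h3 := ((h1.trans h2).trans (ih (a :: t) (x := n ++ y) ⟨y, rfl⟩)).mono
      (u := 2 * (a :: n).length + 1) (by simp; omega)
    simpa using h3

/-- Comparing the key with the front of `X`, if it is not a prefix. -/
theorem run_cmp_missed (r : Ret) {x n : List Sym} (h : ¬ n <+: x) :
    ∃ y x' n', x = y ++ x' ∧ n = y ++ n' ∧
      Run gs (.cmp r) [] (regs m x t n p g) (.keyMissed r) [] (regs m x' (y.reverse ++ t) n' p g)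
        (2 * y.length + 2) := by
  induction n generalizing x t with
  | nil => simp at h
  | cons a n ih =>
    have h1 : Run gs (.cmp r) [] (regs m x t (a :: n) p g) (.cmp' r a) [] (regs m x t n p g) 1 :=
      .step fun v => ⟨some a, by simp [decider, popR]⟩
    cases x with
    | nil =>
      refine ⟨[], [], a :: n, rfl, rfl, h1.trans (u := 1) (.step fun v => ⟨none, ?_⟩)⟩
      simp [decider, popR, pushR, go]
    | cons c x =>
      by_cases hc : c = a
      · subst hc
        have h2 : Run gs (.cmp' r c) [] (regs m (c :: x) t n p g) (.cmp r) []
            (regs m x (c :: t) n p g) 1 :=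
          .step fun v => ⟨some c, by simp [decider, popR, pushR, go]⟩
        obtain ⟨y, x', n', rfl, rfl, h3⟩ := ih (c :: t) (x := x) (by simpa using h)
        refine ⟨c :: y, x', n', rfl, rfl, ?_⟩
        have h4 := ((h1.trans h2).trans h3).mono (u := 2 * (c :: y).length + 2) (by simp; omega)
        simpa using h4
      · refine ⟨[], c :: x, a :: n, rfl, rfl, h1.trans (u := 1) (.step fun v => ⟨some c, ?_⟩)⟩
        simp [decider, popR, pushR, pushV, go, hc]

/-- Where and with which rest `X` a search ends. -/
theorem run_scan (r : Ret) {n : List Sym} (hn : r.sym ∉ n) :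
    Run gs (.scan r) [] (regs m x [] n p g)
      (if (search r.sym n x).isSome then .found r else r.missing) []
      (regs m ((search r.sym n x).getD []) [] n p g) (4 * x.length + 4) := by
  induction hx : x.length using Nat.strong_induction_on generalizing x with
  | _ k ih =>
    subst hx
    cases x with
    | nil =>
      simp only [search]
      exact (Run.step fun v => ⟨none, by simp [decider, popR]⟩ : Run _ _ _ _ _ _ _ 1).mono (by simp)
    | cons a x =>
      by_cases ha : a = r.sym
      · subst ha
        have h1 : Run gs (.scan r) [] (regs m (r.sym :: x) [] n p g) (.cmp r) []
          (regs m x [] n p g) 1 := .step fun v => ⟨some r.sym, by simp [decider, popR]⟩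
        by_cases h : n <+: x
        · have h2 := run_cmp_found (gs := gs) m [] p g r h
          have h3 := run_move (gs := gs) (l := .keyFound r) (a := .T) (b := .N) (by simp) rfl []
            (regs m (x.drop n.length) (n.reverse ++ []) [] p g)
          have h4 := h.length_le
          have h5 := ((h1.trans h2).trans h3).mono (u := 4 * (r.sym :: x).length + 4)
            (by simp; omega)
          simpa [search, h] using h5
        · obtain ⟨y, x', n', rfl, rfl, h2⟩ := run_cmp_missed (gs := gs) m [] p g r h
          have h3 := run_move (gs := gs) (l := .keyMissed r) (a := .T) (b := .N) (by simp) rfl []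
            (regs m x' (y.reverse ++ []) n' p g)
          simp only [List.mem_append, not_or] at hn
          have h4 := ih x'.length (by simp) x' rfl
          have h5 : search r.sym (y ++ n') (r.sym :: (y ++ x')) = search r.sym (y ++ n') x' := by
            rw [search, if_neg (by simpa using h), search_append hn.1]
          simp only [regs_T, regs_N, update_regs_T, update_regs_N, List.append_nil,
            List.reverse_reverse] at h2 h3
          rw [h5]
          exact (((h1.trans h2).trans h3).trans h4).mono (by simp; omega)
      · have h1 : Run gs (.scan r) [] (regs m (a :: x) [] n p g) (.scan r) []
          (regs m x [] n p g) 1 := .step fun v => ⟨some a, by simp [decider, popR, ha]⟩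
        rw [search_cons_of_ne ha]
        exact (h1.trans (ih x.length (by simp) x rfl)).mono (by simp; omega)

/-- A complete search in the memory. -/
theorem run_search (r : Ret) {n : List Sym} (hn : r.sym ∉ n) :
    Run gs (.copy r) [] (regs m [] [] n p g)
      (if (search r.sym n m).isSome then .found r else r.missing) []
      (regs m ((search r.sym n m).getD []) [] n p g) (6 * m.length + 6) := by
  have h1 := run_move (gs := gs) (l := .copy r) (a := .M) (b := .T) (by simp) rfl []
    (regs m [] [] n p g)
  have h2 := run_uncopy (gs := gs) [] [] m.reverse n p g r
  have h3 := run_scan (gs := gs) m m p g r hn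
  simp only [regs_M, regs_T, update_regs_M, update_regs_T, List.append_nil,
    List.reverse_reverse] at h1 h2
  exact ((h1.trans h2).trans h3).mono (by simp; omega)

theorem run_arg (r : Ret) (u : List Bool) :
    Run gs (.arg r) [] (regs m [] [] [] (symBits u ++ p) g) (.copy r) []
      (regs m [] [] (symBits u) p g) (2 * (symBits u).length + 1) := by
  have h (t : List Sym) : Run gs (.arg r) [] (regs m [] t [] (symBits u ++ p) g) (.arg' r) []
      (regs m [] ((symBits u).reverse ++ t) [] p g) (symBits u).length := by
    induction u generalizing t with
    | nil => exact .step fun v => ⟨some (.tok .term), by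
        simp [decider, popR, pushV, symBits, encBits]⟩
    | cons b u ih =>
      have h1 : Run gs (.arg r) [] (regs m [] t [] (symBits (b :: u) ++ p) g) (.arg r) []
        (regs m [] (.tok (.bit b) :: t) [] (symBits u ++ p) g) 1 :=
        .step fun v => ⟨some (.tok (.bit b)), by simp [decider, popR, pushV, symBits, encBits]⟩
      have h2 := (h1.trans (ih (.tok (.bit b) :: t))).mono (u := (symBits (b :: u)).length)
        (by simp [symBits, encBits]; omega)
      have h3 : symBits (b :: u) = .tok (.bit b) :: symBits u := rfl
      simpa [h3] using h2
  have h1 := h []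
  have h2 := run_move (gs := gs) (l := .arg' r) (a := .T) (b := .N) (by simp) rfl []
    (regs m [] ((symBits u).reverse ++ []) [] p g)
  simp only [regs_T, regs_N, update_regs_T, update_regs_N, List.append_nil,
    List.reverse_reverse] at h1 h2
  exact (h1.trans h2).mono (by simp; omega)

theorem run_skip (k : Skip) (u : List Bool) :
    Run gs (.skip k) [] (regs m x t n (symBits u ++ p) g) k.dest [] (regs m x t n p g)
      (symBits u).length := by
  induction u with
  | nil => exact .step fun v => ⟨some (.tok .term), by simp [decider, popR, symBits, encBits]⟩
  | cons b u ih =>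
    have h1 : Run gs (.skip k) [] (regs m x t n (symBits (b :: u) ++ p) g) (.skip k) []
      (regs m x t n (symBits u ++ p) g) 1 :=
      .step fun v => ⟨some (.tok (.bit b)), by simp [decider, popR, symBits, encBits]⟩
    exact (h1.trans ih).mono (by simp [symBits, encBits]; omega)

/-- Paying for an instruction. -/
theorem stepAux_pay (c k : ℕ) (l : Lab) (v : Option Sym) :
    ∃ v', TM2.stepAux (payStmt c (go l)) v
        (stks [] (regs m x t n p (List.replicate k (.tok .one))) []) =
      ⟨some (if k < c then .fin false else l), v',
        stks [] (regs m x t n p (List.replicate (k - c) (.tok .one))) []⟩ := by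
  induction c generalizing k v with
  | zero => exact ⟨v, by simp [payStmt, go]⟩
  | succ c ih =>
    cases k with
    | zero => exact ⟨none, by simp [payStmt, popR, go]⟩
    | succ k =>
      obtain ⟨v', h⟩ := ih k (some (.tok .one))
      exact ⟨v', by simpa [payStmt, popR, List.replicate_succ] using h⟩

/-- Putting `X` in the place of the program counter. -/
theorem run_goto (c : Bool) :
    Run gs (.goto c) [] (regs m x [] n p g) (cond c .chargeLabel .main) []
      (regs m [] [] [] x g) (2 * x.length + n.length + p.length + 4) := by
  have h1 := run_clear (gs := gs) (l := .goto c) (a := .N) rfl [] (regs m x [] n p g)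
  have h2 := run_clear (gs := gs) (l := .goto₁ c) (a := .P) rfl [] (regs m x [] [] p g)
  have h3 := run_move (gs := gs) (l := .goto₂ c) (a := .X) (b := .T) (by simp) rfl []
    (regs m x [] [] [] g)
  have h4 := run_move (gs := gs) (l := .goto₃ c) (a := .T) (b := .P) (by simp) rfl []
    (regs m [] (x.reverse ++ []) [] [] g)
  simp only [regs_X, regs_T, regs_N, regs_P, update_regs_X, update_regs_P, update_regs_T,
    update_regs_N, List.append_nil, List.reverse_reverse] at h1 h2 h3 h4
  exact (((h1.trans h2).trans h3).trans h4).mono (by simp; omega)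

/-- The bits of `u` in the memory, without a terminator. -/
def rawBits (u : List Bool) : List Sym := u.map fun b => .tok (.bit b)

theorem symBits_eq (u : List Bool) : symBits u = rawBits u ++ [.tok .term] := by
  simp [symBits, encBits, rawBits]

theorem run_val (o : Option Bool) (u : List Bool) (y : List Sym) :
    Run gs (.val o) [] (regs m (symBits u ++ y) t n p g) (.put o) []
      (regs m y ((rawBits u).reverse ++ t) n p g) (u.length + 1) := by
  induction u generalizing t with
  | nil => exact .step fun v => ⟨some (.tok .term), by
      simp [decider, popR, symBits, encBits, rawBits, go]⟩
  | cons b u ih =>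
    have h1 : Run gs (.val o) [] (regs m (symBits (b :: u) ++ y) t n p g) (.val o) []
      (regs m (symBits u ++ y) (.tok (.bit b) :: t) n p g) 1 :=
      .step fun v => ⟨some (.tok (.bit b)), by
        cases b <;> simp [decider, popR, pushV, go, symBits, encBits]⟩
    have h2 := (h1.trans (ih (.tok (.bit b) :: t))).mono (u := (b :: u).length + 1)
      (by simp; omega)
    have h3 : rawBits (b :: u) = .tok (.bit b) :: rawBits u := rfl
    simpa [h3] using h2

theorem run_val_nil (o : Option Bool) :
    Run gs (.val o) [] (regs m [] t n p g) (.put o) [] (regs m [] t n p g) 1 :=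
  .step fun v => ⟨none, by simp [decider, popR, go]⟩

/-- Adding an entry to the state. -/
theorem run_put (o : Option Bool) :
    Run gs (.put o) [] (regs m x t n p g) .main []
      (regs (.mark .entry :: (n ++ (rawBits o.toList ++ (t.reverse ++ .tok .term :: m))))
        [] [] [] p g) (x.length + t.length + 2 * n.length + 7) := by
  have h1 := run_clear (gs := gs) (l := .put o) (a := .X) rfl [] (regs m x t n p g)
  have h2 : Run gs (.put₁ o) [] (regs m [] t n p g) (.put₂ o) []
      (regs (.tok .term :: m) [] t n p g) 1 :=
    .step fun v => ⟨v, by simp [decider, pushR, go]⟩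
  have h3 := run_move (gs := gs) (l := .put₂ o) (a := .T) (b := .M) (by simp) rfl []
    (regs (.tok .term :: m) [] t n p g)
  simp only [regs_M, regs_X, regs_T, update_regs_X, update_regs_T, update_regs_M] at h1 h2 h3
  generalize t.reverse ++ .tok .term :: m = m' at h3 ⊢
  have h4 : Run gs (.put₃ o) [] (regs m' [] [] n p g) .put₄ []
      (regs (rawBits o.toList ++ m') [] [] n p g) 1 :=
    .step fun v => ⟨v, by cases o <;> simp [decider, pushR, go, rawBits]⟩
  have h5 := run_move (gs := gs) (l := .put₄) (a := .N) (b := .T) (by simp) rfl []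
    (regs (rawBits o.toList ++ m') [] [] n p g)
  have h6 := run_move (gs := gs) (l := .put₅) (a := .T) (b := .M) (by simp) rfl []
    (regs (rawBits o.toList ++ m') [] (n.reverse ++ []) [] p g)
  simp only [regs_M, regs_T, regs_N, update_regs_T, update_regs_N, update_regs_M, List.append_nil,
    List.reverse_reverse] at h5 h6
  have h7 : Run gs .put₆ [] (regs (n ++ (rawBits o.toList ++ m')) [] [] [] p g) .main []
      (regs (.mark .entry :: (n ++ (rawBits o.toList ++ m'))) [] [] [] p g) 1 :=
    .step fun v => ⟨v, by simp [decider, pushR, go]⟩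
  exact ((((((h1.trans h2).trans h3).trans h4).trans h5).trans h6).trans h7).mono (by simp; omega)

end

/-! ### The decider simulates the virtual machine -/

/-- From the configuration `c` on, the object `o` is used at some time. -/
def Acc (gs : GasSchedule) (tx : Transaction) (o : ObjId) (c : Cfg) : Prop :=
  ∃ c', Reaches (step gs tx) c c' ∧ (o ∈ c'.usedRead ∨ o ∈ c'.usedWrite)

theorem acc_iff_of_step {gs : GasSchedule} {tx : Transaction} {o : ObjId} {c c' : Cfg}
    (hr : o ∉ c.usedRead) (hw : o ∉ c.usedWrite) (h : step gs tx c = some c') :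
    Acc gs tx o c ↔ Acc gs tx o c' := by
  constructor
  · rintro ⟨d, hd, hu⟩
    rcases Relation.ReflTransGen.cases_head hd with rfl | ⟨e, he, hd⟩
    · tauto
    · rw [h] at he
      cases he
      exact ⟨d, hd, hu⟩
  · rintro ⟨d, hd, hu⟩
    exact ⟨d, .head h hd, hu⟩

theorem not_acc_of_step {gs : GasSchedule} {tx : Transaction} {o : ObjId} {c : Cfg}
    (hr : o ∉ c.usedRead) (hw : o ∉ c.usedWrite) (h : step gs tx c = none) :
    ¬ Acc gs tx o c := by
  rintro ⟨d, hd, hu⟩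
  rcases Relation.ReflTransGen.cases_head hd with rfl | ⟨e, he, hd⟩
  · tauto
  · rw [h] at he
    cases he

/-- The decider started at label `l` outputs in time `t` whether the object of `x` is used from the
configuration `c` on. -/
def Decides (gs : GasSchedule) (x : Instance) (l : Lab) (S : Reg → List Sym) (c : Cfg) (t : ℕ) :
    Prop :=
  ∃ β, Final gs l [] S β t ∧ (β = true ↔ Acc gs x.tx x.obj c)

section
variable {gs : GasSchedule} {x : Instance} {l l' : Lab} {S S' : Reg → List Sym} {c c' : Cfg}
  {t u V b : ℕ}

theorem Decides.mono (h : Decides gs x l S c t) (htu : t ≤ u) : Decides gs x l S c u :=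
  let ⟨β, h1, h2⟩ := h
  ⟨β, h1.mono htu, h2⟩

theorem Decides.of_run (h' : Decides gs x l' S' c u) (h : Run gs l [] S l' [] S' t) :
    Decides gs x l S c (t + u) :=
  let ⟨β, h1, h2⟩ := h'
  ⟨β, h.final h1, h2⟩

theorem Decides.congr (h' : Decides gs x l S c' t)
    (hc : Acc gs x.tx x.obj c ↔ Acc gs x.tx x.obj c') : Decides gs x l S c t :=
  let ⟨β, h1, h2⟩ := h'
  ⟨β, h1, h2.trans hc.symm⟩

theorem decides_fin {m x' t' n p g : List Sym} {β : Bool} (h : β = true ↔ Acc gs x.tx x.obj c)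
    (hm : m.length ≤ b) (hx : x'.length ≤ b) (ht : t'.length ≤ b) (hn : n.length ≤ b)
    (hp : p.length ≤ b) (hg : g.length ≤ b) :
    Decides gs x (.fin β) (regs m x' t' n p g) c (6 * b + 7) :=
  ⟨β, (final_fin gs β [] m x' t' n p g).mono (by simp; omega), h⟩

/-- The configuration `c` of the virtual machine can be represented by the decider, with the
entries `l` added to the state. The numbers `V` and `b` bound the lengths of all values and of the
memory until the gas is used up. -/
structure Rep (x : Instance) (V b : ℕ) (l : List (ObjId × Value)) (c : Cfg) : Prop where
  rest : c.rest <:+ x.tx.ins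
  state : c.state = stateOf (l ++ x.state)
  notRead : x.obj ∉ c.usedRead
  notWritten : x.obj ∉ c.usedWrite
  val : ∀ o, (c.state o).length + c.gas ≤ V
  bound : (mem l x).length + c.gas * (V + (mem [] x).length + 10) ≤ b

/-- The contents of the work stacks that represent a configuration. -/
def repRegs (x : Instance) (l : List (ObjId × Value)) (c : Cfg) : Reg → List Sym :=
  regs (mem l x) [] [] [] (symCode c.rest ++ memTail x) (List.replicate c.gas (.tok .one))

variable {e : List (ObjId × Value)}

theorem length_mem_nil_le (x : Instance) (e : List (ObjId × Value)) :
    (mem [] x).length ≤ (mem e x).length := by simp [mem]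

theorem length_symCode_le {i : List Instr} (h : i <:+ x.tx.ins) :
    (symCode i ++ memTail x).length ≤ (mem [] x).length := by
  obtain ⟨j, hj⟩ := h
  simp [mem, ← hj, symCode]
  omega

theorem Rep.gas_le (h : Rep x V b e c) : c.gas ≤ b := by
  have h1 := h.bound
  have : c.gas ≤ c.gas * (V + (mem [] x).length + 10) := Nat.le_mul_of_pos_right _ (by omega)
  omega

theorem Rep.mem_le (h : Rep x V b e c) : (mem e x).length ≤ b := by
  have h1 := h.bound
  omega

theorem Rep.rest_le (h : Rep x V b e c) : (symCode c.rest ++ memTail x).length ≤ b :=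
  (length_symCode_le h.rest).trans ((length_mem_nil_le x e).trans h.mem_le)

/-- Going to another place of the program. -/
theorem Rep.move (h : Rep x V b e c) {i : List Instr} (hi : i <:+ x.tx.ins) {k : ℕ}
    (hk : k ≤ c.gas) {r w : Finset ObjId} (hr : x.obj ∉ r) (hw : x.obj ∉ w) :
    Rep x V b e ⟨i, c.state, k, r, w⟩ where
  rest := hi
  state := h.state
  notRead := hr
  notWritten := hw
  val o := by have := h.val o; simp only; omega
  bound := by
    have h1 := h.bound
    have := Nat.mul_le_mul_right (V + (mem [] x).length + 10) hk
    simp only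
    omega

theorem stateOf_cons (o : ObjId) (v : Value) (e : List (ObjId × Value)) :
    stateOf ((o, v) :: e) = Function.update (stateOf e) o v := by
  funext o'
  by_cases h : o' = o
  · subst h; simp [stateOf]
  · have h1 : (o' == o) = false := by simpa using h
    simp [stateOf, List.lookup_cons, h1, h]

/-- Writing a value that has at most one bit more than the old one. -/
theorem Rep.write (h : Rep x V b e c) {i : List Instr} (hi : i <:+ x.tx.ins) {k : ℕ}
    (hk : k < c.gas) {r w : Finset ObjId} (hr : x.obj ∉ r) (hw : x.obj ∉ w) {o : ObjId} {v : Value}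
    (ho : (symBits o).length ≤ (mem [] x).length) (hv : v.length ≤ (c.state o).length + 1) :
    Rep x V b ((o, v) :: e) ⟨i, Function.update c.state o v, k, r, w⟩ where
  rest := hi
  state := by rw [h.state, List.cons_append, stateOf_cons]
  notRead := hr
  notWritten := hw
  val o' := by
    simp only
    by_cases h' : o' = o
    · subst h'
      have := h.val o'
      rw [Function.update_self]
      omega
    · have := h.val o'
      rw [Function.update_of_ne h']
      omega
  bound := by
    have h1 := h.bound
    have h2 := h.val o
    have h3 := Nat.mul_le_mul_right (V + (mem [] x).length + 10) (Nat.succ_le_of_lt hk)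
    have h4 : (mem ((o, v) :: e) x).length =
        (mem e x).length + 1 + (symBits o).length + (v.length + 1) := by
      simp [mem, symEntry, symBits, encBits]
      omega
    rw [Nat.succ_mul] at h3
    simp only
    omega

/-- The time for one step of the virtual machine and the subsequent jump. -/
def stepTime (b : ℕ) : ℕ := 100 * (b + 1)

/-- The induction hypothesis for the simulation: the decider is correct on all configurations with
less gas than `k`. -/
def DecidesBelow (gs : GasSchedule) (x : Instance) (V b k : ℕ) : Prop :=
  ∀ e c, c.gas < k → Rep x V b e c →
    Decides gs x .main (repRegs x e c) c ((c.gas + 1) * stepTime b)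

theorem DecidesBelow.decides {k : ℕ} (ih : DecidesBelow gs x V b k) (hc : c.gas < k)
    (h : Rep x V b e c) : Decides gs x .main (repRegs x e c) c (k * stepTime b) :=
  (ih e c hc h).mono (Nat.mul_le_mul_right _ hc)

theorem seek_suffix (tx : Transaction) (ℓ : Label) : tx.seek ℓ <:+ tx.ins :=
  List.dropWhile_suffix _

theorem head_seek {tx : Transaction} {ℓ : Label} {i : Instr} {is : List Instr}
    (h : tx.seek ℓ = i :: is) : i = .label ℓ := by
  rw [Transaction.seek] at h
  generalize tx.ins = l at h
  induction l with
  | nil => simp at h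
  | cons j js ih =>
    rw [List.dropWhile_cons] at h
    split_ifs at h with hj
    · exact ih h
    · cases h
      simpa using hj

theorem run_main {i : Instr} {is : List Instr} (m x' t' n p g : List Sym) :
    ∃ z, symCode (i :: is) ++ p = .tok (.op i.op) :: z ∧
      Run gs .main [] (regs m x' t' n (symCode (i :: is) ++ p) g) (.charge i.op) []
        (regs m x' t' n z g) 1 := by
  obtain ⟨z, hz⟩ : ∃ z, symCode (i :: is) ++ p = .tok (.op i.op) :: z := by
    cases i <;> exact ⟨_, rfl⟩
  exact ⟨z, hz, .step fun v => ⟨some (.tok (.op i.op)), by simp [decider, popR, hz]⟩⟩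

theorem run_charge (p : Op) (k : ℕ) (m x' t' n r : List Sym) :
    Run gs (.charge p) [] (regs m x' t' n r (List.replicate k (.tok .one)))
      (if k < gs.cost p then .fin false else p.code) []
      (regs m x' t' n r (List.replicate (k - gs.cost p) (.tok .one))) 1 :=
  .step fun v => stepAux_pay m x' t' n r (gs.cost p) k p.code v

theorem run_chargeLabel (k : ℕ) (m x' t' n r : List Sym) :
    Run gs .chargeLabel [] (regs m x' t' n r (List.replicate k (.tok .one)))
      (if k < gs.cost .label then .fin false else .main) []
      (regs m x' t' n r (List.replicate (k - gs.cost .label) (.tok .one))) 1 :=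
  .step fun v => stepAux_pay m x' t' n r (gs.cost .label) k .main v

theorem length_search_getD_le {a : Sym} {key m : List Sym} (h : m.length ≤ b) :
    ((search a key m).getD []).length ≤ b := by
  rcases h' : search a key m with _ | z
  · simp
  · exact (length_search h').trans h

/-- The decider carries out a jump, including the first step at the target. -/
theorem decides_jump {k : ℕ} (ih : DecidesBelow gs x V b k) (h : Rep x V b e c) (hc : c.gas < k)
    {ℓ : Label} (hℓ : c.rest = x.tx.seek ℓ) (p : List Sym) (hp : (symBits ℓ ++ p).length ≤ b) :
    Decides gs x (.arg .jump) (regs (mem e x) [] [] [] (symBits ℓ ++ p)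
      (List.replicate c.gas (.tok .one))) c (k * stepTime b + 20 * (b + 1)) := by
  have hm := h.mem_le
  have hg := h.gas_le
  have h1 := run_arg (gs := gs) (mem e x) p (List.replicate c.gas (.tok .one)) .jump ℓ
  have h2 := run_search (gs := gs) (mem e x) p (List.replicate c.gas (.tok .one)) .jump
    (Ret.sym_notMem .jump ℓ)
  have h3 := h1.trans h2
  rw [List.length_append] at hp
  rw [search_label, ← hℓ] at h3
  rcases hs : c.rest with _ | ⟨i, is⟩
  · simp only [hs] at h3
    have h4 : step gs x.tx c = none := by rw [step, hs]
    refine ((decides_fin (β := false) (b := b) ?_ hm ?_ ?_ ?_ ?_ ?_).of_run h3).mono ?_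
    · simpa using not_acc_of_step h.notRead h.notWritten h4
    all_goals try (simp; done)
    · omega
    · omega
    · simpa using hg
    · omega
  · simp only [hs] at h3
    obtain rfl := head_seek (hℓ.symm.trans hs)
    have hsuf : is <:+ x.tx.ins := (List.suffix_cons _ _).trans (hs ▸ h.rest)
    have hlen : (symCode is ++ memTail x).length ≤ b :=
      (length_symCode_le hsuf).trans ((length_mem_nil_le x e).trans hm)
    have h4 : Run gs (.found .jump) [] (regs (mem e x) (symCode is ++ memTail x) [] (symBits ℓ) p
        (List.replicate c.gas (.tok .one))) (.goto true) [] (regs (mem e x)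
          (symCode is ++ memTail x) [] (symBits ℓ) p (List.replicate c.gas (.tok .one))) 1 :=
      .step fun v => ⟨v, by simp [decider, go]⟩
    have h5 := run_goto (gs := gs) (mem e x) (symCode is ++ memTail x) (symBits ℓ) p
      (List.replicate c.gas (.tok .one)) true
    have h6 := run_chargeLabel (gs := gs) c.gas (mem e x) [] [] [] (symCode is ++ memTail x)
    have h7 := ((h3.trans h4).trans h5).trans h6
    by_cases hgas : c.gas < gs.cost .label
    · rw [if_pos hgas] at h7
      have h8 : step gs x.tx c = none := by rw [step, hs]; simp [Instr.op, hgas]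
      refine ((decides_fin (β := false) (b := b) ?_ hm ?_ ?_ ?_ hlen ?_).of_run h7).mono ?_
      · simpa using not_acc_of_step h.notRead h.notWritten h8
      all_goals try (simp; done)
      · simp; omega
      · omega
    · rw [if_neg hgas] at h7
      have h8 : step gs x.tx c = some { c with rest := is, gas := c.gas - gs.cost .label } := by
        rw [step, hs]; simp [Instr.op, hgas]
      refine Decides.congr (Decides.mono (Decides.of_run (ih.decides ?_ (h.move hsuf
        (k := c.gas - gs.cost .label) ?_ h.notRead h.notWritten)) h7) ?_)
        (acc_iff_of_step h.notRead h.notWritten h8)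
      · simp only; omega
      · omega
      · omega

/-- The decider looks up the value of an object that is accessed, if the object is declared and
is not the object of the instance. -/
theorem run_access (h : Rep x V b e c) (a : Act) {o : ObjId} (ho : x.obj ≠ o)
    (hd : o ∈ cond a.isWrite x.tx.writeSet x.tx.readSet) (p g : List Sym)
    (hp : (symBits o ++ p).length ≤ b) :
    ∃ y, y.length ≤ b ∧ (c.state o = [] ∧ y = [] ∨ ∃ z, y = symBits (c.state o) ++ z) ∧
      Run gs (.arg (.decl a)) [] (regs (mem e x) [] [] [] (symBits o ++ p) g)
        (.use a) [] (regs (mem e x) y [] (symBits o) p g) (22 * (b + 1)) := by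
  have hm := h.mem_le
  rw [List.length_append] at hp
  have h1 := run_arg (gs := gs) (mem e x) p g (.decl a) o
  have h2 := run_search (gs := gs) (mem e x) p g (.decl a) (Ret.sym_notMem _ o)
  rw [if_pos ((search_decl e x a o).2 hd)] at h2
  have h3 := run_clear (gs := gs) (l := .found (.decl a)) (a := .X) rfl [] (regs (mem e x)
    ((search (Ret.decl a).sym (symBits o) (mem e x)).getD []) [] (symBits o) p g)
  have hl := length_search_getD_le (a := (Ret.decl a).sym) (key := symBits o) hm
  have h4 := run_search (gs := gs) (mem e x) p g (.obj a) (Ret.sym_notMem _ o)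
  have h5 : ¬ (search (Ret.obj a).sym (symBits o) (mem e x)).isSome := by
    rwa [search_obj]
  rw [if_neg h5, Option.not_isSome_iff_eq_none.1 h5, Option.getD_none] at h4
  have h6 := run_search (gs := gs) (mem e x) p g (.val a) (Ret.sym_notMem _ o)
  have hl' := length_search_getD_le (a := (Ret.val a).sym) (key := symBits o) hm
  simp only [regs_X, update_regs_X] at h3
  have h7 := (((h1.trans h2).trans h3).trans h4).trans h6
  have hv := search_val e x a o
  rw [← h.state] at hv
  rcases hv with ⟨hv, hs⟩ | ⟨y, hs⟩
  · rw [hs] at h7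
    exact ⟨[], by simp, .inl ⟨hv, rfl⟩, h7.mono (by omega)⟩
  · rw [hs] at h7 hl'
    have h8 : Run gs (.found (.val a)) [] (regs (mem e x) (symBits (c.state o) ++ y) [] (symBits o)
        p g) (.use a) [] (regs (mem e x) (symBits (c.state o) ++ y) [] (symBits o) p g) 1 :=
      .step fun v => ⟨v, by simp [decider, go]⟩
    exact ⟨_, hl', .inr ⟨y, rfl⟩, (h7.trans h8).mono (by omega)⟩

/-- The decider rejects if an object that is not declared is to be accessed. -/
theorem decides_undeclared (h : Rep x V b e c) (a : Act) {o : ObjId}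
    (hd : o ∉ cond a.isWrite x.tx.writeSet x.tx.readSet) (p : List Sym) {k : ℕ} (hk : k ≤ b)
    (hp : (symBits o ++ p).length ≤ b) (hc : step gs x.tx c = none) :
    Decides gs x (.arg (.decl a)) (regs (mem e x) [] [] [] (symBits o ++ p)
      (List.replicate k (.tok .one))) c (20 * (b + 1)) := by
  have hm := h.mem_le
  rw [List.length_append] at hp
  have h1 := run_arg (gs := gs) (mem e x) p (List.replicate k (.tok .one)) (.decl a) o
  have h2 := run_search (gs := gs) (mem e x) p (List.replicate k (.tok .one)) (.decl a)
    (Ret.sym_notMem _ o)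
  have hl := length_search_getD_le (a := (Ret.decl a).sym) (key := symBits o) hm
  rw [if_neg (by rwa [search_decl])] at h2
  refine ((decides_fin (β := false) (b := b) ?_ hm hl ?_ ?_ ?_ ?_).of_run (h1.trans h2)).mono ?_
  · simpa using not_acc_of_step h.notRead h.notWritten hc
  all_goals try (simp; done)
  · omega
  · omega
  · simpa using hk
  · omega

/-- The decider accepts if the object of the instance is accessed. -/
theorem decides_used (h : Rep x V b e c) (a : Act)
    (hd : x.obj ∈ cond a.isWrite x.tx.writeSet x.tx.readSet) (p : List Sym) {k : ℕ} (hk : k ≤ b)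
    (hp : (symBits x.obj ++ p).length ≤ b) (hc : Acc gs x.tx x.obj c) :
    Decides gs x (.arg (.decl a)) (regs (mem e x) [] [] [] (symBits x.obj ++ p)
      (List.replicate k (.tok .one))) c (25 * (b + 1)) := by
  have hm := h.mem_le
  rw [List.length_append] at hp
  generalize hg : List.replicate k (Sym.tok .one) = g
  have h1 := run_arg (gs := gs) (mem e x) p g (.decl a) x.obj
  have h2 := run_search (gs := gs) (mem e x) p g (.decl a) (Ret.sym_notMem _ x.obj)
  rw [if_pos ((search_decl e x a _).2 hd)] at h2
  have h3 := run_clear (gs := gs) (l := .found (.decl a)) (a := .X) rfl [] (regs (mem e x)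
    ((search (Ret.decl a).sym (symBits x.obj) (mem e x)).getD []) [] (symBits x.obj) p g)
  have hl := length_search_getD_le (a := (Ret.decl a).sym) (key := symBits x.obj) hm
  have h4 := run_search (gs := gs) (mem e x) p g (.obj a) (Ret.sym_notMem _ x.obj)
  rw [if_pos ((search_obj e x a _).2 rfl)] at h4
  have hl' := length_search_getD_le (a := (Ret.obj a).sym) (key := symBits x.obj) hm
  simp only [regs_X, update_regs_X] at h3
  have h5 : Run gs (.found (.obj a)) [] (regs (mem e x)
      ((search (Ret.obj a).sym (symBits x.obj) (mem e x)).getD []) [] (symBits x.obj) p g)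
      (.fin true) [] (regs (mem e x)
        ((search (Ret.obj a).sym (symBits x.obj) (mem e x)).getD []) [] (symBits x.obj) p g) 1 :=
    .step fun v => ⟨v, by simp [decider, go]⟩
  refine ((decides_fin (β := true) (b := b) (by simpa using hc) hm hl' ?_ ?_ ?_ ?_).of_run
    ((((h1.trans h2).trans h3).trans h4).trans h5)).mono ?_
  · simp
  · omega
  · omega
  · simpa [← hg] using hk
  · omega

theorem run_use_read {v : Value} {y : List Sym}
    (hy : v = [] ∧ y = [] ∨ ∃ z, y = symBits v ++ z) (m n p g : List Sym) :
    Run gs (.use .read) [] (regs m y [] n p g)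
      (match v.head? with
        | none => .skip .toSkip
        | some false => .arg .jump
        | some true => .skip .toJump) []
      (regs m [] [] [] p g) (y.length + n.length + 3) := by
  have h1 : Run gs (.use .read) [] (regs m y [] n p g) (.branch v.head?) []
      (regs m y.tail [] n p g) 1 := by
    rcases hy with ⟨rfl, rfl⟩ | ⟨z, rfl⟩
    · exact .step fun v => ⟨none, by simp [decider, popR]⟩
    · cases v with
      | nil => exact .step fun v => ⟨some (.tok .term), by simp [decider, popR, symBits, encBits]⟩
      | cons b v =>
        exact .step fun v => ⟨some (.tok (.bit b)), by simp [decider, popR, symBits, encBits]⟩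
  have h2 := run_clear (gs := gs) (l := .branch v.head?) (a := .X) rfl [] (regs m y.tail [] n p g)
  have h3 := run_clear (gs := gs) (l := .branch' v.head?) (a := .N) rfl [] (regs m [] [] n p g)
  simp only [regs_X, update_regs_X, regs_N, update_regs_N] at h2 h3
  exact ((h1.trans h2).trans h3).mono (by simp; omega)

theorem run_use_push {v : Value} {y : List Sym}
    (hy : v = [] ∧ y = [] ∨ ∃ z, y = symBits v ++ z) (b : Bool) (m n p g : List Sym) :
    Run gs (.use (.push b)) [] (regs m y [] n p g) .main []
      (regs (.mark .entry :: (n ++ (rawBits (b :: v) ++ .tok .term :: m))) [] [] [] p g)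
      (3 * y.length + 2 * n.length + 10) := by
  have h1 : Run gs (.use (.push b)) [] (regs m y [] n p g) (.val (some b)) []
      (regs m y [] n p g) 1 := .step fun v => ⟨v, by simp [decider, go]⟩
  rcases hy with ⟨rfl, rfl⟩ | ⟨z, rfl⟩
  · have h2 := run_val_nil (gs := gs) m [] n p g (some b)
    have h3 := run_put (gs := gs) m [] [] n p g (some b)
    exact ((h1.trans h2).trans h3).mono (by simp; omega)
  · have h2 := run_val (gs := gs) m [] n p g (some b) v z
    have h3 := run_put (gs := gs) m z ((rawBits v).reverse ++ []) n p g (some b)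
    have h4 := ((h1.trans h2).trans h3).mono
      (u := 3 * (symBits v ++ z).length + 2 * n.length + 10)
      (by simp [rawBits, symBits, encBits]; omega)
    simpa [rawBits] using h4

theorem run_use_pop {v : Value} {y : List Sym}
    (hy : v = [] ∧ y = [] ∨ ∃ z, y = symBits v ++ z) (m n p g : List Sym) :
    Run gs (.use .pop) [] (regs m y [] n p g) .main []
      (regs (.mark .entry :: (n ++ (rawBits v.tail ++ .tok .term :: m))) [] [] [] p g)
      (3 * y.length + 2 * n.length + 10) := by
  rcases hy with ⟨rfl, rfl⟩ | ⟨z, rfl⟩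
  · have h1 : Run gs (.use .pop) [] (regs m [] [] n p g) (.put none) []
      (regs m [] [] n p g) 1 := .step fun v => ⟨none, by simp [decider, popR]⟩
    have h3 := run_put (gs := gs) m [] [] n p g none
    exact (h1.trans h3).mono (by simp; omega)
  · cases v with
    | nil =>
      have h1 : Run gs (.use .pop) [] (regs m (symBits [] ++ z) [] n p g) (.put none) []
        (regs m z [] n p g) 1 :=
        .step fun v => ⟨some (.tok .term), by simp [decider, popR, symBits, encBits]⟩
      have h3 := run_put (gs := gs) m z [] n p g none
      exact (h1.trans h3).mono (by simp; omega)
    | cons b v =>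
      have h1 : Run gs (.use .pop) [] (regs m (symBits (b :: v) ++ z) [] n p g) (.val none) []
        (regs m (symBits v ++ z) [] n p g) 1 :=
        .step fun v => ⟨some (.tok (.bit b)), by simp [decider, popR, symBits, encBits]⟩
      have h2 := run_val (gs := gs) m [] n p g none v z
      have h3 := run_put (gs := gs) m z ((rawBits v).reverse ++ []) n p g none
      have h4 := ((h1.trans h2).trans h3).mono
        (u := 3 * (symBits (b :: v) ++ z).length + 2 * n.length + 10)
        (by simp [rawBits, symBits, encBits]; omega)
      simpa [rawBits] using h4

theorem mem_cons (o : ObjId) (v : Value) (e : List (ObjId × Value)) (x : Instance) :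
    mem ((o, v) :: e) x =
      .mark .entry :: (symBits o ++ (rawBits v ++ .tok .term :: mem e x)) := by
  simp [mem, symEntry, symBits_eq]

/-- The decider is correct on every configuration that it can represent. -/
theorem decides_main (k : ℕ) : DecidesBelow gs x V b k := by
  induction k with
  | zero => exact fun e c hc => absurd hc (by omega)
  | succ k ih =>
    intro e c hc h
    rcases Nat.lt_succ_iff_lt_or_eq.1 hc with hc | hc
    · exact ih e c hc h
    have hm := h.mem_le
    have hg := h.gas_le
    have hr := h.rest_le
    rw [Nat.succ_mul, repRegs]
    subst hc
    rcases hs : c.rest with _ | ⟨i, is⟩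
    · have h1 : Run gs .main [] (regs (mem e x) [] [] [] (symCode [] ++ memTail x)
        (List.replicate c.gas (.tok .one))) (.fin false) [] (regs (mem e x) [] [] []
          (memTail x).tail (List.replicate c.gas (.tok .one))) 1 :=
        .step fun v => ⟨some (.tok .close), by simp [decider, popR, symCode, memTail]⟩
      have h2 : step gs x.tx c = none := by rw [step, hs]
      rw [hs] at hr
      refine ((decides_fin (β := false) (b := b) ?_ hm ?_ ?_ ?_ ?_ ?_).of_run h1).mono ?_
      · simpa using not_acc_of_step h.notRead h.notWritten h2
      all_goals try (simp; done)
      · simp [symCode] at hr ⊢; omega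
      · simpa using hg
      · rw [stepTime]; omega
    rw [hs] at hr
    have hsuf : is <:+ x.tx.ins := (List.suffix_cons _ _).trans (hs ▸ h.rest)
    obtain ⟨z, hz, h1⟩ := run_main (gs := gs) (i := i) (is := is) (mem e x) [] [] [] (memTail x)
      (List.replicate c.gas (.tok .one))
    have h2 := run_charge (gs := gs) i.op c.gas (mem e x) [] [] [] z
    have h3 := h1.trans h2
    have hzb : z.length + 1 ≤ b := by rw [hz] at hr; simpa using hr
    by_cases hgas : c.gas < gs.cost i.op
    · rw [if_pos hgas] at h3
      have h4 : step gs x.tx c = none := by rw [step, hs]; simp [hgas]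
      refine ((decides_fin (β := false) (b := b) ?_ hm ?_ ?_ ?_ ?_ ?_).of_run h3).mono ?_
      · simpa using not_acc_of_step h.notRead h.notWritten h4
      all_goals try (simp; done)
      · omega
      · simp; omega
      · rw [stepTime]; omega
    rw [if_neg hgas] at h3
    have hpos := gs.cost_pos i.op
    have hlt : c.gas - gs.cost i.op < c.gas := by omega
    generalize hk : c.gas - gs.cost i.op = k at h3 hlt
    have hkb : k ≤ b := by omega
    -- What remains is to start at the code of the instruction.
    suffices H : Decides gs x i.op.code (regs (mem e x) [] [] [] z (List.replicate k (.tok .one))) c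
        (c.gas * stepTime b + 60 * (b + 1)) from
      (H.of_run h3).mono (by rw [stepTime]; omega)
    have hmem := length_mem_nil_le x e
    have hz0 : z.length ≤ (mem [] x).length := by
      have := length_symCode_le (x := x) (hs ▸ h.rest)
      rw [hz] at this
      simp at this
      omega
    cases i with
    | label ℓ =>
      obtain rfl : z = symBits ℓ ++ (symCode is ++ memTail x) := by
        simpa [symCode, encInstr, symBits, eq_comm, Instr.op] using hz
      rw [List.length_append] at hzb
      have h4 : step gs x.tx c = some { c with rest := is, gas := k } := by
        rw [step, hs]; simp [hgas, hk]
      have h5 := run_skip (gs := gs) (mem e x) [] [] [] (symCode is ++ memTail x)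
        (List.replicate k (.tok .one)) .toMain ℓ
      exact (((ih.decides hlt (h.move hsuf hlt.le h.notRead h.notWritten)).of_run h5).congr
        (acc_iff_of_step h.notRead h.notWritten h4)).mono (by omega)
    | jump ℓ =>
      obtain rfl : z = symBits ℓ ++ (symCode is ++ memTail x) := by
        simpa [symCode, encInstr, symBits, eq_comm, Instr.op] using hz
      have h4 : step gs x.tx c = some { c with rest := x.tx.seek ℓ, gas := k } := by
        rw [step, hs]; simp [hgas, hk]
      exact ((decides_jump ih (h.move (seek_suffix x.tx ℓ) hlt.le h.notRead h.notWritten) hlt rfl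
        _ (by omega)).congr (acc_iff_of_step h.notRead h.notWritten h4)).mono (by omega)
    | halt =>
      have h4 : step gs x.tx c = none := by rw [step, hs]; simp
      refine (decides_fin (β := false) (b := b) ?_ hm ?_ ?_ ?_ ?_ ?_).mono ?_
      · simpa using not_acc_of_step h.notRead h.notWritten h4
      all_goals try (simp; done)
      · omega
      · simpa using hkb
      · omega
    | read o ℓ₀ ℓ₁ =>
      obtain rfl : z = symBits o ++ (symBits ℓ₀ ++ (symBits ℓ₁ ++ (symCode is ++ memTail x))) := by
        simpa [symCode, encInstr, symBits, eq_comm, Instr.op] using hz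
      by_cases hd : o ∈ x.tx.readSet
      swap
      · exact (decides_undeclared h .read hd _ hkb (by omega)
          (by rw [step, hs]; simp [hd])).mono (by omega)
      have h4 : step gs x.tx c = some { c with
          rest := match c.state o with
            | [] => is
            | false :: _ => x.tx.seek ℓ₀
            | true :: _ => x.tx.seek ℓ₁
          gas := k
          usedRead := insert o c.usedRead } := by
        rcases hv : c.state o with _ | ⟨_ | _, _⟩ <;> simp [step, hs, hv, hgas, hk, hd]
      by_cases ho : x.obj = o
      · subst ho
        exact (decides_used h .read hd _ hkb (by omega) ⟨_, .single h4, by simp⟩).mono (by omega)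
      obtain ⟨y, hyb, hy, h5⟩ := run_access (gs := gs) h .read ho hd
        (symBits ℓ₀ ++ (symBits ℓ₁ ++ (symCode is ++ memTail x))) (List.replicate k (.tok .one))
        (by omega)
      have h6 := h5.trans (run_use_read hy (mem e x) (symBits o)
        (symBits ℓ₀ ++ (symBits ℓ₁ ++ (symCode is ++ memTail x))) (List.replicate k (.tok .one)))
      have hr' : x.obj ∉ insert o c.usedRead := by simp [ho, h.notRead]
      simp only [List.length_append] at hzb
      refine Decides.congr ?_ (acc_iff_of_step h.notRead h.notWritten h4)
      rcases hv : c.state o with _ | ⟨_ | _, v⟩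
      · have h7 := run_skip (gs := gs) (mem e x) [] [] [] (symBits ℓ₁ ++ (symCode is ++ memTail x))
          (List.replicate k (.tok .one)) .toSkip ℓ₀
        have h8 := run_skip (gs := gs) (mem e x) [] [] [] (symCode is ++ memTail x)
          (List.replicate k (.tok .one)) .toMain ℓ₁
        rw [hv] at h6
        exact ((ih.decides hlt (h.move hsuf hlt.le hr' h.notWritten)).of_run
          ((h6.trans h7).trans h8)).mono (by omega)
      · rw [hv] at h6
        exact ((decides_jump ih (h.move (seek_suffix x.tx ℓ₀) hlt.le hr' h.notWritten) hlt rfl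
          _ (by simp only [List.length_append]; omega)).of_run h6).mono (by omega)
      · have h7 := run_skip (gs := gs) (mem e x) [] [] [] (symBits ℓ₁ ++ (symCode is ++ memTail x))
          (List.replicate k (.tok .one)) .toJump ℓ₀
        rw [hv] at h6
        exact ((decides_jump ih (h.move (seek_suffix x.tx ℓ₁) hlt.le hr' h.notWritten) hlt rfl
          _ (by simp only [List.length_append]; omega)).of_run (h6.trans h7)).mono (by omega)
    | push o β =>
      obtain rfl : z = .tok (.bit β) :: (symBits o ++ (symCode is ++ memTail x)) := by
        simpa [symCode, encInstr, symBits, eq_comm, Instr.op] using hz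
      rw [List.length_cons] at hzb hz0
      have h0 : Run gs .pushBit [] (regs (mem e x) [] [] []
          (.tok (.bit β) :: (symBits o ++ (symCode is ++ memTail x)))
          (List.replicate k (.tok .one))) (.arg (.decl (.push β))) [] (regs (mem e x) [] [] []
          (symBits o ++ (symCode is ++ memTail x)) (List.replicate k (.tok .one))) 1 :=
        .step fun v => ⟨some (.tok (.bit β)), by simp [decider, popR]⟩
      by_cases hd : o ∈ x.tx.writeSet
      swap
      · exact ((decides_undeclared h (.push β) hd _ hkb (by omega)
          (by rw [step, hs]; simp [hd])).of_run h0).mono (by omega)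
      have h4 : step gs x.tx c = some { c with
          rest := is
          state := Function.update c.state o (β :: c.state o)
          gas := k
          usedWrite := insert o c.usedWrite } := by
        rw [step, hs]; simp [hgas, hk, hd]
      by_cases ho : x.obj = o
      · subst ho
        exact ((decides_used h (.push β) hd _ hkb (by omega) ⟨_, .single h4, by simp⟩).of_run
          h0).mono (by omega)
      obtain ⟨y, hyb, hy, h5⟩ := run_access (gs := gs) h (.push β) ho hd
        (symCode is ++ memTail x) (List.replicate k (.tok .one)) (by omega)
      have h6 := (h0.trans h5).trans (run_use_push hy β (mem e x) (symBits o)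
        (symCode is ++ memTail x) (List.replicate k (.tok .one)))
      have hw' : x.obj ∉ insert o c.usedWrite := by simp [ho, h.notWritten]
      rw [← mem_cons] at h6
      simp only [List.length_append] at hzb hz0
      exact (((ih.decides hlt (h.write hsuf hlt h.notRead hw' (by omega) (by simp))).of_run
        h6).mono (by omega)).congr (acc_iff_of_step h.notRead h.notWritten h4)
    | pop o =>
      obtain rfl : z = symBits o ++ (symCode is ++ memTail x) := by
        simpa [symCode, encInstr, symBits, eq_comm, Instr.op] using hz
      by_cases hd : o ∈ x.tx.writeSet
      swap
      · exact (decides_undeclared h .pop hd _ hkb (by omega)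
          (by rw [step, hs]; simp [hd])).mono (by omega)
      have h4 : step gs x.tx c = some { c with
          rest := is
          state := Function.update c.state o (c.state o).tail
          gas := k
          usedWrite := insert o c.usedWrite } := by
        rw [step, hs]; simp [hgas, hk, hd]
      by_cases ho : x.obj = o
      · subst ho
        exact (decides_used h .pop hd _ hkb (by omega) ⟨_, .single h4, by simp⟩).mono (by omega)
      obtain ⟨y, hyb, hy, h5⟩ := run_access (gs := gs) h .pop ho hd
        (symCode is ++ memTail x) (List.replicate k (.tok .one)) (by omega)
      have h6 := h5.trans (run_use_pop hy (mem e x) (symBits o)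
        (symCode is ++ memTail x) (List.replicate k (.tok .one)))
      have hw' : x.obj ∉ insert o c.usedWrite := by simp [ho, h.notWritten]
      rw [← mem_cons] at h6
      simp only [List.length_append] at hzb hz0
      exact (((ih.decides hlt (h.write hsuf hlt h.notRead hw' (by omega)
        (by simp; omega))).of_run h6).mono (by omega)).congr
        (acc_iff_of_step h.notRead h.notWritten h4)

end

section
variable {gs : GasSchedule}

theorem mem_OUDP_encode (x : Instance) :
    x.encode ∈ OUDP gs ↔ Acc gs x.tx x.obj (start x.tx (stateOf x.state) x.gas) := by
  have h (y : Instance) : oum gs y.tx (stateOf y.state) y.obj y.gas = .accept ↔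
      Acc gs y.tx y.obj (start y.tx (stateOf y.state) y.gas) := by
    unfold oum
    split_ifs with h'
    · exact ⟨fun _ => h', fun _ => rfl⟩
    · exact ⟨fun h => (by cases h), fun h => absurd h h'⟩
  constructor
  · rintro ⟨y, hy, hacc⟩
    obtain rfl := Instance.encode_injective hy
    exact (h y).1 hacc
  · exact fun hx => ⟨x, rfl, (h x).2 hx⟩

theorem run_start (w : List Tok) : Run gs .start w (regs [] [] [] [] [] []) (.load .obj) w
    (regs [] [] [.mark .obj] [] [] []) 1 :=
  .step fun v => ⟨v, by simp [decider, pushR, go]⟩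

theorem one_notMem_mem (x : Instance) : .tok .one ∉ mem [] x := by
  have hs (u) : Sym.tok .one ∉ symBits u := by simp [symBits, encBits]
  have hb (u) : Tok.one ∉ encBits u := by simp [encBits]
  have hi (i) : Tok.one ∉ encInstr i := by cases i <;> simp [encInstr, hb]
  simp [mem, memTail, hs, symCode, hi, symDecl, symEntry]

theorem length_value_le (x : Instance) (o : ObjId) :
    (stateOf x.state o).length ≤ (mem [] x).length := by
  rcases search_val [] x .read o with ⟨h, -⟩ | ⟨y, h⟩
  · simp only [List.nil_append] at h
    simp [h]
  · have := length_search h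
    simp [symBits, encBits] at this
    omega

/-- A bound for the running time of the decider, in terms of a bound `s` for the length of the
memory and the gas. -/
def totalTime (s : ℕ) : ℕ := (s + 1) * stepTime (2 * s * s + 11 * s) + 100 * (s + 1)

/-- The decider decides the Object Usage Decision Problem. -/
theorem final_start (w : List Tok) (b : Bool) (hb : b = true ↔ w ∈ OUDP gs) :
    Final gs .start w (regs [] [] [] [] [] []) b (totalTime (2 * w.length + 1)) := by
  rcases h : PState.obj.run w with _ | out
  · have hw : w ∉ OUDP gs := by
      rintro ⟨x, rfl, -⟩
      obtain ⟨out, h1, -⟩ := PState.run_encode x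
      rw [h] at h1
      cases h1
    obtain rfl : b = false := by simpa using mt hb.1 hw
    refine ((run_start w).final (final_load h _)).mono ?_
    simp [totalTime]
    omega
  · obtain ⟨x, rfl⟩ := PState.exists_encode (by rw [h]; rfl)
    obtain ⟨out', h1, h2⟩ := PState.run_encode x
    obtain rfl : out = out' := by simpa [h] using h1
    have hlen := PState.length_run h
    have hlen2 := congrArg List.length h2
    simp only [List.length_cons, List.length_append, List.length_replicate] at hlen2
    have hs : (mem [] x).length + x.gas ≤ 2 * x.encode.length + 1 := by omega
    generalize hn : 2 * x.encode.length + 1 = s at hs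
    have r1 := (run_start (gs := gs) x.encode).trans (run_load h [.mark .obj])
    have h3 : out.reverse ++ [.mark .obj] =
        List.replicate x.gas (.tok .one) ++ (mem [] x).reverse := by
      simpa using congrArg List.reverse h2
    rw [h3] at r1
    have r2 := r1.trans (run_rewind_gas x.gas _ [] [])
    have r3 := r2.trans (run_rewind (by simpa using one_notMem_mem x) [] _)
    simp only [List.append_nil, List.reverse_reverse] at r3
    have r4 := r3.trans (run_search (gs := gs) (mem [] x) [] (List.replicate x.gas (.tok .one)) .init
      (n := []) (by simp))
    rw [search_prog] at r4
    simp only [Option.isSome_some, if_true, Option.getD_some] at r4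
    have r5 : Run gs (.found .init) [] (regs (mem [] x) (symCode x.tx.ins ++ memTail x) [] [] []
        (List.replicate x.gas (.tok .one))) (.goto false) [] (regs (mem [] x)
          (symCode x.tx.ins ++ memTail x) [] [] [] (List.replicate x.gas (.tok .one))) 1 :=
      .step fun v => ⟨v, by simp [decider, go]⟩
    have r6 := (r4.trans r5).trans (run_goto _ _ _ _ _ false)
    have hl := length_symCode_le (x := x) List.suffix_rfl
    have hrep : Rep x s (2 * s * s + 11 * s) [] (start x.tx (stateOf x.state) x.gas) := by
      refine ⟨List.suffix_rfl, rfl, by simp [start], by simp [start], fun o => ?_, ?_⟩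
      · have := length_value_le x o
        simp only [start]
        omega
      · have h4 : x.gas * (s + (mem [] x).length + 10) ≤ s * (s + s + 10) :=
          Nat.mul_le_mul (by omega) (by omega)
        simp only [start]
        nlinarith
    obtain ⟨β, f, hβ⟩ := decides_main (gs := gs) _ _ _ (Nat.lt_succ_self x.gas) hrep
    obtain rfl : b = β := by
      rw [Bool.eq_iff_iff, hb, hβ, mem_OUDP_encode]
    have h5 : (x.gas + 1) * stepTime (2 * s * s + 11 * s) ≤
        (s + 1) * stepTime (2 * s * s + 11 * s) := Nat.mul_le_mul_right _ (by omega)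
    refine (r6.final f).mono ?_
    simp only [start, totalTime, List.length_nil, List.length_reverse]
    omega

end

/-- The Object Usage Decision Problem is in P. -/
theorem inP_OUDP (gs : GasSchedule) : InP (OUDP gs) := by
  refine ⟨{
    tm := deciderTM gs
    inputAlphabet := Equiv.refl _
    outputAlphabet := Equiv.refl _
    time := (2 * .X + 1 + 1) * (100 * (2 * (2 * .X + 1) * (2 * .X + 1) + 11 * (2 * .X + 1) + 1)) +
      100 * (2 * .X + 1 + 1)
    outputsFun := fun w => ?_ }⟩
  have h := final_start (gs := gs) w (@decide (w ∈ OUDP gs) (Classical.propDecidable _))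
    (by simp) none
  have h1 : initList (deciderTM gs) w =
      ⟨some .start, none, stks w (regs [] [] [] [] [] []) []⟩ := by
    have h : (initList (deciderTM gs) w).stk = stks w (regs [] [] [] [] [] []) [] := by
      funext k
      rcases k with _ | _ | (_ | _ | _ | _ | _ | _) <;> rfl
    exact congrArg (TM2.Cfg.mk _ _) h
  have h2 (o : List Bool) :
      haltList (deciderTM gs) o = ⟨none, none, stks [] (regs [] [] [] [] [] []) o⟩ := by
    have h : (haltList (deciderTM gs) o).stk = stks [] (regs [] [] [] [] [] []) o := by
      funext k
      rcases k with _ | _ | (_ | _ | _ | _ | _ | _) <;> rfl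
    exact congrArg (TM2.Cfg.mk _ _) h
  refine Classical.choice ?_
  obtain ⟨n, hn, h⟩ := h
  replace h : (flip bind (deciderTM gs).step)^[n] (some (initList (deciderTM gs) w)) =
      some (haltList (deciderTM gs) [@decide (w ∈ OUDP gs) (Classical.propDecidable _)]) :=
    (congrArg (fun c => (flip bind (deciderTM gs).step)^[n] (some c)) h1).trans
      (h.trans (congrArg some (h2 _).symm))
  refine ⟨⟨⟨n, ?_⟩, hn.trans_eq ?_⟩⟩
  · refine (congrArg (fun l => (flip bind (deciderTM gs).step)^[n]
      (some (initList (deciderTM gs) l))) (List.map_id w)).trans (h.trans ?_)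
    exact congrArg (fun o => some (haltList (deciderTM gs) o)) (List.map_id _).symm
  · simp [totalTime, stepTime]

/-! ### A transducer that pads its output -/

/-- `T` comes from `a` to `b` on the input `w` and does not visit work cells beyond `m` meanwhile. -/
def Transducer.ReachesWithin {α β : Type} (T : Transducer α β) (w : List α) (m : ℕ) :
    T.Cfg → T.Cfg → Prop :=
  Relation.ReflTransGen fun a b => b ∈ T.step w a ∧ ∀ i, b.workPos i ≤ m

section
variable {α β : Type} {T : Transducer α β} {w : List α} {m : ℕ} {a b c : T.Cfg}

theorem Transducer.ReachesWithin.reaches (h : T.ReachesWithin w m a b) :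
    Reaches (T.step w) a b := by
  induction h with
  | refl => exact .refl
  | tail _ h ih => exact ih.tail h.1

/-- If a computation ends, then all configurations that are reached are on its way. -/
theorem Transducer.ReachesWithin.workPos_le (h : T.ReachesWithin w m a b) (hb : T.step w b = none)
    (ha : ∀ i, a.workPos i ≤ m) (hc : Reaches (T.step w) a c) (i : Fin T.k) :
    c.workPos i ≤ m := by
  induction h using Relation.ReflTransGen.head_induction_on with
  | refl =>
    rcases Relation.ReflTransGen.cases_head hc with rfl | ⟨d, hd, -⟩
    · exact ha i
    · rw [hb] at hd; cases hd
  | head h _ ih =>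
    rcases Relation.ReflTransGen.cases_head hc with rfl | ⟨d, hd, hc⟩
    · exact ha i
    · cases Option.mem_unique hd h.1
      exact ih h.2 hc

end

/-- The control states of the padding transducer. The flag of the last two tells whether the input
has been read. -/
inductive PadState where
  | start
  | scan
  | inc (full : Bool)
  | back (full : Bool)

/-- The symbols on the work tape: `none` is the blank, `some none` marks the first cell, the others
are digits. -/
abbrev PadSym (B : ℕ) := Option (Option (Fin (B + 3)))

/-- The base in which the padding transducer counts. -/
def padBase (B : ℕ) (full : Bool) : ℕ := cond full (B + 3) 2

/-- The padding transducer emits `pre`, the images of the letters of its input, and `post`.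
Meanwhile it counts the letters in base `2`. Then it goes on counting in base `B + 3` until all
digits overflow, and emits `c` copies of `u` before each increment. -/
def padder {α β : Type} (h : α → List β) (pre post : List β) (u : β) (c B : ℕ) :
    Transducer α β where
  Q := PadState
  finQ := by
    refine Finite.of_injective (β := Option (Option (Bool × Bool))) (fun
      | .start => none
      | .scan => some none
      | .inc p => some (some (true, p))
      | .back p => some (some (false, p))) ?_
    rintro (_ | _ | _ | _) (_ | _ | _ | _) <;> simp
  Γ := PadSym B
  finΓ := inferInstance
  k := 1
  blank := none
  start := .start
  δ q a s :=
    match q with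
    | .start => some ⟨.scan, .right, fun _ => some none, fun _ => .stay, pre⟩
    | .scan =>
      match a with
      | .leftEnd => none
      | .letter a => some ⟨.inc false, .stay, s, fun _ => .right, h a⟩
      | .rightEnd => some ⟨.inc true, .stay, s, fun _ => .right, post ++ List.replicate c u⟩
    | .inc p =>
      match s 0 with
      | none => if p then none
          else some ⟨.back false, .stay, fun _ => some (some 1), fun _ => .left, []⟩
      | some none => none
      | some (some d) =>
        if d.val + 1 < padBase B p then
          some ⟨.back p, .stay, fun _ => some (some (d + 1)), fun _ => .left, []⟩
        else some ⟨.inc p, .stay, fun _ => some (some 0), fun _ => .right, []⟩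
    | .back p =>
      match s 0 with
      | some none =>
        if p then some ⟨.inc true, .stay, s, fun _ => .right, List.replicate c u⟩
        else some ⟨.scan, .right, s, fun _ => .stay, []⟩
      | _ => some ⟨.back p, .stay, s, fun _ => .left, []⟩

section
variable {B : ℕ}

/-- The work tape with the digits `l`, the least significant one first. -/
def padTape (l : List (Fin (B + 3))) : ℕ → PadSym B
  | 0 => some none
  | i + 1 => l[i]?.map some

theorem padTape_append (l l' : List (Fin (B + 3))) (d : Fin (B + 3)) :
    padTape (l ++ d :: l') (l.length + 1) = some (some d) := by
  simp [padTape]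

theorem padTape_length (l : List (Fin (B + 3))) : padTape l (l.length + 1) = none := by
  simp [padTape]

theorem update_padTape_zero (l : List (Fin (B + 3))) :
    Function.update (padTape l) 0 (some none) = padTape l :=
  Function.update_eq_self 0 (padTape l)

theorem update_padTape (l l' : List (Fin (B + 3))) (d e : Fin (B + 3)) :
    Function.update (padTape (l ++ d :: l')) (l.length + 1) (some (some e)) =
      padTape (l ++ e :: l') := by
  funext i
  rcases i with _ | i
  · simp [padTape]
  · rcases lt_trichotomy i l.length with hi | rfl | hi
    · simp [padTape, List.getElem?_append_left hi, hi.ne]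
    · simp [padTape]
    · obtain ⟨j, rfl⟩ := Nat.exists_eq_add_of_lt hi
      simp [padTape, List.getElem?_append_right hi.le,
        show l.length + j + 1 - l.length = j + 1 by omega, show ¬ l.length + j + 1 = l.length by omega]

theorem update_padTape_length (l : List (Fin (B + 3))) (e : Fin (B + 3)) :
    Function.update (padTape l) (l.length + 1) (some (some e)) = padTape (l ++ [e]) := by
  funext i
  rcases i with _ | i
  · simp [padTape]
  · rcases lt_trichotomy i l.length with hi | rfl | hi
    · simp [padTape, List.getElem?_append_left hi, hi.ne]
    · simp [padTape]
    · obtain ⟨j, rfl⟩ := Nat.exists_eq_add_of_lt hi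
      simp [padTape, show ¬ l.length + j + 1 = l.length by omega,
        show l.length ≤ l.length + j + 1 by omega]

/-- Adding one in base `L`: the new digits, and whether there is an overflow. -/
def incr (L : ℕ) : List (Fin (B + 3)) → List (Fin (B + 3)) × Bool
  | [] => ([], true)
  | d :: l => if d.val + 1 < L then ((d + 1) :: l, false) else (0 :: (incr L l).1, (incr L l).2)

/-- The value of a list of digits in base `L`. -/
def digitVal (L : ℕ) : List (Fin (B + 3)) → ℕ
  | [] => 0
  | d :: l => d.val + L * digitVal L l

theorem length_incr (L : ℕ) (l : List (Fin (B + 3))) : (incr L l).1.length = l.length := by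
  induction l with
  | nil => rfl
  | cons d l ih =>
    rw [incr]
    split_ifs
    · rfl
    · simp [ih]

theorem val_add_one {L : ℕ} (hL : L ≤ B + 3) {d : Fin (B + 3)} (h : d.val + 1 < L) :
    (d + 1).val = d.val + 1 :=
  Fin.val_add_one_of_lt' (by omega)

theorem incr_lt {L : ℕ} (hL : L ≤ B + 3) (hL0 : 0 < L) {l : List (Fin (B + 3))}
    (hl : ∀ d ∈ l, d.val < L) : ∀ d ∈ (incr L l).1, d.val < L := by
  induction l with
  | nil => simp [incr]
  | cons d l ih =>
    simp only [List.mem_cons, forall_eq_or_imp] at hl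
    rw [incr]
    split_ifs with h
    · simpa [val_add_one hL h, h] using hl.2
    · simpa [hL0] using ih hl.2

theorem digitVal_incr {L : ℕ} (hL : L ≤ B + 3) {l : List (Fin (B + 3))}
    (hl : ∀ d ∈ l, d.val < L) :
    digitVal L (incr L l).1 + cond (incr L l).2 (L ^ l.length) 0 = digitVal L l + 1 := by
  induction l with
  | nil => simp [incr, digitVal]
  | cons d l ih =>
    simp only [List.mem_cons, forall_eq_or_imp] at hl
    rw [incr]
    split_ifs with h
    · simp [digitVal, val_add_one hL h]
      omega
    · have h1 := ih hl.2
      have h2 : d.val + 1 = L := by omega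
      have h3 := congrArg (L * ·) h1
      simp only [digitVal, List.length_cons, pow_succ', Fin.val_zero]
      cases hc : (incr L l).2 <;> rw [hc] at h3
      · simp only [cond_false, mul_add, mul_one] at h3 ⊢
        omega
      · simp only [cond_true, mul_add, mul_one] at h3 ⊢
        omega

theorem digitVal_append (L : ℕ) (l : List (Fin (B + 3))) (d : Fin (B + 3)) :
    digitVal L (l ++ [d]) = digitVal L l + L ^ l.length * d.val := by
  induction l with
  | nil => simp [digitVal]
  | cons a l ih =>
    simp only [List.cons_append, digitVal, ih, List.length_cons, pow_succ']
    ring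

theorem digitVal_lt {L : ℕ} {l : List (Fin (B + 3))} (hl : ∀ d ∈ l, d.val < L) :
    digitVal L l < L ^ l.length := by
  induction l with
  | nil => simp [digitVal]
  | cons d l ih =>
    simp only [List.mem_cons, forall_eq_or_imp] at hl
    have h1 := Nat.mul_le_mul_left L (Nat.succ_le_of_lt (ih hl.2))
    rw [Nat.succ_eq_add_one, mul_add, mul_one] at h1
    simp only [digitVal, List.length_cons, pow_succ']
    omega

/-- A numeral with digits `0` and `1` is small in every base that is at least `3`. -/
theorem two_mul_digitVal_le {l : List (Fin (B + 3))} (hl : ∀ d ∈ l, d.val < 2) :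
    2 * digitVal (B + 3) l + 1 ≤ (B + 3) ^ l.length := by
  induction l with
  | nil => simp [digitVal]
  | cons d l ih =>
    simp only [List.mem_cons, forall_eq_or_imp] at hl
    have h1 := Nat.mul_le_mul_left (B + 3) (ih hl.2)
    simp only [digitVal, List.length_cons, pow_succ']
    have h2 : (B + 3) * (2 * digitVal (B + 3) l + 1) =
      2 * ((B + 3) * digitVal (B + 3) l) + (B + 3) := by ring
    omega

/-- Adding one in base `2`, with a new digit if necessary. -/
def incr₂ (l : List (Fin (B + 3))) : List (Fin (B + 3)) :=
  cond (incr 2 l).2 ((incr 2 l).1 ++ [1]) (incr 2 l).1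

/-- The binary digits of `n`. -/
def digits₂ (B n : ℕ) : List (Fin (B + 3)) := incr₂^[n] []

theorem digits₂_succ (n : ℕ) : digits₂ B (n + 1) = incr₂ (digits₂ B n) :=
  Function.iterate_succ_apply' _ _ _

theorem length_le_incr₂ (l : List (Fin (B + 3))) : l.length ≤ (incr₂ l).length := by
  rw [incr₂]
  cases (incr 2 l).2 <;> simp [length_incr]

theorem digits₂_spec (n : ℕ) : (∀ d ∈ digits₂ B n, d.val < 2) ∧ digitVal 2 (digits₂ B n) = n ∧
    2 ^ (digits₂ B n).length ≤ 2 * n + 1 := by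
  induction n with
  | zero => simp [digits₂, digitVal]
  | succ n ih =>
    obtain ⟨h1, h2, h3⟩ := ih
    rw [digits₂_succ, incr₂]
    have h4 := incr_lt (by omega) (by omega) h1
    have h5 := digitVal_incr (by omega) h1
    rw [h2] at h5
    cases hc : (incr 2 (digits₂ B n)).2
    · rw [hc] at h5
      refine ⟨by simpa using h4, by simpa using h5, ?_⟩
      rw [cond_false, length_incr]
      omega
    · rw [hc, cond_true] at h5
      refine ⟨?_, ?_, ?_⟩
      · rw [cond_true]
        intro d hd
        rcases List.mem_append.1 hd with hd | hd
        · exact h4 d hd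
        · rw [List.mem_singleton.1 hd]; simp
      · rw [cond_true, digitVal_append, length_incr]
        simpa using h5
      · rw [cond_true, List.length_append, length_incr, List.length_singleton, pow_succ]
        have := digitVal_lt h1
        omega

theorem lt_two_pow_length_digits₂ (n : ℕ) : n < 2 ^ (digits₂ B n).length := by
  have h := digits₂_spec (B := B) n
  have := digitVal_lt h.1
  omega

theorem length_digits₂_le (n : ℕ) : (digits₂ B n).length ≤ Nat.log 2 n + 1 := by
  have h := (digits₂_spec (B := B) n).2.2
  rcases hl : (digits₂ B n).length with _ | k
  · omega
  · rw [hl, pow_succ] at h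
    have h1 : 2 ^ k ≤ n := by omega
    have := Nat.le_log_of_pow_le (by omega) h1
    omega

variable {α β : Type} {h : α → List β} {pre post : List β} {u : β} {c : ℕ} {w : List α} {m : ℕ}

/-- A configuration of the padding transducer. -/
def padCfg (h : α → List β) (pre post : List β) (u : β) (c : ℕ) (q : PadState) (i : ℕ)
    (l : List (Fin (B + 3))) (k : ℕ) (o : List β) : (padder h pre post u c B).Cfg :=
  ⟨q, i, fun _ => padTape l, fun _ => k, o⟩

local notation "cfg" => padCfg h pre post u c

theorem pad_step {q q' : PadState} {i i' : ℕ} {l l' : List (Fin (B + 3))} {k k' : ℕ} {o o' : List β}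
    (hs : (padder h pre post u c B).step w (cfg q i l k o) = some (cfg q' i' l' k' o'))
    (hk : k' ≤ m) :
    (padder h pre post u c B).ReachesWithin w m (cfg q i l k o) (cfg q' i' l' k' o') :=
  .single ⟨hs, fun _ => hk⟩

/-- The way back to the first cell. -/
theorem pad_back (p : Bool) (i : ℕ) (l : List (Fin (B + 3))) (k : ℕ) (o : List β)
    (hk : k ≤ m) :
    (padder h pre post u c B).ReachesWithin w m (cfg (.back p) i l k o) (cfg (.back p) i l 0 o) := by
  induction k with
  | zero => exact .refl
  | succ k ih =>
    refine .trans (pad_step (k' := k) (l' := l) (o' := o) ?_ (by omega)) (ih (by omega))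
    have hu := Function.update_eq_self (k + 1) (padTape l)
    rcases hl : l[k]? with _ | d <;> simp only [padTape, hl, Option.map_none, Option.map_some] at hu <;>
      simp [Transducer.step, padder, padCfg, padTape, hl, Transducer.moveIn, Transducer.moveWork, hu]

/-- The result of the carry, without an overflow. -/
theorem pad_inc (p : Bool) (i : ℕ) (l l' : List (Fin (B + 3))) (o : List β)
    (hm : l'.length + l.length + 1 ≤ m) :
    (padder h pre post u c B).ReachesWithin w m (cfg (.inc p) i (l' ++ l) (l'.length + 1) o)
      (cond (incr (padBase B p) l).2
        (cfg (.inc p) i (l' ++ (incr (padBase B p) l).1) (l'.length + l.length + 1) o)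
        (cfg (.back p) i (l' ++ (incr (padBase B p) l).1) 0 o)) := by
  induction l generalizing l' with
  | nil => exact .refl
  | cons d l ih =>
    rw [incr]
    rw [List.length_cons] at hm
    split_ifs with hd
    · refine .trans (pad_step (q' := .back p) (i' := i) (l' := l' ++ (d + 1) :: l)
        (k' := l'.length) (o' := o) ?_ (by omega)) (pad_back p i _ _ o (by omega))
      simp [Transducer.step, padder, padCfg, padTape_append, hd, Transducer.moveIn,
        Transducer.moveWork, update_padTape]
    · have h1 := ih (l' ++ [0]) (by simp; omega)
      simp only [List.append_assoc, List.singleton_append, List.length_append,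
        List.length_singleton] at h1
      rw [show l'.length + 1 + l.length + 1 = l'.length + (l.length + 1) + 1 by omega] at h1
      refine .trans (pad_step (q' := .inc p) (i' := i) (l' := l' ++ 0 :: l)
        (k' := l'.length + 1 + 1) (o' := o) ?_ (by omega)) h1
      simp [Transducer.step, padder, padCfg, padTape_append, hd, Transducer.moveIn,
        Transducer.moveWork, update_padTape]

/-- Counting a letter. -/
theorem pad_letter (i : ℕ) (hi : i ≤ w.length) (l : List (Fin (B + 3))) (o : List β)
    (hm : (incr₂ l).length + 1 ≤ m) :
    (padder h pre post u c B).ReachesWithin w m (cfg (.inc false) i l 1 o)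
      (cfg .scan (i + 1) (incr₂ l) 0 o) := by
  have h0 := length_le_incr₂ l
  have h1 := pad_inc (h := h) (pre := pre) (post := post) (u := u) (c := c) (w := w) (m := m)
    false i l [] o (by simp; omega)
  have h3 : (padder h pre post u c B).ReachesWithin w m (cfg (.back false) i (incr₂ l) 0 o)
      (cfg .scan (i + 1) (incr₂ l) 0 o) := by
    refine pad_step ?_ (by omega)
    simp [Transducer.step, padder, padCfg, padTape, Transducer.moveIn, Transducer.moveWork, hi,
      update_padTape_zero]
  refine .trans ?_ h3
  have h2 := length_incr 2 l
  rw [incr₂] at hm ⊢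
  simp only [List.nil_append, List.length_nil, padBase, cond_false, zero_add] at h1
  cases hc : (incr 2 l).2
  · rw [hc] at h1
    exact h1
  · rw [hc] at h1 hm
    simp only [cond_true, List.length_append, List.length_singleton] at h1 hm
    refine h1.trans (.trans (pad_step (q' := .back false) (i' := i) (l' := (incr 2 l).1 ++ [1])
      (k' := l.length) (o' := o) ?_ (by omega)) (pad_back false i _ _ o (by omega)))
    rw [← length_incr 2 l]
    simp [Transducer.step, padder, padCfg, padTape_length, Transducer.moveIn,
      Transducer.moveWork, update_padTape_length]

/-- Reading the input. -/
theorem pad_scan (w₁ w₂ : List α) (hw : w = w₁ ++ w₂) (o : List β)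
    (hm : (digits₂ B w.length).length + 1 ≤ m) :
    (padder h pre post u c B).ReachesWithin w m
      (cfg .scan (w₁.length + 1) (digits₂ B w₁.length) 0 o)
      (cfg .scan (w.length + 1) (digits₂ B w.length) 0 (o ++ w₂.flatMap h)) := by
  have mono (i j : ℕ) (hij : i ≤ j) : (digits₂ B i).length ≤ (digits₂ B j).length := by
    induction j, hij using Nat.le_induction with
    | base => rfl
    | succ j _ ih => rw [digits₂_succ]; exact ih.trans (length_le_incr₂ _)
  induction w₂ generalizing w₁ o with
  | nil =>
    rw [List.append_nil] at hw
    subst hw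
    rw [List.flatMap_nil, List.append_nil]
    exact .refl
  | cons a w₂ ih =>
    have h1 := ih (w₁ ++ [a]) (by simp [hw]) (o ++ h a)
    rw [List.length_append, List.length_singleton, List.append_assoc] at h1
    have h2 : w₁.length + 1 ≤ w.length := by simp [hw]
    have h3 := mono _ _ h2
    have h4 := length_le_incr₂ (digits₂ B w₁.length)
    rw [digits₂_succ] at h1 h3
    refine .trans (pad_step (q' := .inc false) (i' := w₁.length + 1)
      (l' := digits₂ B w₁.length) (k' := 1) (o' := o ++ h a) ?_ (by omega))
      ((pad_letter _ h2 _ _ (by omega)).trans h1)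
    simp [Transducer.step, padder, padCfg, hw, Transducer.readInput, Transducer.moveIn,
      Transducer.moveWork]

/-- Padding the output. -/
theorem pad_emit (n i : ℕ) (l : List (Fin (B + 3))) (o : List β) (hm : l.length + 1 ≤ m)
    (hn : digitVal (B + 3) l + n + 1 = (B + 3) ^ l.length) :
    ∃ l', l'.length = l.length ∧ (padder h pre post u c B).ReachesWithin w m
      (cfg (.inc true) i l 1 o)
      (cfg (.inc true) i l' (l.length + 1) (o ++ List.replicate (c * n) u)) := by
  have hl : ∀ d ∈ l, d.val < B + 3 := fun d _ => d.2
  have h1 := pad_inc (h := h) (pre := pre) (post := post) (u := u) (c := c) (w := w) (m := m)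
    true i l [] o (by simpa using hm)
  have h2 := digitVal_incr le_rfl hl
  have h4 : ∀ d ∈ (incr (B + 3) l).1, d.val < B + 3 := fun d _ => d.2
  have h3 := digitVal_lt h4
  simp only [List.nil_append, List.length_nil, padBase, cond_true, zero_add] at h1
  rw [length_incr] at h3
  cases n with
  | zero =>
    cases hc : (incr (B + 3) l).2
    · rw [hc, cond_false] at h2
      omega
    · rw [hc] at h1
      exact ⟨_, length_incr _ _, by simpa using h1⟩
  | succ n =>
    cases hc : (incr (B + 3) l).2
    · rw [hc] at h1 h2
      rw [cond_false] at h2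
      obtain ⟨l', hl', h5⟩ := pad_emit n i (incr (B + 3) l).1 (o ++ List.replicate c u)
        (by rwa [length_incr]) (by rw [length_incr]; omega)
      rw [length_incr] at hl' h5
      refine ⟨l', hl', h1.trans (.trans (pad_step (q' := .inc true) (i' := i)
        (l' := (incr (B + 3) l).1) (k' := 1) (o' := o ++ List.replicate c u) ?_ (by omega)) ?_)⟩
      · simp [Transducer.step, padder, padCfg, padTape, Transducer.moveIn, Transducer.moveWork,
          update_padTape_zero]
      · rw [Nat.mul_succ, Nat.add_comm (c * n), List.replicate_add, ← List.append_assoc]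
        exact h5
    · rw [hc, cond_true] at h2
      omega
  termination_by n

end

/-- Replacing letters by words and padding the result up to a length that exceeds a given power of
the length of the input can be done in logarithmic space. -/
theorem exists_logSpaceComputable_pad {α β : Type} (h : α → List β) (pre post : List β) (u : β)
    (c e : ℕ) : ∃ N : ℕ → ℕ, (∀ n, (n + 1) ^ e ≤ 2 * N n) ∧ LogSpaceComputable fun w =>
      pre ++ w.flatMap h ++ post ++ List.replicate (c * N w.length) u := by
  -- The base `2 ^ (e + 2)` of the second counter makes its number of values exceed `(n + 1) ^ e`. At
  -- least half of them are left when the counter starts, as all digits are then `0` or `1`.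
  obtain ⟨B, hB⟩ : ∃ B, B + 3 = 2 ^ (e + 2) := by
    refine ⟨2 ^ (e + 2) - 3, Nat.sub_add_cancel ?_⟩
    have := Nat.one_le_two_pow (n := e)
    rw [pow_add]
    omega
  have hval (n : ℕ) := two_mul_digitVal_le (B := B) (digits₂_spec (B := B) n).1
  refine ⟨fun n => (B + 3) ^ (digits₂ B n).length - digitVal (B + 3) (digits₂ B n), fun n => ?_,
    padder h pre post u c B, ?_⟩
  · have h1 : (n + 1) ^ e ≤ (B + 3) ^ (digits₂ B n).length := by
      have h3 := congrArg (· ^ (digits₂ B n).length) hB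
      rw [h3, ← pow_mul, mul_comm, pow_mul]
      have h2 : n + 1 ≤ 2 ^ (digits₂ B n).length := lt_two_pow_length_digits₂ n
      calc (n + 1) ^ e ≤ (2 ^ (digits₂ B n).length) ^ e := Nat.pow_le_pow_left h2 e
        _ ≤ _ := Nat.pow_le_pow_right (by positivity) (by omega)
    have := hval n
    simp only
    omega
  · have key (w : List α) : ∃ d, (padder h pre post u c B).ReachesWithin w
        ((digits₂ B w.length).length + 1) (padder h pre post u c B).init d ∧
        (padder h pre post u c B).step w d = none ∧ d.out = pre ++ w.flatMap h ++ post ++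
          List.replicate (c * ((B + 3) ^ (digits₂ B w.length).length -
            digitVal (B + 3) (digits₂ B w.length))) u := by
      have h1 : (padder h pre post u c B).ReachesWithin w ((digits₂ B w.length).length + 1)
          (padder h pre post u c B).init (padCfg h pre post u c .scan 1 [] 0 pre) := by
        refine .single ⟨?_, by simp [padCfg]⟩
        have h2 : Function.update (fun _ : ℕ => (none : PadSym B)) 0 (some none) = padTape [] := by
          funext i; rcases i with _ | i <;> simp [padTape]
        simp [Transducer.step, padder, Transducer.init, padCfg, Transducer.moveIn,
          Transducer.moveWork, h2]
        rfl
      have h2 := pad_scan (h := h) (pre := pre) (post := post) (u := u) (c := c) (B := B)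
        (w := w) [] w rfl pre le_rfl
      have h3 : (padder h pre post u c B).ReachesWithin w ((digits₂ B w.length).length + 1)
          (padCfg h pre post u c .scan (w.length + 1) (digits₂ B w.length) 0 (pre ++ w.flatMap h))
          (padCfg h pre post u c (.inc true) (w.length + 1) (digits₂ B w.length) 1
            (pre ++ w.flatMap h ++ (post ++ List.replicate c u))) := by
        refine pad_step ?_ (by omega)
        simp [Transducer.step, padder, padCfg, Transducer.readInput, Transducer.moveIn,
          Transducer.moveWork]
      have hv := hval w.length
      obtain ⟨l, hl, h4⟩ := pad_emit (h := h) (pre := pre) (post := post) (u := u) (c := c) (w := w)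
        ((B + 3) ^ (digits₂ B w.length).length - digitVal (B + 3) (digits₂ B w.length) - 1)
        (w.length + 1) (digits₂ B w.length) (pre ++ w.flatMap h ++ (post ++ List.replicate c u))
        le_rfl (by omega)
      refine ⟨_, ((h1.trans h2).trans h3).trans h4, ?_, ?_⟩
      · rw [← hl]
        simp [Transducer.step, padder, padCfg, padTape_length]
      · obtain ⟨k, hk⟩ : ∃ k, (B + 3) ^ (digits₂ B w.length).length -
            digitVal (B + 3) (digits₂ B w.length) = k + 1 :=
          ⟨_, (Nat.sub_add_cancel (by omega)).symm⟩
        rw [hk]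
        simp only [padCfg, Nat.add_sub_cancel, List.append_assoc, List.append_cancel_left_eq,
          ← List.replicate_add]
        congr 1
        ring
    refine ⟨fun w => ?_, 2, fun w d hd i => ?_⟩
    · obtain ⟨d, h1, h2, h3⟩ := key w
      exact ⟨d, h1.reaches, h2, h3⟩
    · obtain ⟨d', h1, h2, -⟩ := key w
      refine (h1.workPos_le h2 (by simp [Transducer.init]) hd i).trans ?_
      have := length_digits₂_le (B := B) w.length
      omega

/-! ### A stack machine as a transaction -/

/-- The phases of the execution of a statement by the virtual machine. In the phases `dec j`,
`zero j` and `one j`, a symbol is being read of whose code `j` ones have been removed; its next bit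
is unknown, `0`, or `1`. -/
inductive Phase where
  | run
  | dec (j : ℕ)
  | zero (j : ℕ)
  | one (j : ℕ)
  deriving DecidableEq

/-- A stack machine together with the data for its translation into a transaction: the symbol
`acc` on the stack `out` means acceptance, `stmts` is a finite set of statements that contains the
program and is closed under subterms, `syms` is a finite set of symbols that contains all symbols
that are pushed, and `obj` names the objects that stand for the stacks; `obj none` is the object
whose use is in question. -/
structure Compiler {K : Type} [Fintype K] (Γ : K → Type) (Λ σ : Type) [Fintype σ] where
  prog : Λ → TM2.Stmt Γ Λ σ
  main : Λ
  var : σ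
  out : K
  acc : Γ out
  stmts : Finset (TM2.Stmt Γ Λ σ)
  syms : Finset (Σ k, Γ k)
  obj : Option K → ObjId
  obj_injective : Function.Injective obj
  halt_mem : .halt ∈ stmts
  prog_mem : ∀ l, prog l ∈ stmts
  sub_mem : ∀ q ∈ stmts, TM2.stmts₁ q ⊆ stmts
  push_mem : ∀ k f q, .push k f q ∈ stmts → ∀ v, ⟨k, f v⟩ ∈ syms

namespace Compiler

variable {K : Type} [Fintype K] {Γ : K → Type} {Λ σ : Type} [Fintype σ]
  (D : Compiler Γ Λ σ)

open Classical in
/-- The code of a symbol: its number in an enumeration of the symbols. -/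
noncomputable def code (a : Σ k, Γ k) : ℕ := D.syms.toList.idxOf a

/-- The bits that stand for a symbol in the value of an object. -/
noncomputable def bits (a : Σ k, Γ k) : List Bool := List.replicate (D.code a) true ++ [false]

/-- The value of the object that stands for a stack. -/
noncomputable def value (k : K) (l : List (Γ k)) : Value := l.flatMap fun a => D.bits ⟨k, a⟩

open Classical in
/-- The program points of the transaction: a statement, the local variable, and a phase. -/
noncomputable def pts : List (TM2.Stmt Γ Λ σ × σ × Phase) :=
  (D.stmts ×ˢ (Finset.univ : Finset σ) ×ˢ insert .run (((Finset.range (D.syms.card + 1)).image .dec ∪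
    (Finset.range (D.syms.card + 1)).image .zero) ∪
      (Finset.range (D.syms.card + 1)).image .one)).toList

open Classical in
/-- The label of a program point. -/
noncomputable def lbl (p : TM2.Stmt Γ Λ σ × σ × Phase) : Label :=
  List.replicate (D.pts.idxOf p) true

/-- The instructions that push a symbol. -/
noncomputable def pushCode (a : Σ k, Γ k) : List Instr :=
  .push (D.obj a.1) false :: List.replicate (D.code a) (.push (D.obj a.1) true)

open Classical in
/-- The stack that a statement reads, and the instructions to be carried out after a symbol has
been popped from it. The statement `halt` is taken to read the output. -/
noncomputable def reader : TM2.Stmt Γ Λ σ → Option (Σ k, σ → Option (Γ k) → List Instr)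
  | .peek k f q => some ⟨k, fun v a =>
      a.elim [] (fun a => D.pushCode ⟨k, a⟩) ++ [.jump (D.lbl (q, f v a, .run))]⟩
  | .pop k f q => some ⟨k, fun v a => [.jump (D.lbl (q, f v a, .run))]⟩
  | .halt => some ⟨D.out, fun _ a => if a = some D.acc then [.push (D.obj none) true] else [.halt]⟩
  | _ => none

open Classical in
/-- The instructions at a program point. -/
noncomputable def body (p : TM2.Stmt Γ Λ σ × σ × Phase) : List Instr :=
  match p.2.2 with
  | .run =>
    match p.1 with
    | .push k f q => D.pushCode ⟨k, f p.2.1⟩ ++ [.jump (D.lbl (q, p.2.1, .run))]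
    | .load f q => [.jump (D.lbl (q, f p.2.1, .run))]
    | .branch f q q' => [.jump (D.lbl (cond (f p.2.1) q q', p.2.1, .run))]
    | .goto f => [.jump (D.lbl (D.prog (f p.2.1), p.2.1, .run))]
    | q => [.jump (D.lbl (q, p.2.1, .dec 0))]
  | .dec j => (D.reader p.1).elim [] fun r =>
      .read (D.obj r.1) (D.lbl (p.1, p.2.1, .zero j)) (D.lbl (p.1, p.2.1, .one j)) :: r.2 p.2.1 none
  | .one j => (D.reader p.1).elim [] fun r =>
      [.pop (D.obj r.1), .jump (D.lbl (p.1, p.2.1, .dec (j + 1)))]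
  | .zero j => (D.reader p.1).elim [] fun r =>
      .pop (D.obj r.1) :: (if h : ∃ a, ⟨r.1, a⟩ ∈ D.syms ∧ D.code ⟨r.1, a⟩ = j then
        r.2 p.2.1 (some h.choose) else [])

/-- The transaction that simulates the stack machine. -/
noncomputable def tx : Transaction where
  t := 0
  g := 0
  ins := .jump (D.lbl (D.prog D.main, D.var, .run)) ::
    D.pts.flatMap fun p => .label (D.lbl p) :: D.body p
  readSet := Finset.univ.toList.map D.obj
  writeSet := Finset.univ.toList.map D.obj

theorem code_lt {a : Σ k, Γ k} (h : a ∈ D.syms) : D.code a < D.syms.card := by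
  classical
  rw [code, ← Finset.length_toList]
  convert List.idxOf_lt_length_of_mem (Finset.mem_toList.2 h)

theorem code_inj {a b : Σ k, Γ k} (h : a ∈ D.syms) (hab : D.code a = D.code b) : a = b := by
  classical
  exact (List.idxOf_inj (Finset.mem_toList.2 h)).1 (by simpa [code] using hab)

theorem lbl_inj {p p' : TM2.Stmt Γ Λ σ × σ × Phase} (h : p ∈ D.pts) (hl : D.lbl p = D.lbl p') :
    p = p' := by
  classical
  have := congrArg List.length hl
  simp only [lbl, List.length_replicate] at this
  exact (List.idxOf_inj h).1 this

theorem mem_pts {q : TM2.Stmt Γ Λ σ} (hq : q ∈ D.stmts) (v : σ) {ph : Phase}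
    (h : match ph with
      | .run => True
      | .dec j | .zero j | .one j => j ≤ D.syms.card) : (q, v, ph) ∈ D.pts := by
  simp only [pts, Finset.mem_toList, Finset.mem_product, Finset.mem_univ, Finset.mem_insert,
    Finset.mem_union, Finset.mem_image, Finset.mem_range, hq, true_and]
  cases ph <;> simp_all

theorem reader_ne_label {q : TM2.Stmt Γ Λ σ} {r : Σ k, σ → Option (Γ k) → List Instr}
    (h : D.reader q = some r) (v : σ) (a : Option (Γ r.1)) (ℓ : Label) :
    Instr.label ℓ ∉ r.2 v a := by
  cases q <;> simp only [reader, Option.some.injEq, reduceCtorEq] at h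
  · subst h
    cases a <;> simp [pushCode]
  · subst h
    simp
  · subst h
    simp only
    split_ifs <;> simp

theorem body_ne_label (p : TM2.Stmt Γ Λ σ × σ × Phase) (ℓ : Label) : Instr.label ℓ ∉ D.body p := by
  obtain ⟨q, v, ph⟩ := p
  cases ph with
  | run => cases q <;> simp [body, pushCode]
  | dec j =>
    rcases hr : D.reader q with _ | r
    · simp [body, hr]
    · simpa [body, hr] using D.reader_ne_label hr v none ℓ
  | one j =>
    rcases hr : D.reader q with _ | r <;> simp [body, hr]
  | zero j =>
    rcases hr : D.reader q with _ | r
    · simp [body, hr]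
    · simp only [body, hr, Option.elim_some, List.mem_cons, reduceCtorEq, false_or]
      split_ifs
      · exact D.reader_ne_label hr v _ ℓ
      · simp

theorem seek_lbl {p : TM2.Stmt Γ Λ σ × σ × Phase} (hp : p ∈ D.pts) :
    ∃ r, D.tx.seek (D.lbl p) = .label (D.lbl p) :: (D.body p ++ r) := by
  have h (l : List (TM2.Stmt Γ Λ σ × σ × Phase)) (hl : p ∈ l) :
      ∃ r, (l.flatMap fun p => .label (D.lbl p) :: D.body p).dropWhile
        (fun i => decide (i ≠ Instr.label (D.lbl p))) = .label (D.lbl p) :: (D.body p ++ r) := by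
    induction l with
    | nil => simp at hl
    | cons p' l ih =>
      by_cases hpp : p = p'
      · subst hpp
        exact ⟨_, by rw [List.flatMap_cons, List.cons_append, List.dropWhile_cons_of_neg (by simp)]⟩
      · obtain ⟨r, hr⟩ := ih (by simpa [hpp] using hl)
        refine ⟨r, ?_⟩
        rw [List.flatMap_cons, List.cons_append, List.dropWhile_cons_of_pos,
          List.dropWhile_append_of_pos, hr]
        · intro i hi
          have := D.body_ne_label p' (D.lbl p)
          simp only [ne_eq, decide_eq_true_eq]
          rintro rfl
          exact this hi
        · simp only [ne_eq, Instr.label.injEq, decide_eq_true_eq]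
          exact fun hl' => hpp (D.lbl_inj hp hl'.symm)
  obtain ⟨r, hr⟩ := h D.pts hp
  exact ⟨r, by rw [Transaction.seek, tx, List.dropWhile_cons_of_pos (by simp)]; exact hr⟩

theorem obj_mem_writeSet (k : Option K) : D.obj k ∈ D.tx.writeSet := by simp [tx]

theorem obj_mem_readSet (k : Option K) : D.obj k ∈ D.tx.readSet := by simp [tx]

end Compiler

/-- `VRun gs tx o r s r' s' n`: the virtual machine comes from the instructions `r` and the state
`s` to the instructions `r'` and the state `s'` with at most `n` units of gas and without using the
object `o`. -/
def VRun (gs : GasSchedule) (tx : Transaction) (o : ObjId) (r : List Instr) (s : State)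
    (r' : List Instr) (s' : State) (n : ℕ) : Prop :=
  ∃ t ≤ n, ∀ G ur uw, o ∉ ur → o ∉ uw → ∃ ur' uw', o ∉ ur' ∧ o ∉ uw' ∧
    Reaches (step gs tx) ⟨r, s, G + t, ur, uw⟩ ⟨r', s', G, ur', uw'⟩

section
variable {gs : GasSchedule} {tx : Transaction} {o : ObjId} {r r' r'' : List Instr}
  {s s' s'' : State} {n n' : ℕ}

theorem VRun.refl : VRun gs tx o r s r s 0 :=
  ⟨0, le_rfl, fun _ ur uw hr hw => ⟨ur, uw, hr, hw, .refl⟩⟩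

theorem VRun.trans (h : VRun gs tx o r s r' s' n) (h' : VRun gs tx o r' s' r'' s'' n') :
    VRun gs tx o r s r'' s'' (n + n') := by
  obtain ⟨t, ht, h⟩ := h
  obtain ⟨t', ht', h'⟩ := h'
  refine ⟨t + t', by omega, fun G ur uw hr hw => ?_⟩
  obtain ⟨ur', uw', hr', hw', h1⟩ := h (G + t') ur uw hr hw
  obtain ⟨ur'', uw'', hr'', hw'', h2⟩ := h' G ur' uw' hr' hw'
  refine ⟨ur'', uw'', hr'', hw'', ?_⟩
  rw [show G + (t + t') = G + t' + t by omega]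
  exact h1.trans h2

theorem VRun.mono (h : VRun gs tx o r s r' s' n) (hn : n ≤ n') : VRun gs tx o r s r' s' n' :=
  let ⟨t, ht, h⟩ := h
  ⟨t, ht.trans hn, h⟩

theorem vrun_label (ℓ : Label) (r : List Instr) (s : State) :
    VRun gs tx o (.label ℓ :: r) s r s (gs.cost .label) :=
  ⟨_, le_rfl, fun _ ur uw hr hw => ⟨ur, uw, hr, hw, .single (by simp [step, Instr.op])⟩⟩

theorem vrun_jump {ℓ : Label} (h : tx.seek ℓ = .label ℓ :: r') (r : List Instr) (s : State) :
    VRun gs tx o (.jump ℓ :: r) s r' s (gs.cost .jump + gs.cost .label) := by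
  refine VRun.trans (r' := .label ℓ :: r') (s' := s) ?_ (vrun_label _ _ _)
  exact ⟨_, le_rfl, fun _ ur uw hr hw => ⟨ur, uw, hr, hw, .single (by simp [step, Instr.op, h])⟩⟩

theorem vrun_push {o' : ObjId} (h : o' ∈ tx.writeSet) (ho : o ≠ o') (b : Bool) (r : List Instr)
    (s : State) : VRun gs tx o (.push o' b :: r) s r (Function.update s o' (b :: s o'))
      (gs.cost .push) :=
  ⟨_, le_rfl, fun _ ur uw hr hw => ⟨ur, insert o' uw, hr, by simp [ho, hw],
    .single (by simp [step, Instr.op, h])⟩⟩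

theorem vrun_pop {o' : ObjId} (h : o' ∈ tx.writeSet) (ho : o ≠ o') (r : List Instr)
    (s : State) : VRun gs tx o (.pop o' :: r) s r (Function.update s o' (s o').tail)
      (gs.cost .pop) :=
  ⟨_, le_rfl, fun _ ur uw hr hw => ⟨ur, insert o' uw, hr, by simp [ho, hw],
    .single (by simp [step, Instr.op, h])⟩⟩

theorem vrun_read_nil {o' : ObjId} (h : o' ∈ tx.readSet) (ho : o ≠ o') (ℓ ℓ' : Label)
    (r : List Instr) (s : State) (hs : s o' = []) :
    VRun gs tx o (.read o' ℓ ℓ' :: r) s r s (gs.cost .read) :=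
  ⟨_, le_rfl, fun _ ur uw hr hw => ⟨insert o' ur, uw, by simp [ho, hr], hw,
    .single (by simp [step, Instr.op, h, hs])⟩⟩

theorem vrun_read_cons {o' : ObjId} (h : o' ∈ tx.readSet) (ho : o ≠ o') {ℓ ℓ' : Label} {b : Bool}
    {x : Value} (r : List Instr) (s : State) (hs : s o' = b :: x)
    (hl : tx.seek (cond b ℓ' ℓ) = .label (cond b ℓ' ℓ) :: r') :
    VRun gs tx o (.read o' ℓ ℓ' :: r) s r' s (gs.cost .read + gs.cost .label) := by
  refine VRun.trans (r' := .label (cond b ℓ' ℓ) :: r') (s' := s) ?_ (vrun_label _ _ _)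
  refine ⟨_, le_rfl, fun _ ur uw hr hw => ⟨insert o' ur, uw, by simp [ho, hr], hw, .single ?_⟩⟩
  cases b <;> simp [step, Instr.op, h, hs] <;> simpa using hl

theorem exists_step_push {G : ℕ} (h : o ∈ tx.writeSet) (hG : gs.cost .push ≤ G) (b : Bool)
    (r : List Instr) (s : State) (ur uw : Finset ObjId) :
    ∃ d, step gs tx ⟨.push o b :: r, s, G, ur, uw⟩ = some d ∧ o ∈ d.usedWrite := by
  simp [step, Instr.op, h, Nat.not_lt.2 hG]

theorem used_mono {c d : Cfg} (h : Reaches (step gs tx) c d) :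
    c.usedRead ⊆ d.usedRead ∧ c.usedWrite ⊆ d.usedWrite := by
  induction h with
  | refl => exact ⟨subset_rfl, subset_rfl⟩
  | @tail d e _ hde ih =>
    refine ⟨ih.1.trans ?_, ih.2.trans ?_⟩ <;>
    · obtain ⟨rest, st, gas, ur, uw⟩ := d
      rcases rest with _ | ⟨i, is⟩
      · simp [step] at hde
      · simp only [step] at hde
        split at hde
        · cases hde
        · cases i <;> simp only [Option.mem_def, reduceCtorEq] at hde <;> (try split_ifs at hde) <;>
            (try cases hde) <;> simp

/-- If the virtual machine stops without having used `o`, then `o` is not accessed. -/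
theorem not_acc_of_reaches {c d : Cfg} (h : Reaches (step gs tx) c d) (hd : step gs tx d = none)
    (hr : o ∉ d.usedRead) (hw : o ∉ d.usedWrite) : ¬ Acc gs tx o c := by
  rintro ⟨e, he, hu⟩
  rcases reaches_total he h with h1 | h1
  · have := used_mono h1
    rcases hu with hu | hu
    · exact hr (this.1 hu)
    · exact hw (this.2 hu)
  · rcases Relation.ReflTransGen.cases_head h1 with rfl | ⟨f, hf, -⟩
    · tauto
    · rw [hd] at hf; cases hf

end

namespace Compiler

variable {K : Type} [Fintype K] {Γ : K → Type} {Λ σ : Type} [Fintype σ]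
  (D : Compiler Γ Λ σ) {gs : GasSchedule}

/-- A bound for the prices. -/
def maxCost (gs : GasSchedule) : ℕ := Finset.univ.sup gs.cost

theorem cost_le (p : Op) : gs.cost p ≤ maxCost gs := Finset.le_sup (Finset.mem_univ p)

theorem target_ne (k : K) : D.obj none ≠ D.obj (some k) := fun h => by
  simpa using D.obj_injective h

local notation "run" => VRun gs D.tx (D.obj none)

/-- Jumping to a program point. -/
theorem vrun_jump {p : TM2.Stmt Γ Λ σ × σ × Phase} (hp : p ∈ D.pts) (r : List Instr) (s : State) :
    ∃ r', run (.jump (D.lbl p) :: r) s (D.body p ++ r') s (2 * maxCost gs) := by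
  obtain ⟨r', h⟩ := D.seek_lbl hp
  have h1 := cost_le (gs := gs) .jump
  have h2 := cost_le (gs := gs) .label
  exact ⟨r', (ObjectUsage.vrun_jump h r s).mono (by omega)⟩

theorem vrun_pushes (k : K) (n : ℕ) (r : List Instr) (s : State) :
    run (List.replicate n (.push (D.obj (some k)) true) ++ r) s r
      (Function.update s (D.obj (some k)) (List.replicate n true ++ s (D.obj (some k))))
      (n * maxCost gs) := by
  induction n generalizing s with
  | zero => simpa using VRun.refl
  | succ n ih =>
    have h1 := vrun_push (gs := gs) (D.obj_mem_writeSet (some k)) (D.target_ne k) true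
      (List.replicate n (.push (D.obj (some k)) true) ++ r) s
    have h2 := (h1.trans (ih _)).mono (n' := (n + 1) * maxCost gs) (by
      have := cost_le (gs := gs) .push
      rw [Nat.succ_mul]; omega)
    rw [List.replicate_succ, List.cons_append]
    convert h2 using 1
    rw [Function.update_self, Function.update_idem, List.replicate_succ']
    simp

theorem vrun_pushCode {k : K} {a : Γ k} (ha : ⟨k, a⟩ ∈ D.syms) (r : List Instr) (s : State) :
    run (D.pushCode ⟨k, a⟩ ++ r) s r
      (Function.update s (D.obj (some k)) (D.bits ⟨k, a⟩ ++ s (D.obj (some k))))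
      (D.syms.card * maxCost gs) := by
  have h1 := vrun_push (gs := gs) (D.obj_mem_writeSet (some k)) (D.target_ne k) false
    (List.replicate (D.code ⟨k, a⟩) (.push (D.obj (some k)) true) ++ r) s
  have h2 := (h1.trans (D.vrun_pushes k _ _ _)).mono (n' := D.syms.card * maxCost gs) (by
    have := Nat.mul_le_mul_right (maxCost gs) (Nat.succ_le_of_lt (D.code_lt ha))
    have := cost_le (gs := gs) .push
    rw [Nat.succ_mul] at *
    omega)
  simpa [pushCode, bits] using h2

/-- Removing a leading one. -/
theorem vrun_one {q : TM2.Stmt Γ Λ σ} (hq : q ∈ D.stmts) {k : K}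
    {f : σ → Option (Γ k) → List Instr} (hr : D.reader q = some ⟨k, f⟩) (v : σ) {j : ℕ}
    (hj : j < D.syms.card) (r : List Instr) {s : State} {x : Value}
    (hs : s (D.obj (some k)) = true :: x) :
    ∃ r', run (D.body (q, v, .dec j) ++ r) s (D.body (q, v, .dec (j + 1)) ++ r')
      (Function.update s (D.obj (some k)) x) (5 * maxCost gs) := by
  have hp : (q, v, .one j) ∈ D.pts := D.mem_pts hq v hj.le
  have hp' : (q, v, .dec (j + 1)) ∈ D.pts := D.mem_pts hq v (Nat.succ_le_of_lt hj)
  obtain ⟨r1, h1⟩ := D.seek_lbl hp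
  have h2 := vrun_read_cons (gs := gs) (D.obj_mem_readSet (some k)) (D.target_ne k)
    (ℓ := D.lbl (q, v, .zero j)) (ℓ' := D.lbl (q, v, .one j)) (b := true) (f v none ++ r) s hs h1
  have hb : D.body (q, v, .one j) = [.pop (D.obj (some k)), .jump (D.lbl (q, v, .dec (j + 1)))] := by
    simp [body, hr]
  rw [hb] at h2
  obtain ⟨r2, h3⟩ := D.vrun_jump (gs := gs) hp' r1 (Function.update s (D.obj (some k)) x)
  have h4 := vrun_pop (gs := gs) (D.obj_mem_writeSet (some k)) (D.target_ne k)
    (.jump (D.lbl (q, v, .dec (j + 1))) :: r1) s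
  rw [hs] at h4
  have h5 := (h2.trans h4).trans h3
  refine ⟨r2, ?_⟩
  have c1 := cost_le (gs := gs) .read
  have c2 := cost_le (gs := gs) .label
  have c3 := cost_le (gs := gs) .pop
  have h6 := h5.mono (n' := 5 * maxCost gs) (by omega)
  simpa [body, hr] using h6

/-- Removing the zero at the end of the code of a symbol: the symbol is now known. -/
theorem vrun_zero {q : TM2.Stmt Γ Λ σ} (hq : q ∈ D.stmts) {k : K}
    {f : σ → Option (Γ k) → List Instr} (hr : D.reader q = some ⟨k, f⟩) (v : σ) {a : Γ k}
    (ha : ⟨k, a⟩ ∈ D.syms) (r : List Instr) {s : State} {x : Value}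
    (hs : s (D.obj (some k)) = false :: x) :
    ∃ r', run (D.body (q, v, .dec (D.code ⟨k, a⟩)) ++ r) s (f v (some a) ++ r')
      (Function.update s (D.obj (some k)) x) (3 * maxCost gs) := by
  have hp : (q, v, .zero (D.code ⟨k, a⟩)) ∈ D.pts := D.mem_pts hq v (D.code_lt ha).le
  obtain ⟨r1, h1⟩ := D.seek_lbl hp
  have h2 := vrun_read_cons (gs := gs) (D.obj_mem_readSet (some k)) (D.target_ne k)
    (ℓ := D.lbl (q, v, .zero (D.code ⟨k, a⟩))) (ℓ' := D.lbl (q, v, .one (D.code ⟨k, a⟩)))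
    (b := false) (f v none ++ r) s hs h1
  have hb : D.body (q, v, .zero (D.code ⟨k, a⟩)) = .pop (D.obj (some k)) :: f v (some a) := by
    have h : ∃ b, ⟨k, b⟩ ∈ D.syms ∧ D.code ⟨k, b⟩ = D.code ⟨k, a⟩ := ⟨a, ha, rfl⟩
    have hc : h.choose = a := by
      simpa using D.code_inj h.choose_spec.1 h.choose_spec.2
    simp only [body, hr, Option.elim_some]
    rw [dif_pos h, hc]
  rw [hb] at h2
  have h4 := vrun_pop (gs := gs) (D.obj_mem_writeSet (some k)) (D.target_ne k)
    (f v (some a) ++ r1) s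
  rw [hs] at h4
  refine ⟨r1, ?_⟩
  have c1 := cost_le (gs := gs) .read
  have c2 := cost_le (gs := gs) .label
  have c3 := cost_le (gs := gs) .pop
  have h6 := (h2.trans h4).mono (n' := 3 * maxCost gs) (by omega)
  simpa [body, hr] using h6

/-- Popping a symbol of whose code `j` ones have been removed already. -/
theorem vrun_dec {q : TM2.Stmt Γ Λ σ} (hq : q ∈ D.stmts) {k : K}
    {f : σ → Option (Γ k) → List Instr} (hr : D.reader q = some ⟨k, f⟩) (v : σ) {a : Γ k}
    (ha : ⟨k, a⟩ ∈ D.syms) {i j : ℕ} (hij : i + j = D.code ⟨k, a⟩) (r : List Instr) {s : State}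
    {x : Value} (hs : s (D.obj (some k)) = List.replicate i true ++ false :: x) :
    ∃ r', run (D.body (q, v, .dec j) ++ r) s (f v (some a) ++ r')
      (Function.update s (D.obj (some k)) x) (5 * maxCost gs * i + 3 * maxCost gs) := by
  induction i generalizing j r s with
  | zero =>
    obtain rfl : j = D.code ⟨k, a⟩ := by omega
    simpa using D.vrun_zero hq hr v ha r hs
  | succ i ih =>
    have := D.code_lt ha
    obtain ⟨r1, h1⟩ := D.vrun_one (gs := gs) hq hr v (j := j) (by omega) r hs
    obtain ⟨r2, h2⟩ := ih (j := j + 1) (by omega) r1 (Function.update_self ..)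
    refine ⟨r2, ?_⟩
    have hn : 5 * maxCost gs * (i + 1) = 5 * maxCost gs * i + 5 * maxCost gs := Nat.mul_succ _ _
    have h3 := (h1.trans h2).mono (n' := 5 * maxCost gs * (i + 1) + 3 * maxCost gs) (by omega)
    simpa only [Function.update_idem] using h3

/-- The state represents the stacks `S`. -/
def Rep (s : State) (S : ∀ k, List (Γ k)) : Prop :=
  ∀ k, s (D.obj (some k)) = D.value k (S k) ∧ ∀ a ∈ S k, ⟨k, a⟩ ∈ D.syms

variable [DecidableEq K] in
theorem Rep.update {s : State} {S : ∀ k, List (Γ k)} (h : D.Rep s S) {k : K} {l : List (Γ k)}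
    (hl : ∀ a ∈ l, ⟨k, a⟩ ∈ D.syms) :
    D.Rep (Function.update s (D.obj (some k)) (D.value k l)) (Function.update S k l) := by
  intro k'
  by_cases hk : k' = k
  · subst hk
    simpa using hl
  · have : D.obj (some k') ≠ D.obj (some k) := fun h => hk (by simpa using D.obj_injective h)
    simpa [hk, this] using h k'

/-- A bound for the gas that is needed to pop a symbol: the code of a symbol has at most as many ones
as there are symbols, removing a one takes five instructions, and there is a constant overhead. -/
def popCost (gs : GasSchedule) : ℕ := (5 * D.syms.card + 5) * maxCost gs

/-- Executing a statement up to the point where the popped symbol is known. -/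
theorem vrun_reader {q : TM2.Stmt Γ Λ σ} (hq : q ∈ D.stmts) {k : K}
    {f : σ → Option (Γ k) → List Instr} (hr : D.reader q = some ⟨k, f⟩) (v : σ) (r : List Instr)
    {s : State} {S : ∀ k, List (Γ k)} (h : D.Rep s S) :
    ∃ r', run (D.body (q, v, .run) ++ r) s (f v (S k).head? ++ r')
      (Function.update s (D.obj (some k)) (D.value k (S k).tail)) (D.popCost gs) := by
  have hb : D.body (q, v, .run) = [.jump (D.lbl (q, v, .dec 0))] := by
    cases q <;> simp [reader, body] at hr ⊢
  have hp : (q, v, .dec 0) ∈ D.pts := D.mem_pts hq v (Nat.zero_le _)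
  obtain ⟨r1, h1⟩ := D.vrun_jump (gs := gs) hp r s
  change run ([.jump (D.lbl (q, v, .dec 0))] ++ r) s _ s _ at h1
  rw [← hb] at h1
  obtain ⟨hs, hS⟩ := h k
  rcases hl : S k with _ | ⟨a, l⟩
  · rw [hl] at hs
    have hs' : s (D.obj (some k)) = [] := by simpa [value] using hs
    have h2 := vrun_read_nil (gs := gs) (D.obj_mem_readSet (some k)) (D.target_ne k)
      (D.lbl (q, v, .zero 0)) (D.lbl (q, v, .one 0)) (f v none ++ r1) s hs'
    refine ⟨r1, ?_⟩
    have c1 := cost_le (gs := gs) .read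
    have h3 : D.body (q, v, .dec 0) = .read (D.obj (some k)) (D.lbl (q, v, .zero 0))
      (D.lbl (q, v, .one 0)) :: f v none := by simp [body, hr]
    rw [h3] at h1
    have h4 := (h1.trans h2).mono (n' := D.popCost gs) (by rw [popCost, Nat.add_mul]; omega)
    rw [List.tail_nil, ← hs, Function.update_eq_self]
    exact h4
  · have ha := hS a (by simp [hl])
    rw [hl] at hs
    have hs' : s (D.obj (some k)) = List.replicate (D.code ⟨k, a⟩) true ++ false :: D.value k l := by
      simpa [value, bits] using hs
    obtain ⟨r2, h2⟩ := D.vrun_dec (gs := gs) hq hr v ha (i := D.code ⟨k, a⟩) (j := 0) rfl r1 hs'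
    refine ⟨r2, (h1.trans h2).mono ?_⟩
    have := Nat.mul_le_mul_left (5 * maxCost gs) (D.code_lt ha).le
    rw [Nat.mul_right_comm 5 _ D.syms.card] at this
    rw [popCost, Nat.add_mul]
    omega

/-- The program point that belongs to a configuration of the stack machine. -/
def point (c : TM2.Cfg Γ Λ σ) : TM2.Stmt Γ Λ σ × σ × Phase :=
  (c.l.elim .halt D.prog, c.var, .run)

variable [DecidableEq K]

/-- Executing a statement. -/
theorem exists_vrun_stmt (q : TM2.Stmt Γ Λ σ) (hq : q ∈ D.stmts) :
    ∃ n, ∀ v S s r, D.Rep s S → ∃ r' s', D.Rep s' (TM2.stepAux q v S).stk ∧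
      run (D.body (q, v, .run) ++ r) s (D.body (D.point (TM2.stepAux q v S)) ++ r') s' n := by
  have hjump (q' : TM2.Stmt Γ Λ σ) (hq' : q' ∈ D.stmts) (v : σ) (r : List Instr) (s : State) :
      ∃ r', run ([.jump (D.lbl (q', v, .run))] ++ r) s (D.body (q', v, .run) ++ r') s
        (2 * maxCost gs) := D.vrun_jump (D.mem_pts hq' v trivial) r s
  induction q with
  | push k f q ih =>
    have hq' := D.sub_mem _ hq (show q ∈ _ by simp [TM2.stmts₁, TM2.stmts₁_self])
    obtain ⟨n, ih⟩ := ih hq'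
    refine ⟨D.syms.card * maxCost gs + 2 * maxCost gs + n, fun v S s r h => ?_⟩
    have ha := D.push_mem k f q hq v
    have h1 := D.vrun_pushCode (gs := gs) ha ([.jump (D.lbl (q, v, .run))] ++ r) s
    obtain ⟨r2, h2⟩ := hjump q hq' v r
      (Function.update s (D.obj (some k)) (D.value k (f v :: S k)))
    obtain ⟨r3, s3, h3, h4⟩ := ih v (Function.update S k (f v :: S k)) _ r2 (h.update D (k := k)
      (l := f v :: S k) (by
        intro a ha'
        rcases List.mem_cons.1 ha' with rfl | ha'
        · exact ha
        · exact (h k).2 a ha'))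
    rw [(h k).1] at h1
    refine ⟨r3, s3, h3, ?_⟩
    simpa [body, TM2.stepAux] using (h1.trans h2).trans h4
  | peek k f q ih =>
    have hq' := D.sub_mem _ hq (show q ∈ _ by simp [TM2.stmts₁, TM2.stmts₁_self])
    obtain ⟨n, ih⟩ := ih hq'
    refine ⟨D.popCost gs + (D.syms.card * maxCost gs + 2 * maxCost gs) + n, fun v S s r h => ?_⟩
    obtain ⟨r1, h1⟩ := D.vrun_reader (gs := gs) hq rfl v r h
    obtain ⟨r2, h2⟩ := hjump q hq' (f v (S k).head?) r1 s
    obtain ⟨r3, s3, h3, h4⟩ := ih (f v (S k).head?) S s r2 h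
    refine ⟨r3, s3, h3, (h1.trans ?_).trans h4⟩
    rcases hl : S k with _ | ⟨a, l⟩
    · have hs := (h k).1
      rw [hl] at hs
      rw [hl] at h2
      rw [List.tail_nil, ← hs, Function.update_eq_self]
      exact h2.mono (by omega)
    · have hs := (h k).1
      rw [hl] at hs h2
      have h5 := D.vrun_pushCode (gs := gs) ((h k).2 a (by simp [hl]))
        ([.jump (D.lbl (q, f v (some a), .run))] ++ r1)
        (Function.update s (D.obj (some k)) (D.value k l))
      rw [Function.update_self, Function.update_idem, show D.bits ⟨k, a⟩ ++ D.value k l =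
        s (D.obj (some k)) by simp [hs, value], Function.update_eq_self] at h5
      simpa using h5.trans h2
  | pop k f q ih =>
    have hq' := D.sub_mem _ hq (show q ∈ _ by simp [TM2.stmts₁, TM2.stmts₁_self])
    obtain ⟨n, ih⟩ := ih hq'
    refine ⟨D.popCost gs + 2 * maxCost gs + n, fun v S s r h => ?_⟩
    obtain ⟨r1, h1⟩ := D.vrun_reader (gs := gs) hq rfl v r h
    obtain ⟨r2, h2⟩ := hjump q hq' (f v (S k).head?) r1
      (Function.update s (D.obj (some k)) (D.value k (S k).tail))
    obtain ⟨r3, s3, h3, h4⟩ := ih (f v (S k).head?) (Function.update S k (S k).tail) _ r2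
      (h.update D fun a ha => (h k).2 a (List.mem_of_mem_tail ha))
    exact ⟨r3, s3, h3, (h1.trans h2).trans h4⟩
  | load f q ih =>
    have hq' := D.sub_mem _ hq (show q ∈ _ by simp [TM2.stmts₁, TM2.stmts₁_self])
    obtain ⟨n, ih⟩ := ih hq'
    refine ⟨2 * maxCost gs + n, fun v S s r h => ?_⟩
    obtain ⟨r2, h2⟩ := hjump q hq' (f v) r s
    obtain ⟨r3, s3, h3, h4⟩ := ih (f v) S s r2 h
    exact ⟨r3, s3, h3, h2.trans h4⟩
  | branch f q q' ih ih' =>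
    have hq1 := D.sub_mem _ hq (show q ∈ _ by simp [TM2.stmts₁, TM2.stmts₁_self])
    have hq2 := D.sub_mem _ hq (show q' ∈ _ by simp [TM2.stmts₁, TM2.stmts₁_self])
    obtain ⟨n, ih⟩ := ih hq1
    obtain ⟨n', ih'⟩ := ih' hq2
    refine ⟨2 * maxCost gs + (n + n'), fun v S s r h => ?_⟩
    rcases hf : f v with _ | _
    · obtain ⟨r2, h2⟩ := hjump q' hq2 v r s
      obtain ⟨r3, s3, h3, h4⟩ := ih' v S s r2 h
      refine ⟨r3, s3, by simpa [TM2.stepAux, hf] using h3, ?_⟩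
      simpa [body, TM2.stepAux, hf] using (h2.trans h4).mono (by omega)
    · obtain ⟨r2, h2⟩ := hjump q hq1 v r s
      obtain ⟨r3, s3, h3, h4⟩ := ih v S s r2 h
      refine ⟨r3, s3, by simpa [TM2.stepAux, hf] using h3, ?_⟩
      simpa [body, TM2.stepAux, hf] using (h2.trans h4).mono (by omega)
  | goto f =>
    refine ⟨2 * maxCost gs, fun v S s r h => ?_⟩
    obtain ⟨r2, h2⟩ := hjump (D.prog (f v)) (D.prog_mem _) v r s
    exact ⟨r2, s, h, h2⟩
  | halt =>
    exact ⟨0, fun v S s r h => ⟨r, s, h, VRun.refl⟩⟩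

/-- A bound for the gas that is needed to simulate one step of the stack machine. -/
theorem exists_vrun_step : ∃ n, ∀ c c' s r, TM2.step D.prog c = some c' →
    D.Rep s c.stk → ∃ r' s', D.Rep s' c'.stk ∧
      run (D.body (D.point c) ++ r) s (D.body (D.point c') ++ r') s' n := by
  choose n hn using D.exists_vrun_stmt (gs := gs)
  refine ⟨D.stmts.attach.sup fun q => n q.1 q.2, ?_⟩
  rintro ⟨_ | l, v, S⟩ c' s r hc h
  · cases hc
  · cases hc
    obtain ⟨r', s', h1, h2⟩ := hn _ (D.prog_mem l) v S s r h
    exact ⟨r', s', h1, h2.mono (Finset.le_sup (f := fun q : D.stmts => n q.1 q.2)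
      (Finset.mem_attach _ ⟨D.prog l, D.prog_mem l⟩))⟩

/-- If the stack machine halts after `n` steps, then the transaction uses the object `obj none`
if and only if the machine accepts, provided that the gas suffices for the simulation. -/
theorem exists_acc_iff : ∃ m, ∀ n S v S' s G,
    (flip bind (TM2.step D.prog))^[n] (some ⟨some D.main, D.var, S⟩) = some ⟨none, v, S'⟩ →
    D.Rep s S → m * (n + 1) ≤ G →
    (Acc gs D.tx (D.obj none) (start D.tx s G) ↔ (S' D.out).head? = some D.acc) := by
  obtain ⟨m, hm⟩ := D.exists_vrun_step (gs := gs)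
  have hsteps (n : ℕ) (c c' : TM2.Cfg Γ Λ σ) (s : State) (r : List Instr)
      (hc : (flip bind (TM2.step D.prog))^[n] (some c) = some c') (h : D.Rep s c.stk) :
      ∃ r' s', D.Rep s' c'.stk ∧
        run (D.body (D.point c) ++ r) s (D.body (D.point c') ++ r') s' (m * n) := by
    induction n generalizing c s r with
    | zero =>
      cases hc
      exact ⟨r, s, h, VRun.refl⟩
    | succ n ih =>
      rw [Function.iterate_succ_apply] at hc
      rcases hd : TM2.step D.prog c with _ | d
      · have hnone : (flip bind (TM2.step D.prog))^[n] none = none :=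
          Function.iterate_fixed rfl n
        have : flip bind (TM2.step D.prog) (some c) = none := hd
        rw [this, hnone] at hc
        cases hc
      · have : flip bind (TM2.step D.prog) (some c) = some d := hd
        rw [this] at hc
        obtain ⟨r1, s1, h1, h2⟩ := hm c d s r hd h
        obtain ⟨r2, s2, h3, h4⟩ := ih d s1 r1 hc h1
        exact ⟨r2, s2, h3, (h2.trans h4).mono (by rw [Nat.mul_succ]; omega)⟩
  refine ⟨m + D.popCost gs + 3 * maxCost gs, fun n S v S' s G hc h hG => ?_⟩
  obtain ⟨r0, h0⟩ := D.vrun_jump (gs := gs) (p := D.point ⟨some D.main, D.var, S⟩)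
    (D.mem_pts (D.prog_mem _) _ trivial)
    (D.pts.flatMap fun p => .label (D.lbl p) :: D.body p) s
  obtain ⟨r1, s1, h1, h2⟩ := hsteps n _ _ s r0 hc h
  obtain ⟨r3, h3⟩ := D.vrun_reader (gs := gs) D.halt_mem rfl v r1 h1
  have h4 := (h0.trans h2).trans h3
  obtain ⟨t, ht, h4⟩ := h4
  have hG' : t + maxCost gs ≤ G := by
    refine le_trans ?_ hG
    refine le_trans (b := m * n + (D.popCost gs + 3 * maxCost gs)) (by omega) ?_
    rw [Nat.add_assoc, Nat.add_mul]
    exact Nat.add_le_add (Nat.mul_le_mul_left _ n.le_succ) (Nat.le_mul_of_pos_right _ n.succ_pos)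
  obtain ⟨G', rfl⟩ := Nat.exists_eq_add_of_le hG'
  obtain ⟨ur, uw, hr, hw, h5⟩ := h4 (maxCost gs + G') ∅ ∅ (by simp) (by simp)
  rw [show maxCost gs + G' + t = t + maxCost gs + G' by omega] at h5
  change Reaches _ (start D.tx s _) _ at h5
  by_cases ha : (S' D.out).head? = some D.acc
  · simp only [ha, iff_true]
    rw [if_pos ha] at h5
    have hle := cost_le (gs := gs) .push
    obtain ⟨d, hd, hu⟩ : ∃ d, step gs D.tx _ = some d ∧ D.obj none ∈ d.usedWrite :=
      exists_step_push (D.obj_mem_writeSet none) (G := maxCost gs + G') (by omega) _ _ _ _ _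
    exact ⟨d, h5.tail hd, .inr hu⟩
  · simp only [ha, iff_false]
    rw [if_neg ha] at h5
    exact not_acc_of_reaches h5 (by simp [step]) hr hw

end Compiler

/-! ### Hardness -/

open Classical in
/-- The symbols that a statement pushes in its first step. -/
noncomputable def pushed {K : Type} {Γ : K → Type} {Λ σ : Type} [Fintype σ] :
    TM2.Stmt Γ Λ σ → Finset (Σ k, Γ k)
  | .push k f _ => Finset.univ.image fun v => ⟨k, f v⟩
  | _ => ∅

theorem mem_pushed {K : Type} {Γ : K → Type} {Λ σ : Type} [Fintype σ] (k : K) (f : σ → Γ k)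
    (q : TM2.Stmt Γ Λ σ) (v : σ) : ⟨k, f v⟩ ∈ pushed (.push k f q) := by
  simp [pushed]

open Classical in
/-- The translation data for a Turing machine. The alphabets of the stacks other than the input
stack may be infinite, but only the letters of the input and the symbols that some statement pushes
can occur on a stack, and these are finitely many. -/
noncomputable def Compiler.ofMachine (tm : FinTM2) (acc : tm.Γ tm.k₁) :
    @Compiler tm.K tm.kFin tm.Γ tm.Λ tm.σ tm.σFin :=
  letI := tm.kFin
  letI := tm.σFin
  letI := tm.ΛFin
  letI := tm.Γk₀Fin
  let stmts : Finset (TM2.Stmt tm.Γ tm.Λ tm.σ) :=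
    insert .halt (Finset.univ.biUnion fun l => TM2.stmts₁ (tm.m l))
  { prog := tm.m
    main := tm.main
    var := tm.initialState
    out := tm.k₁
    acc := acc
    stmts := stmts
    syms := Finset.univ.image (fun a : tm.Γ tm.k₀ => ⟨tm.k₀, a⟩) ∪ stmts.biUnion pushed
    obj := fun k => List.replicate (Fintype.equivFin (Option tm.K) k) true
    obj_injective := fun k k' h => by
      simpa [Fin.val_inj] using congrArg List.length h
    halt_mem := Finset.mem_insert_self ..
    prog_mem := fun l => Finset.mem_insert_of_mem
      (Finset.mem_biUnion.2 ⟨l, Finset.mem_univ l, TM2.stmts₁_self⟩)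
    sub_mem := fun q hq => by
      rcases Finset.mem_insert.1 hq with rfl | hq
      · simp [TM2.stmts₁, stmts]
      · obtain ⟨l, hl, hq⟩ := Finset.mem_biUnion.1 hq
        exact fun q' hq' => Finset.mem_insert_of_mem
          (Finset.mem_biUnion.2 ⟨l, hl, TM2.stmts₁_trans hq hq'⟩)
    push_mem := fun k f q hq v => Finset.mem_union_right _
      (Finset.mem_biUnion.2 ⟨_, hq, mem_pushed k f q v⟩) }

/-- A polynomial is bounded by the sum of its coefficients times a power. -/
theorem exists_eval_le (p : Polynomial ℕ) : ∃ A e, ∀ n, p.eval n ≤ A * (n + 1) ^ e := by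
  refine ⟨∑ i ∈ Finset.range (p.natDegree + 1), p.coeff i, p.natDegree, fun n => ?_⟩
  rw [Polynomial.eval_eq_sum_range, Finset.sum_mul]
  refine Finset.sum_le_sum fun i hi => Nat.mul_le_mul_left _ ?_
  exact (Nat.pow_le_pow_left n.le_succ i).trans
    (Nat.pow_le_pow_right n.succ_pos (Nat.lt_succ_iff.1 (Finset.mem_range.1 hi)))

/-- Every language in P reduces to the Object Usage Decision Problem: the transaction simulates the
Turing machine, the value of one object is the input, and the gas limit exceeds the price of the
simulation. -/
theorem pHard_OUDP (gs : GasSchedule) : PHard (OUDP gs) := by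
  classical
  rintro α - L ⟨⟨tm, ia, oa⟩, time, hrun⟩
  dsimp only at hrun
  let := tm.kFin
  let := tm.σFin
  let := tm.Γk₀Fin
  set D := Compiler.ofMachine tm (oa.invFun true) with hD
  obtain ⟨m, hm⟩ := D.exists_acc_iff (gs := gs)
  obtain ⟨A, e, hA⟩ := exists_eval_le time
  obtain ⟨N, hN, hlog⟩ := exists_logSpaceComputable_pad
    (fun a : α => (D.bits ⟨tm.k₀, ia.invFun a⟩).map Tok.bit)
    (encBits (D.obj none) ++ encTx D.tx ++ encBits (D.obj (some tm.k₀))) [Tok.term, Tok.close]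
    Tok.one (2 * (m * (A + 1))) e
  refine ⟨_, hlog, fun w => ?_⟩
  -- The gas covers the simulation since `(n + 1) ^ e ≤ 2 * N n`.
  let x : Instance :=
    ⟨D.obj none, D.tx, [(D.obj (some tm.k₀), D.value tm.k₀ (w.map ia.invFun))],
      2 * (m * (A + 1)) * N w.length⟩
  have hx : x.encode = encBits (D.obj none) ++ encTx D.tx ++ encBits (D.obj (some tm.k₀)) ++
      w.flatMap (fun a : α => (D.bits ⟨tm.k₀, ia.invFun a⟩).map Tok.bit) ++ [Tok.term, Tok.close] ++
        List.replicate (2 * (m * (A + 1)) * N w.length) Tok.one := by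
    simp [x, Instance.encode, encList, encEntry, encBits, Compiler.value, List.map_flatMap,
      List.flatMap_map]
  rw [← hx, mem_OUDP_encode]
  have h := (hrun w).evals_in_steps
  have hgas : m * ((hrun w).steps + 1) ≤ 2 * (m * (A + 1)) * N w.length := by
    have h1 : (hrun w).steps + 1 ≤ (A + 1) * (w.length + 1) ^ e := by
      have h2 := (hrun w).steps_le_m.trans (hA w.length)
      have h3 := Nat.one_le_pow e (w.length + 1) w.length.succ_pos
      rw [Nat.add_mul]
      omega
    calc m * ((hrun w).steps + 1) ≤ m * ((A + 1) * (2 * N w.length)) :=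
          Nat.mul_le_mul_left _ (h1.trans (Nat.mul_le_mul_left _ (hN _)))
      _ = _ := by ring
  have hrep : D.Rep (stateOf x.state) (initList tm (w.map ia.invFun)).stk := by
    intro k
    by_cases hk : k = tm.k₀
    · subst hk
      have hS : (initList tm (w.map ia.invFun)).stk tm.k₀ = w.map ia.invFun := by simp [initList]
      rw [hS]
      refine ⟨by simp [stateOf, x], fun a _ => ?_⟩
      simp [hD, Compiler.ofMachine]
    · have hS : (initList tm (w.map ia.invFun)).stk k = [] := by simp [initList, hk]
      have ho : D.obj (some k) ≠ D.obj (some tm.k₀) := fun h => hk (by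
        simpa using D.obj_injective h)
      rw [hS]
      simp [stateOf, x, Compiler.value, List.lookup_cons, beq_false_of_ne ho]
  refine Iff.trans ?_ (hm _ _ _ _ _ _ h hrep hgas).symm
  have hout (l : List (tm.Γ tm.k₁)) : (haltList tm l).stk tm.k₁ = l := by simp [haltList]
  refine Iff.trans ?_ (iff_of_eq (congrArg (fun l => l.head? = some (oa.invFun true))
    (hout ((Computability.encodeBool (decide (w ∈ L))).map oa.invFun)))).symm
  by_cases hw : w ∈ L <;> simp [Computability.encodeBool, hw]

end ObjectUsage

theorem mainTheorem2 (gs : ObjectUsage.GasSchedule) :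
    ObjectUsage.PComplete (ObjectUsage.OUDP gs) :=
  ⟨ObjectUsage.inP_OUDP gs, ObjectUsage.pHard_OUDP gs⟩
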